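/- **Setting.** Let $L\ge 1$, $d_1,\dots,d_L\ge 1$, $p=\prod_k d_k$, $m_k=\prod_{i\ne k}d_i=p/d_k$, $d_{\max}=\max_k d_k$, $m_{\min}=\min_k m_k$. Write $\|\cdot\|_2$ and $\|\cdot\|_F$ for the operator and Frobenius norms, $\phi_{\min},\phi_{\max}$ for the extreme eigenvalues of a symmetric matrix, and $\kappa=\phi_{\max}/\phi_{\min}$ for the condition number of a positive definite matrix. Let $\Psi_k\in\mathbb R^{d_k\times d_k}$ be symmetric, let $$\Omega_0=\Psi_1\oplus\cdots\oplus\Psi_L=\sum_{k=1}^L I_{d_1}\otimes\cdots\otimes I_{d_{k-1}}\otimes\Psi_k\otimes I_{d_{k+1}}\otimes\cdots\otimes I_{d_L}$$ be their Kronecker sum, $\Sigma_0=\Omega_0^{-1}$, $s_k=|\{(i,j): i\ne j,\ \Psi_{k,ij}\neq 0\}|$ and $s=\sum_k m_ks_k$. One random tensor $\mathscr X\in\mathbb R^{d_1\times\cdots\times d_L}$ is observed ($n=1$), with $\mathrm{vec}(\mathscr X)=\Sigma_0^{1/2}Z$, where $Z\in\mathbb R^p$ has independent components with $\mathbb E Z_j=0$,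 $\mathbb E Z_j^2=1$ and $\|Z_j\|_{\psi_2}=\inf\{t>0:\mathbb E\exp(Z_j^2/t^2)\le 2\}\le K$. Let $\mathbf X^{(k)}\in\mathbb R^{d_k\times m_k}$ be the mode-$k$ unfolding of $\mathscr X$ (its columns are the mode-$k$ fibers), and let $S^k=\mathbf X^{(k)}\mathbf X^{(k)T}/m_k$. The TeraLasso estimator $\hat\Omega$ is a minimizer, over all positive definite $\Omega=B_1\oplus\cdots\oplus B_L$ with $B_k\in\mathbb R^{d_k\times d_k}$, of $$-\log|\Omega|+\sum_{k=1}^L m_k\Big(\langle S^k,B_k\rangle+\rho_k\sum_{i\ne j}|B_{k,ij}|\Big).$$ **Assumptions** (with constants $a_1,a_2,\varepsilon_0,C_3$). - (A1) $m_{\min}\ge\log p$, and $\rho_k=\delta_k/\varepsilon_k$ for all $k$, where $a_1\|\Sigma_0\|_2\sqrt{\log p/m_k}\le\delta_k\le a_2\|\Sigma_0\|_2\sqrt{\log p/m_k}$ and $\varepsilon_0\le\varepsilon_k<1$. - (A2) $0<\underline k_\Omega\le\phi_{\min}(\Omega_0)$ and $\phi_{\max}(\Omega_0)\le\overline k_\Omega<\infty$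 for some $\underline k_\Omega,\overline k_\Omega$. - (A3) $m_{\min}^2\ge C_3^2(L+1)\,\kappa(\Sigma_0)^4\,(s\log p+Lp)$. **Corollary (dependence on aspect ratio for $n=1$).** For every $K>0$ there are constants $a_1,c>0$, depending only on $K$, such that for all $a_2\ge a_1$ and $\varepsilon_0\in(0,1)$ there are constants $C_3,C>0$, depending only on $K,a_2,\varepsilon_0$, with the following property. In the setting above, if (A1), (A2) and (A3) hold, then with probability at least $1-L\exp(-c\log p)$ a minimizer $\hat\Omega$ exists and every minimizer satisfies $$\frac{\|\hat\Omega-\Omega_0\|_2}{\|\Omega_0\|_2}\vee\frac{\|\hat\Omega-\Omega_0\|_F}{\|\Omega_0\|_F}\le C\,\kappa(\Sigma_0)\Big(\frac{L\,d_{\max}}{m_{\min}}\Big)^{1/2}\Big(\sum_{k=1}^L\frac{s_k\log p}{d_k}+L\Big)^{1/2}.$$ -/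

import Mathlib

open MeasureTheory ProbabilityTheory

noncomputable section

namespace TeraLasso

/-! ### Matrix quantities -/

section MatrixQuantities

variable {ι : Type*} [Fintype ι] [DecidableEq ι]

/-- Smallest eigenvalue of a symmetric real matrix. -/
def phiMin (A : Matrix ι ι ℝ) : ℝ := sInf (spectrum ℝ A)

/-- Largest eigenvalue of a symmetric real matrix. -/
def phiMax (A : Matrix ι ι ℝ) : ℝ := sSup (spectrum ℝ A)

/-- Condition number of a positive definite matrix. -/
def kappa (A : Matrix ι ι ℝ) : ℝ := phiMax A / phiMin A

/-- Operator norm with respect to the Euclidean norm. -/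
def opNorm (A : Matrix ι ι ℝ) : ℝ := ‖Matrix.toEuclideanCLM (𝕜 := ℝ) A‖

/-- Frobenius norm. -/
def frobNorm (A : Matrix ι ι ℝ) : ℝ := √(∑ i, ∑ j, A i j ^ 2)

/-- Off-diagonal `ℓ₁` norm. -/
def offOne (A : Matrix ι ι ℝ) : ℝ := ∑ i, ∑ j, if i = j then 0 else |A i j|

/-- Number of non-zero off-diagonal entries. -/
def offSupp (A : Matrix ι ι ℝ) : ℕ := {ij : ι × ι | ij.1 ≠ ij.2 ∧ A ij.1 ij.2 ≠ 0}.ncard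

end MatrixQuantities

/-! ### Tensors of size `d 0 × ⋯ × d (L - 1)`

Entries of a tensor, and rows and columns of a `p × p` matrix, are indexed by multi-indices. -/

section Tensors

variable {L : ℕ}

/-- Multi-indices of a tensor with dimensions `d`; there are `p = ∏ k, d k` of them. -/
abbrev Idx (d : Fin L → ℕ) : Type := (k : Fin L) → Fin (d k)

/-- `p = ∏ k, d k`. -/
def pdim (d : Fin L → ℕ) : ℕ := ∏ k, d k

/-- `m k = ∏_{i ≠ k} d i`. -/
def mdim (d : Fin L → ℕ) (k : Fin L) : ℕ := ∏ i ∈ Finset.univ.erase k, d i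

def dmax (d : Fin L → ℕ) : ℕ := ⨆ k, d k

def mmin (d : Fin L → ℕ) : ℕ := ⨅ k, mdim d k

variable {d : Fin L → ℕ}

/-- Kronecker product `A 0 ⊗ ⋯ ⊗ A (L - 1)`. -/
def kronProd (A : (k : Fin L) → Matrix (Fin (d k)) (Fin (d k)) ℝ) : Matrix (Idx d) (Idx d) ℝ :=
  Matrix.of fun i j => ∏ k, A k (i k) (j k)

/-- Kronecker sum `B 0 ⊕ ⋯ ⊕ B (L - 1) = ∑ k, I ⊗ ⋯ ⊗ I ⊗ B k ⊗ I ⊗ ⋯ ⊗ I`. -/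
def kronSum (B : (k : Fin L) → Matrix (Fin (d k)) (Fin (d k)) ℝ) : Matrix (Idx d) (Idx d) ℝ :=
  ∑ k, kronProd (Function.update (fun _ => 1) k (B k))

/-- Mode-`k` unfolding: a `d k × m k` matrix whose columns are the mode-`k` fibers. -/
def unfolding (x : Idx d → ℝ) (k : Fin L) :
    Matrix (Fin (d k)) ((l : {l : Fin L // l ≠ k}) → Fin (d l)) ℝ :=
  Matrix.of fun a c => x ((Equiv.piSplitAt k fun l => Fin (d l)).symm (a, c))

/-- Mode-`k` Gram matrix of a single tensor. -/
def gram (x : Idx d → ℝ) (k : Fin L) : Matrix (Fin (d k)) (Fin (d k)) ℝ :=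
  (mdim d k : ℝ)⁻¹ • (unfolding x k * (unfolding x k).transpose)

/-- The penalized objective, as a function of the components of `Ω = B 0 ⊕ ⋯ ⊕ B (L - 1)`.
Its value depends on `Ω` only. -/
def objective (x : Idx d → ℝ) (ρ : Fin L → ℝ)
    (B : (k : Fin L) → Matrix (Fin (d k)) (Fin (d k)) ℝ) : ℝ :=
  -Real.log (kronSum B).det +
    ∑ k, (mdim d k : ℝ) * (((gram x k).transpose * B k).trace + ρ k * offOne (B k))

/-- `Ωhat` minimizes the objective over the positive definite Kronecker sums. -/
def IsTeraLasso (x : Idx d → ℝ) (ρ : Fin L → ℝ) (Ωhat : Matrix (Idx d) (Idx d) ℝ) : Prop :=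
  ∃ B : (k : Fin L) → Matrix (Fin (d k)) (Fin (d k)) ℝ,
    Ωhat = kronSum B ∧ (kronSum B).PosDef ∧
      ∀ B' : (k : Fin L) → Matrix (Fin (d k)) (Fin (d k)) ℝ,
        (kronSum B').PosDef → objective x ρ B ≤ objective x ρ B'

end Tensors

/-! ### The sub-gaussian model -/

section Model

variable {S : Type*} [MeasurableSpace S]

/-- The `ψ₂` norm `inf {t > 0 : E exp (Z² / t²) ≤ 2}`, equal to `⊤` if there is no such `t`. -/
def psi2Norm (μ : Measure S) (Z : S → ℝ) : ENNReal :=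
  ⨅ (t : ℝ) (_ : 0 < t) (_ : ∫⁻ ω, ENNReal.ofReal (Real.exp (Z ω ^ 2 / t ^ 2)) ∂μ ≤ 2),
    ENNReal.ofReal t

open scoped MatrixOrder in
/-- `vec X = Σ₀^{1/2} Z`, where the entries of `Z` are independent with mean zero, unit variance
and `ψ₂` norm at most `K`. -/
def IsSubgaussianTensor {ι : Type*} [Fintype ι] [DecidableEq ι] (μ : Measure S) (K : ℝ)
    (Sig0 : Matrix ι ι ℝ) (X : S → ι → ℝ) : Prop :=
  ∃ Z : ι → S → ℝ,
    (∀ i, Measurable (Z i)) ∧ iIndepFun Z μ ∧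
    (∀ i, ∫ ω, Z i ω ∂μ = 0) ∧ (∀ i, ∫ ω, Z i ω ^ 2 ∂μ = 1) ∧
    (∀ i, psi2Norm μ (Z i) ≤ ENNReal.ofReal K) ∧
    ∀ᵐ ω ∂μ, X ω = (CFC.sqrt Sig0).mulVec fun i => Z i ω

end Model

/-! ### The assumptions, for sample size `n = 1` -/

section Assumptions

variable {L : ℕ} {d : Fin L → ℕ}

/-- `min_k m k ≥ log p`, `δ k ≍ ‖Σ₀‖₂ √(log p / m k)` with constants `a₁, a₂`, and
`ρ k = δ k / ε k` with `0 < ε k < 1`, the `ε k` being at least `ε₀`. -/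
def A1 (a₁ a₂ ε₀ : ℝ) (Sig0 : Matrix (Idx d) (Idx d) ℝ) (ρ : Fin L → ℝ) : Prop :=
  Real.log (pdim d) ≤ mmin d ∧
  ∃ δ ε : Fin L → ℝ, ∀ k,
    a₁ * (opNorm Sig0 * √(Real.log (pdim d) / mdim d k)) ≤ δ k ∧
    δ k ≤ a₂ * (opNorm Sig0 * √(Real.log (pdim d) / mdim d k)) ∧
    0 < ε k ∧ ε k < 1 ∧ ε₀ ≤ ε k ∧
    ρ k = δ k / ε k

/-- Positive lower and finite upper bounds on the eigenvalues of `Ω₀`. -/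
def A2 (kLow kUp : ℝ) (Omega0 : Matrix (Idx d) (Idx d) ℝ) : Prop :=
  0 < kLow ∧ kLow ≤ phiMin Omega0 ∧ phiMax Omega0 ≤ kUp

/-- `(m_min)² ≥ C² (L + 1) κ(Σ₀)⁴ (s log p + L p)` with `s = ∑ k, m k * s k`. -/
def A3 (C : ℝ) (Psi : (k : Fin L) → Matrix (Fin (d k)) (Fin (d k)) ℝ)
    (Sig0 : Matrix (Idx d) (Idx d) ℝ) : Prop :=
  C ^ 2 * (L + 1) * kappa Sig0 ^ 4 *
      ((∑ k, (mdim d k : ℝ) * offSupp (Psi k)) * Real.log (pdim d) + L * pdim d)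
    ≤ (mmin d : ℝ) ^ 2

end Assumptions

end TeraLasso

end

/-! Idea of the proof. Write `Δ = Ω - Ω₀` and `x = vec X`. Since `m_k ⟨S^k, B_k⟩` is the quadratic
form of the embedded `B_k` at `x`, the excess of the objective at `Ω` over its value at `Ω₀` splits
into the Bregman remainder `log|Ω₀| - log|Ω₀+Δ| + tr(Σ₀Δ)` and a linear part, namely `x·Δx -
tr(Σ₀Δ)` plus the change of the penalty.

Linear part (`linear_part_ge`). The off-diagonal parts of the components and the diagonal part of
`Δ` are Frobenius-orthogonal. Every off-diagonal deviation is at most `m_k ρ_k`, so the penalty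
absorbs it except on the support of `Ψ_k`; Cauchy–Schwarz leaves a multiple of `‖Σ₀‖₂ √(∑ s_k · log
p) ‖Δ‖_F`. The diagonal part ranges over a space of dimension at most `L d_max` and costs a multiple
of `‖Σ₀‖₂ √(L d_max) ‖Δ‖_F`. Together this is at most `Λ ‖Δ‖_F` in absolute value on the negative
side.

Remainder (`log_det_lower_bound`). After conjugation by `Σ₀^{1/2}` it is a sum of `e - log(1+e)`
over eigenvalues. Outside the Frobenius ball of radius `r` it is at least `r ‖Δ‖_F / (4‖Ω₀‖₂²)`,
provided `‖Σ₀‖₂ ‖Δ‖₂` is controlled by `‖Δ‖_F / r`. This is where the Kronecker structure enters: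
`mmin_mul_opNorm_sq_le` gives `m_min ‖Δ‖₂² ≤ (L+1) ‖Δ‖_F²`. Taking `r` slightly above `4‖Ω₀‖₂² Λ`,
with (A3) to make `r` small enough, the objective outside the ball exceeds its value at `Ω₀`.
Compactness gives a minimizer, every minimizer lies in the ball, and the same norm comparison turns
`r` into both relative rates.

Probability. Deviations of quadratic forms are controlled by a Hanson–Wright bound for moment
generating functions (`SubgaussianFamily.lintegral_eexp_quadratic_le`): average over random cross
blocks to decouple, then linearize squares by auxiliary Gaussians. A union bound treats single
entries; a volume argument (`lintegral_eexp_norm_le`) treats all diagonals at once. -/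

open MeasureTheory ProbabilityTheory

noncomputable section

namespace TeraLasso

/-! ### Exponential moments -/

/-- The exponential function with values in `[0, ∞]`. -/
def eexp (x : ℝ) : ENNReal := ENNReal.ofReal (Real.exp x)

@[fun_prop]
theorem measurable_eexp : Measurable eexp := by
  unfold eexp; fun_prop

theorem eexp_zero : eexp 0 = 1 := by simp [eexp]

theorem eexp_add (x y : ℝ) : eexp (x + y) = eexp x * eexp y := by
  rw [eexp, Real.exp_add, ENNReal.ofReal_mul (Real.exp_pos x).le]; rfl

theorem eexp_sum {ι : Type*} (s : Finset ι) (f : ι → ℝ) :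
    eexp (∑ i ∈ s, f i) = ∏ i ∈ s, eexp (f i) := by
  classical
  induction s using Finset.induction_on with
  | empty => simp [eexp_zero]
  | insert a s ha ih => rw [Finset.sum_insert ha, Finset.prod_insert ha, eexp_add, ih]

theorem eexp_mono {x y : ℝ} (h : x ≤ y) : eexp x ≤ eexp y :=
  ENNReal.ofReal_le_ofReal (Real.exp_le_exp.2 h)

theorem eexp_mul_eexp_neg (x : ℝ) : eexp x * eexp (-x) = 1 := by
  rw [← eexp_add, add_neg_cancel, eexp_zero]

section Scalar

variable {S : Type*} [MeasurableSpace S] {μ : Measure S}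

/-- Doubling `K` avoids the question whether the infimum is attained: some admissible value lies
strictly below `2 * K`, and the integrand decreases in it. -/
theorem lintegral_eexp_le_of_psi2Norm_le {K : ℝ} (hK : 0 < K) {Z : S → ℝ}
    (h : psi2Norm μ Z ≤ ENNReal.ofReal K) : ∫⁻ ω, eexp (Z ω ^ 2 / (2 * K) ^ 2) ∂μ ≤ 2 := by
  have hlt : psi2Norm μ Z < ENNReal.ofReal (2 * K) :=
    h.trans_lt ((ENNReal.ofReal_lt_ofReal_iff (by positivity)).2 (by linarith))
  simp only [psi2Norm, iInf_lt_iff] at hlt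
  obtain ⟨t, ht, htle, hlt⟩ := hlt
  have htK : t < 2 * K := (ENNReal.ofReal_lt_ofReal_iff (by positivity)).1 hlt
  refine (lintegral_mono fun ω => ?_).trans htle
  refine ENNReal.ofReal_le_ofReal (Real.exp_le_exp.2 ?_)
  gcongr

theorem integrable_exp_of_lintegral_eexp_le {f : S → ℝ} (hf : Measurable f) {c : ENNReal}
    (hc : c ≠ ⊤) (h : ∫⁻ ω, eexp (f ω) ∂μ ≤ c) : Integrable (fun ω => Real.exp (f ω)) μ := by
  refine ⟨by fun_prop, ?_⟩
  rw [hasFiniteIntegral_iff_ofReal (Filter.Eventually.of_forall fun _ => (Real.exp_pos _).le)]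
  exact h.trans_lt hc.lt_top

theorem lintegral_eexp_eq_integral {f : S → ℝ}
    (hi : Integrable (fun ω => Real.exp (f ω)) μ) :
    ∫⁻ ω, eexp (f ω) ∂μ = ENNReal.ofReal (∫ ω, Real.exp (f ω) ∂μ) :=
  (ofReal_integral_eq_lintegral_ofReal hi
    (Filter.Eventually.of_forall fun _ => (Real.exp_pos _).le)).symm

theorem integral_exp_le_two {f : S → ℝ} (hf : Measurable f)
    (h : ∫⁻ ω, eexp (f ω) ∂μ ≤ 2) : ∫ ω, Real.exp (f ω) ∂μ ≤ 2 := by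
  have hi := integrable_exp_of_lintegral_eexp_le hf (by simp) h
  rw [lintegral_eexp_eq_integral hi] at h
  have h2 : (2 : ENNReal) = ENNReal.ofReal 2 := by simp
  rw [h2] at h
  exact (ENNReal.ofReal_le_ofReal_iff (by norm_num)).1 h

theorem lintegral_eexp_le_of_pointwise [IsProbabilityMeasure μ] {f g : S → ℝ} (hf : Measurable f)
    (hg : Integrable g μ) {b : ℝ} (hfg : ∀ ω, Real.exp (f ω) ≤ g ω)
    (hb : ∫ ω, g ω ∂μ ≤ Real.exp b) : ∫⁻ ω, eexp (f ω) ∂μ ≤ eexp b := by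
  have hi : Integrable (fun ω => Real.exp (f ω)) μ := by
    refine hg.mono' (by fun_prop) (Filter.Eventually.of_forall fun ω => ?_)
    rw [Real.norm_of_nonneg (Real.exp_pos _).le]
    exact hfg ω
  rw [lintegral_eexp_eq_integral hi]
  exact ENNReal.ofReal_le_ofReal ((integral_mono hi hg hfg).trans hb)

/-- For a centred variable the linear term integrates to zero, so only an exponential moment of the
square remains. -/
theorem exp_le_add_exp_sq (x : ℝ) : Real.exp x ≤ x + Real.exp (x ^ 2) := by
  rcases le_total x 0 with hx | hx
  · rcases le_total x (-1) with h1 | h1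
    · have h2 := Real.add_one_le_exp (x ^ 2)
      have h3 : Real.exp x ≤ 1 := Real.exp_le_one_iff.2 hx
      nlinarith
    · have h2 := Real.add_one_le_exp (x ^ 2)
      have h3 := Real.abs_exp_sub_one_sub_id_le (x := x) (abs_le.2 ⟨h1, by linarith⟩)
      have := abs_le.1 h3
      linarith [this.2]
  · rcases le_total x 1 with h1 | h1
    · have h2 := Real.add_one_le_exp (x ^ 2)
      have h3 := Real.abs_exp_sub_one_sub_id_le (x := x) (abs_le.2 ⟨by linarith, h1⟩)
      have := abs_le.1 h3
      linarith [this.2]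
    · have : Real.exp x ≤ Real.exp (x ^ 2) := Real.exp_le_exp.2 (by nlinarith)
      linarith

/-- A pointwise substitute for Jensen's `E exp(θw) ≤ (E exp w)^θ` when `E exp w ≤ 2`: convexity
between `0` and `w - log 2`, then `2^θ ≤ exp θ`. -/
theorem exp_mul_le_of_le_one {θ : ℝ} (h0 : 0 ≤ θ) (h1 : θ ≤ 1) (w : ℝ) :
    Real.exp (θ * w) ≤ Real.exp θ * (1 - θ + θ * (Real.exp w / 2)) := by
  have hl : Real.log 2 ≤ 1 := by linarith [Real.log_two_lt_d9]
  have hc := convexOn_exp.2 (Set.mem_univ (0 : ℝ)) (Set.mem_univ (w - Real.log 2))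
    (sub_nonneg.2 h1) h0 (by ring)
  simp only [smul_eq_mul, mul_zero, zero_add, Real.exp_zero, mul_one, Real.exp_sub,
    Real.exp_log (by norm_num : (0 : ℝ) < 2)] at hc
  calc Real.exp (θ * w) = Real.exp (θ * Real.log 2) * Real.exp (θ * (w - Real.log 2)) := by
        rw [← Real.exp_add]; ring_nf
    _ ≤ Real.exp θ * (1 - θ + θ * (Real.exp w / 2)) := by
        gcongr
        nlinarith

variable [IsProbabilityMeasure μ] {Z : S → ℝ} {t : ℝ}

/-- A centred variable with `E exp (Z² / t²) ≤ 2` has a sub-gaussian moment generating function. -/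
theorem lintegral_eexp_mul_le (hZ : Measurable Z) (ht : 0 < t) (h0 : ∫ ω, Z ω ∂μ = 0)
    (hψ : ∫⁻ ω, eexp (Z ω ^ 2 / t ^ 2) ∂μ ≤ 2) (a : ℝ) :
    ∫⁻ ω, eexp (a * Z ω) ∂μ ≤ eexp (a ^ 2 * t ^ 2) := by
  have hi := integrable_exp_of_lintegral_eexp_le (by fun_prop) (by simp) hψ
  have h2 := integral_exp_le_two (by fun_prop) hψ
  have hZi : Integrable Z μ := by
    refine (hi.const_mul t).mono' hZ.aestronglyMeasurable (Filter.Eventually.of_forall fun ω => ?_)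
    have h1 := Real.add_one_le_exp (Z ω ^ 2 / t ^ 2)
    have h3 : |Z ω| / t ≤ Z ω ^ 2 / t ^ 2 + 1 := by
      rw [← sq_abs (Z ω), ← div_pow]
      nlinarith [sq_nonneg (|Z ω| / t - 1)]
    rw [div_le_iff₀ ht] at h3
    rw [Real.norm_eq_abs]
    nlinarith
  -- For small `a` the mean zero is essential. For large `a`, Young's inequality `aZ ≤ a²t²/2 +
  -- Z²/(2t²)` suffices, since the resulting factor `3/2` is at most `exp(a²t²/2)`.
  rcases le_total (a ^ 2 * t ^ 2) 1 with hle | hge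
  · set θ := a ^ 2 * t ^ 2 with hθ
    have hθ0 : 0 ≤ θ := by positivity
    refine lintegral_eexp_le_of_pointwise (by fun_prop)
      (g := fun ω => a * Z ω + Real.exp θ * (1 - θ + θ * (Real.exp (Z ω ^ 2 / t ^ 2) / 2)))
      ((hZi.const_mul a).add (((integrable_const _).add ((hi.div_const 2).const_mul θ)).const_mul _))
      (fun ω => ?_) ?_
    · have h1 := exp_le_add_exp_sq (a * Z ω)
      have h3 := exp_mul_le_of_le_one hθ0 hle (Z ω ^ 2 / t ^ 2)
      have h4 : θ * (Z ω ^ 2 / t ^ 2) = (a * Z ω) ^ 2 := by rw [hθ]; field_simp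
      rw [h4] at h3
      linarith
    · have hi2 : Integrable (fun ω => 1 - θ + θ * (Real.exp (Z ω ^ 2 / t ^ 2) / 2)) μ :=
        (integrable_const _).add ((hi.div_const 2).const_mul θ)
      rw [integral_add (hZi.const_mul a) (hi2.const_mul _),
        integral_const_mul, h0, integral_const_mul, integral_add (integrable_const _)
        ((hi.div_const 2).const_mul θ), integral_const_mul, integral_div]
      simp only [mul_zero, zero_add, integral_const, probReal_univ, smul_eq_mul, one_mul]
      have : 1 - θ + θ * ((∫ ω, Real.exp (Z ω ^ 2 / t ^ 2) ∂μ) / 2) ≤ 1 := by nlinarith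
      nlinarith [Real.exp_pos θ]
  · refine lintegral_eexp_le_of_pointwise (by fun_prop)
      (g := fun ω => Real.exp (a ^ 2 * t ^ 2 / 2) * (1 / 2 + Real.exp (Z ω ^ 2 / t ^ 2) / 2))
      (((integrable_const _).add (hi.div_const 2)).const_mul _) (fun ω => ?_) ?_
    · have hc := convexOn_exp.2 (Set.mem_univ (0 : ℝ)) (Set.mem_univ (Z ω ^ 2 / t ^ 2))
        (by norm_num : (0 : ℝ) ≤ 1 / 2) (by norm_num : (0 : ℝ) ≤ 1 / 2) (by norm_num)
      simp only [smul_eq_mul, mul_zero, zero_add, Real.exp_zero] at hc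
      have h1 : a * Z ω ≤ a ^ 2 * t ^ 2 / 2 + 1 / 2 * (Z ω ^ 2 / t ^ 2) := by
        have h3 : a * Z ω = (a * t) * (Z ω / t) := by field_simp
        rw [h3, ← div_pow, ← mul_pow]
        nlinarith [sq_nonneg (a * t - Z ω / t)]
      calc Real.exp (a * Z ω) ≤ Real.exp (a ^ 2 * t ^ 2 / 2 + 1 / 2 * (Z ω ^ 2 / t ^ 2)) :=
            Real.exp_le_exp.2 h1
        _ ≤ _ := by rw [Real.exp_add]; gcongr; linarith
    · rw [integral_const_mul, integral_add (integrable_const _) (hi.div_const 2)]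
      simp only [integral_div, integral_const, probReal_univ, smul_eq_mul, one_mul]
      have h3 : Real.exp (a ^ 2 * t ^ 2) =
          Real.exp (a ^ 2 * t ^ 2 / 2) * Real.exp (a ^ 2 * t ^ 2 / 2) := by
        rw [← Real.exp_add]; ring_nf
      rw [h3]
      gcongr
      have := Real.add_one_le_exp (a ^ 2 * t ^ 2 / 2)
      linarith

theorem one_le_sq_of_lintegral_eexp_le (hZ : Measurable Z) (ht : 0 < t)
    (h1 : ∫ ω, Z ω ^ 2 ∂μ = 1) (hψ : ∫⁻ ω, eexp (Z ω ^ 2 / t ^ 2) ∂μ ≤ 2) : 1 ≤ t ^ 2 := by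
  have hi := integrable_exp_of_lintegral_eexp_le (by fun_prop) (by simp) hψ
  have h2 := integral_exp_le_two (by fun_prop) hψ
  -- A non-integrable square would have Bochner integral `0` by convention, against the value `1`.
  have hsq : Integrable (fun ω => Z ω ^ 2) μ := by
    by_contra h
    rw [integral_undef h] at h1
    exact zero_ne_one h1
  have h3 : ∫ ω, (Z ω ^ 2 / t ^ 2 + 1) ∂μ ≤ ∫ ω, Real.exp (Z ω ^ 2 / t ^ 2) ∂μ :=
    integral_mono ((hsq.div_const _).add (integrable_const _)) hi
      fun ω => Real.add_one_le_exp _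
  rw [integral_add (hsq.div_const _) (integrable_const _), integral_div, h1] at h3
  simp only [integral_const, probReal_univ, smul_eq_mul, one_mul] at h3
  have h4 : 1 / t ^ 2 ≤ 1 := by linarith
  rwa [div_le_one (by positivity)] at h4

theorem exp_le_one_add_add_sq_mul_exp_abs (x : ℝ) :
    Real.exp x ≤ 1 + x + x ^ 2 * Real.exp |x| := by
  rcases le_total |x| 1 with h | h
  · have h3 := (abs_le.1 (Real.abs_exp_sub_one_sub_id_le h)).2
    have : x ^ 2 * 1 ≤ x ^ 2 * Real.exp |x| := by
      gcongr; exact Real.one_le_exp (abs_nonneg x)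
    linarith
  · have h1 : Real.exp x ≤ Real.exp |x| := Real.exp_le_exp.2 (le_abs_self x)
    have h2 := Real.add_one_le_exp |x|
    have h3 : 1 ≤ x ^ 2 := by rw [← sq_abs]; nlinarith
    rcases le_total 0 x with hx | hx
    · nlinarith [Real.exp_pos |x|]
    · have h4 : Real.exp x ≤ 1 := Real.exp_le_one_iff.2 hx
      rw [abs_of_nonpos hx] at h h2 ⊢
      nlinarith [Real.exp_pos (-x)]

/-- The square of a sub-gaussian variable of unit variance is sub-exponential. -/
theorem lintegral_eexp_mul_sq_sub_one_le (hZ : Measurable Z) (ht : 0 < t)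
    (h1 : ∫ ω, Z ω ^ 2 ∂μ = 1) (hψ : ∫⁻ ω, eexp (Z ω ^ 2 / t ^ 2) ∂μ ≤ 2) {a : ℝ}
    (ha : |a| * t ^ 2 ≤ 1 / 4) :
    ∫⁻ ω, eexp (a * (Z ω ^ 2 - 1)) ∂μ ≤ eexp (48 * (a ^ 2 * t ^ 4)) := by
  have hi := integrable_exp_of_lintegral_eexp_le (by fun_prop) (by simp) hψ
  have h2 := integral_exp_le_two (by fun_prop) hψ
  have ht1 := one_le_sq_of_lintegral_eexp_le hZ ht h1 hψ
  have hsq : Integrable (fun ω => Z ω ^ 2) μ := by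
    by_contra h
    rw [integral_undef h] at h1
    exact zero_ne_one h1
  have hlin : Integrable (fun ω => 1 + a * (Z ω ^ 2 - 1)) μ :=
    (integrable_const _).add ((hsq.sub (integrable_const _)).const_mul a)
  have hlin1 : ∫ ω, (1 + a * (Z ω ^ 2 - 1)) ∂μ = 1 := by
    have hsub : Integrable (fun ω => Z ω ^ 2 - 1) μ := hsq.sub (integrable_const _)
    rw [integral_add (integrable_const _) (hsub.const_mul a),
      integral_const_mul, integral_sub hsq (integrable_const _), h1]
    simp
  set τ := |a| * t ^ 2 with hτ
  have hτ0 : 0 ≤ τ := by positivity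
  have hτ2 : a ^ 2 * t ^ 4 = τ ^ 2 := by rw [hτ, mul_pow, sq_abs]; ring
  rw [hτ2]
  -- The constant `24` is `8 · 3`: `8` from `(w+1)² ≤ 8 exp((w+1)/2)`, and `3` from bounding
  -- `exp(3(w+1)/4)` by `3 exp w`. The bound `E exp w ≤ 2` doubles it to `48`.
  refine lintegral_eexp_le_of_pointwise (by fun_prop)
    (g := fun ω => (1 + a * (Z ω ^ 2 - 1)) + 24 * τ ^ 2 * Real.exp (Z ω ^ 2 / t ^ 2))
    (hlin.add (hi.const_mul _)) (fun ω => ?_) ?_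
  · refine (exp_le_one_add_add_sq_mul_exp_abs _).trans ?_
    set w := Z ω ^ 2 / t ^ 2 with hw
    have hw0 : 0 ≤ w := by positivity
    have hy : |a * (Z ω ^ 2 - 1)| ≤ τ * (w + 1) := by
      rw [abs_mul, hτ, mul_assoc]
      gcongr
      have : t ^ 2 * w = Z ω ^ 2 := by rw [hw]; field_simp
      rw [abs_le]
      constructor <;> nlinarith [sq_nonneg (Z ω)]
    have hy4 : |a * (Z ω ^ 2 - 1)| ≤ (w + 1) / 4 := by nlinarith
    have hexp : (w + 1) ^ 2 ≤ 8 * Real.exp ((w + 1) / 2) := by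
      have := Real.quadratic_le_exp_of_nonneg (x := (w + 1) / 2) (by positivity)
      nlinarith
    have hexp2 : Real.exp ((w + 1) / 2) * Real.exp ((w + 1) / 4) ≤ 3 * Real.exp w := by
      rw [← Real.exp_add]
      calc Real.exp ((w + 1) / 2 + (w + 1) / 4) ≤ Real.exp (1 + w) :=
            Real.exp_le_exp.2 (by linarith)
        _ = Real.exp 1 * Real.exp w := Real.exp_add _ _
        _ ≤ 3 * Real.exp w := by gcongr; linarith [Real.exp_one_lt_d9]
    have hmain : (a * (Z ω ^ 2 - 1)) ^ 2 * Real.exp |a * (Z ω ^ 2 - 1)|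
        ≤ 24 * τ ^ 2 * Real.exp w := by
      calc (a * (Z ω ^ 2 - 1)) ^ 2 * Real.exp |a * (Z ω ^ 2 - 1)|
          ≤ (τ * (w + 1)) ^ 2 * Real.exp ((w + 1) / 4) := by
            rw [← sq_abs]; gcongr
        _ ≤ τ ^ 2 * (8 * Real.exp ((w + 1) / 2)) * Real.exp ((w + 1) / 4) := by
            rw [mul_pow]; gcongr
        _ = 8 * τ ^ 2 * (Real.exp ((w + 1) / 2) * Real.exp ((w + 1) / 4)) := by ring
        _ ≤ 8 * τ ^ 2 * (3 * Real.exp w) := by gcongr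
        _ = _ := by ring
    linarith
  · rw [integral_add hlin (hi.const_mul _), hlin1, integral_const_mul]
    have := Real.add_one_le_exp (48 * τ ^ 2)
    nlinarith [sq_nonneg τ]

end Scalar

/-! ### Quadratic forms of independent sub-gaussian variables -/

section Diagonalization

variable {ι : Type*} [Fintype ι]

open Matrix

/-- Squared Frobenius norm. -/
def frobSq (A : Matrix ι ι ℝ) : ℝ := ∑ i, ∑ j, A i j ^ 2

theorem frobSq_nonneg (A : Matrix ι ι ℝ) : 0 ≤ frobSq A := by unfold frobSq; positivity

theorem frobSq_eq_trace (A : Matrix ι ι ℝ) : frobSq A = (Aᵀ * A).trace := by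
  simp only [frobSq, Matrix.trace, Matrix.diag, Matrix.mul_apply, Matrix.transpose_apply]
  rw [Finset.sum_comm]
  simp [sq]

/-- The quadratic form bound `‖A x‖ ≤ b ‖x‖`. -/
def OpBound (A : Matrix ι ι ℝ) (b : ℝ) : Prop :=
  ∀ x : ι → ℝ, (A *ᵥ x) ⬝ᵥ (A *ᵥ x) ≤ b ^ 2 * (x ⬝ᵥ x)

theorem exists_orthogonal_diagonalization [DecidableEq ι] {A : Matrix ι ι ℝ} (hA : A.IsHermitian) :
    ∃ U : Matrix ι ι ℝ, Uᵀ * U = 1 ∧ U * Uᵀ = 1 ∧ A = U * diagonal hA.eigenvalues * Uᵀ := by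
  refine ⟨hA.eigenvectorUnitary, ?_, ?_, ?_⟩
  · have := Unitary.coe_star_mul_self hA.eigenvectorUnitary
    rwa [star_eq_conjTranspose, conjTranspose_eq_transpose_of_trivial] at this
  · have := Unitary.coe_mul_star_self hA.eigenvectorUnitary
    rwa [Unitary.coe_star, star_eq_conjTranspose, conjTranspose_eq_transpose_of_trivial] at this
  · conv_lhs => rw [hA.spectral_theorem, Unitary.conjStarAlgAut_apply,
      star_eq_conjTranspose, conjTranspose_eq_transpose_of_trivial]
    rfl

end Diagonalization

/-! ### Gaussian exponential moments. -/

section Gaussian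

theorem lintegral_eexp_mul_gaussian (y : ℝ) :
    ∫⁻ g, eexp (y * g) ∂(gaussianReal 0 1) = eexp (y ^ 2 / 2) := by
  have hi : Integrable (fun g => Real.exp (y * g)) (gaussianReal 0 1) :=
    integrable_exp_mul_gaussianReal y
  rw [lintegral_eexp_eq_integral hi]
  have := mgf_gaussianReal (p := gaussianReal 0 1) (X := id) (μ := 0) (v := 1) (by simp) y
  simp only [mgf, id] at this
  rw [this]
  simp [eexp]

/-- The integral equals `(1 - 2a)^{-1/2}`, and `(1 - 2a)⁻¹ ≤ 1 + 4a ≤ exp(4a)` holds on `0 ≤ a ≤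
1/4`. -/
theorem lintegral_eexp_mul_sq_gaussian_le {a : ℝ} (ha : a ≤ 1 / 4) (ha0 : 0 ≤ a) :
    ∫⁻ g, eexp (a * g ^ 2) ∂(gaussianReal 0 1) ≤ eexp (2 * a) := by
  rw [gaussianReal_of_var_ne_zero _ one_ne_zero,
    lintegral_withDensity_eq_lintegral_mul _ (measurable_gaussianPDF _ _) (by fun_prop)]
  have hb : 0 < 1 / 2 - a := by linarith
  have hpt : ∀ x : ℝ, (gaussianPDF 0 1 * fun g => eexp (a * g ^ 2)) x
      = ENNReal.ofReal ((√(2 * Real.pi))⁻¹ * Real.exp (-(1 / 2 - a) * x ^ 2)) := by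
    intro x
    simp only [Pi.mul_apply, gaussianPDF, gaussianPDFReal, eexp, NNReal.coe_one, mul_one, sub_zero]
    rw [← ENNReal.ofReal_mul (by positivity), mul_assoc, ← Real.exp_add]
    congr 3
    ring
  simp_rw [hpt]
  rw [← ofReal_integral_eq_lintegral_ofReal ((integrable_exp_neg_mul_sq hb).const_mul _)
    (Filter.Eventually.of_forall fun _ => by positivity), integral_const_mul, integral_gaussian]
  refine ENNReal.ofReal_le_ofReal ?_
  rw [← Real.sqrt_inv, ← Real.sqrt_mul (by positivity)]
  refine Real.sqrt_le_iff.2 ⟨(Real.exp_pos _).le, ?_⟩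
  have h1 : (2 * Real.pi)⁻¹ * (Real.pi / (1 / 2 - a)) = (1 - 2 * a)⁻¹ := by
    have := Real.pi_pos
    have h3 : 1 - 2 * a ≠ 0 := by linarith
    have h4 : 1 / 2 - a ≠ 0 := hb.ne'
    field_simp
  rw [h1, ← Real.exp_nat_mul, inv_le_comm₀ (by linarith) (Real.exp_pos _), ← Real.exp_neg]
  have h5 : Real.exp (-(((2 : ℕ) : ℝ) * (2 * a))) ≤ 1 - 2 * a := by
    push_cast
    rw [Real.exp_neg, inv_le_comm₀ (Real.exp_pos _) (by linarith)]
    have : (1 - 2 * a)⁻¹ ≤ 1 + 4 * a := by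
      rw [inv_le_iff_one_le_mul₀ (by linarith)]; nlinarith
    calc _ ≤ 1 + 4 * a := this
      _ ≤ _ := by
        have := Real.add_one_le_exp (2 * (2 * a)); linarith
  exact h5

theorem lintegral_pi_prod {ι : Type*} [Fintype ι] (ν : ι → Measure ℝ)
    [∀ i, IsProbabilityMeasure (ν i)] (f : ι → ℝ → ENNReal) (hf : ∀ i, Measurable (f i)) :
    ∫⁻ g, ∏ i, f i (g i) ∂(Measure.pi ν) = ∏ i, ∫⁻ x, f i x ∂(ν i) := by
  have hind : iIndepFun (fun i (g : ι → ℝ) => f i (g i)) (Measure.pi ν) :=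
    iIndepFun_pi fun i => (hf i).aemeasurable
  rw [lintegral_prod_eq_prod_lintegral_of_indepFun Finset.univ _ hind (fun i => by fun_prop)]
  refine Finset.prod_congr rfl fun i _ => ?_
  exact (measurePreserving_eval ν i).lintegral_comp (hf i)

end Gaussian

/-! ### Sums and squared norms of independent sub-gaussian variables. -/

section Independent

variable {S : Type*} [MeasurableSpace S] {μ : Measure S}

/-- The joint law is a product, so one block of variables can be frozen while the other is
integrated out. -/
theorem lintegral_comp_prod_of_indepFun [IsProbabilityMeasure μ] {α β : Type*} [MeasurableSpace α]
    [MeasurableSpace β] {U : S → α} {V : S → β} (hU : Measurable U) (hV : Measurable V)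
    (h : IndepFun U V μ) {F : α × β → ENNReal} (hF : Measurable F) :
    ∫⁻ ω, F (U ω, V ω) ∂μ = ∫⁻ ω', ∫⁻ ω, F (U ω, V ω') ∂μ ∂μ := by
  have hmap := (indepFun_iff_map_prod_eq_prod_map_map hU.aemeasurable hV.aemeasurable).1 h
  have : IsProbabilityMeasure (μ.map U) := Measure.isProbabilityMeasure_map hU.aemeasurable
  have : IsProbabilityMeasure (μ.map V) := Measure.isProbabilityMeasure_map hV.aemeasurable
  calc ∫⁻ ω, F (U ω, V ω) ∂μ = ∫⁻ z, F z ∂(μ.map fun ω => (U ω, V ω)) :=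
        (lintegral_map hF (hU.prodMk hV)).symm
    _ = ∫⁻ v, ∫⁻ u, F (u, v) ∂(μ.map U) ∂(μ.map V) := by
        rw [hmap, lintegral_prod_symm _ hF.aemeasurable]
    _ = ∫⁻ ω', ∫⁻ u, F (u, V ω') ∂(μ.map U) ∂μ :=
        lintegral_map hF.lintegral_prod_left' hV
    _ = _ := by
        refine lintegral_congr fun ω' => ?_
        exact lintegral_map (hF.comp (measurable_id.prodMk measurable_const)) hU

variable {ι : Type*}

/-- Independent variables with mean zero, unit variance and `E exp (Z² / t²) ≤ 2`. -/
structure SubgaussianFamily (μ : Measure S) (t : ℝ) (Z : ι → S → ℝ) : Prop where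
  measurable : ∀ i, Measurable (Z i)
  indep : iIndepFun Z μ
  mean : ∀ i, ∫ ω, Z i ω ∂μ = 0
  variance : ∀ i, ∫ ω, Z i ω ^ 2 ∂μ = 1
  tail : ∀ i, ∫⁻ ω, eexp (Z i ω ^ 2 / t ^ 2) ∂μ ≤ 2
  pos : 0 < t

variable [IsProbabilityMeasure μ] {t : ℝ} {Z : ι → S → ℝ}

theorem SubgaussianFamily.lintegral_eexp_sum_le (h : SubgaussianFamily μ t Z) (s : Finset ι)
    (a : ι → ℝ) :
    ∫⁻ ω, eexp (∑ i ∈ s, a i * Z i ω) ∂μ ≤ eexp (t ^ 2 * ∑ i ∈ s, a i ^ 2) := by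
  have hm := h.measurable
  simp_rw [eexp_sum]
  rw [lintegral_prod_eq_prod_lintegral_of_indepFun s (fun i ω => eexp (a i * Z i ω))
    (h.indep.comp (fun i x => eexp (a i * x)) fun i => by fun_prop) (fun i => by fun_prop),
    Finset.mul_sum, eexp_sum]
  refine Finset.prod_le_prod' fun i _ => ?_
  rw [mul_comm]
  exact lintegral_eexp_mul_le (hm i) h.pos (h.mean i) (h.tail i) (a i)

theorem SubgaussianFamily.lintegral_eexp_sum_sq_le (h : SubgaussianFamily μ t Z) (s : Finset ι)
    (a : ι → ℝ) (ha : ∀ i ∈ s, |a i| * t ^ 2 ≤ 1 / 4) :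
    ∫⁻ ω, eexp (∑ i ∈ s, a i * (Z i ω ^ 2 - 1)) ∂μ ≤ eexp (48 * t ^ 4 * ∑ i ∈ s, a i ^ 2) := by
  have hm := h.measurable
  simp_rw [eexp_sum]
  rw [lintegral_prod_eq_prod_lintegral_of_indepFun s (fun i ω => eexp (a i * (Z i ω ^ 2 - 1)))
    (h.indep.comp (fun i x => eexp (a i * (x ^ 2 - 1))) fun i => by fun_prop)
    (fun i => by fun_prop), Finset.mul_sum, eexp_sum]
  refine Finset.prod_le_prod' fun i hi => ?_
  refine (lintegral_eexp_mul_sq_sub_one_le (hm i) h.pos (h.variance i) (h.tail i) (ha i hi)).trans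
    (eexp_mono (by linarith))

variable [Fintype ι] [DecidableEq ι]

open Matrix

/-- Exponential moments of `‖B Z‖²`. -/
theorem SubgaussianFamily.lintegral_eexp_norm_sq_le (h : SubgaussianFamily μ t Z)
    (B : Matrix ι ι ℝ) {b c : ℝ} (hB : OpBound B b) (hc : 0 ≤ c) (hcb : 8 * c * t ^ 2 * b ^ 2 ≤ 1) :
    ∫⁻ ω, eexp (c * ((B *ᵥ fun i => Z i ω) ⬝ᵥ (B *ᵥ fun i => Z i ω))) ∂μ
      ≤ eexp (4 * c * t ^ 2 * frobSq B) := by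
  have hm := h.measurable
  have hBB : (Bᵀ * B).IsHermitian := by
    rw [IsHermitian, conjTranspose_eq_transpose_of_trivial, transpose_mul, transpose_transpose]
  obtain ⟨U, hU1, hU2, hU3⟩ := exists_orthogonal_diagonalization hBB
  set e := hBB.eigenvalues with he
  have hquad : ∀ z : ι → ℝ, (B *ᵥ z) ⬝ᵥ (B *ᵥ z) = ∑ l, e l * ((Uᵀ *ᵥ z) l) ^ 2 := by
    intro z
    have h1 : (B *ᵥ z) ⬝ᵥ (B *ᵥ z) = z ⬝ᵥ ((Bᵀ * B) *ᵥ z) := by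
      rw [← mulVec_mulVec, dotProduct_mulVec z, vecMul_transpose]
    rw [h1, hU3, ← mulVec_mulVec, ← mulVec_mulVec, dotProduct_mulVec z, ← mulVec_transpose]
    simp only [dotProduct, mulVec_diagonal]
    exact Finset.sum_congr rfl fun l _ => by ring
  have hiso : ∀ z : ι → ℝ, (U *ᵥ z) ⬝ᵥ (U *ᵥ z) = z ⬝ᵥ z := by
    intro z
    rw [dotProduct_mulVec, ← mulVec_transpose, mulVec_mulVec, hU1, one_mulVec]
  have hel : ∀ l, e l = (B *ᵥ (U *ᵥ Pi.single l 1)) ⬝ᵥ (B *ᵥ (U *ᵥ Pi.single l 1)) := by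
    intro l
    rw [hquad, mulVec_mulVec, hU1, one_mulVec]
    simp [Pi.single_apply]
  have he0 : ∀ l, 0 ≤ e l := fun l => by
    rw [hel]; exact Finset.sum_nonneg fun i _ => mul_self_nonneg _
  have heb : ∀ l, e l ≤ b ^ 2 := fun l => by
    rw [hel]
    refine (hB _).trans ?_
    rw [hiso]; simp
  have hesum : ∑ l, e l = frobSq B := by
    rw [frobSq_eq_trace, hU3, trace_mul_cycle, hU1, one_mul, trace_diagonal]
  -- Gaussian linearization: since `E exp(yg) = exp(y²/2)`, the choice `r l ^ 2 = 2 * c * e l`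
  -- writes `exp(c‖Bz‖²)` as a Gaussian average of exponentials linear in `z`. After exchanging the
  -- integrals only sub-gaussianity of linear forms in `Z` is needed.
  set r : ι → ℝ := fun l => √(2 * c * e l) with hr
  have hr2 : ∀ l, r l ^ 2 = 2 * c * e l := fun l =>
    Real.sq_sqrt (by have := he0 l; positivity)
  set γ : Measure (ι → ℝ) := Measure.pi fun _ => gaussianReal 0 1 with hγ
  have hrepr : ∀ z : ι → ℝ, eexp (c * ((B *ᵥ z) ⬝ᵥ (B *ᵥ z))) =
      ∫⁻ g, eexp (∑ j, (U *ᵥ fun l => r l * g l) j * z j) ∂γ := by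
    intro z
    have h1 : c * ((B *ᵥ z) ⬝ᵥ (B *ᵥ z)) = ∑ l, (r l * (Uᵀ *ᵥ z) l) ^ 2 / 2 := by
      rw [hquad, Finset.mul_sum]
      refine Finset.sum_congr rfl fun l _ => ?_
      rw [mul_pow, hr2]; ring
    have h2 : ∀ g : ι → ℝ, ∑ j, (U *ᵥ fun l => r l * g l) j * z j
        = ∑ l, (r l * (Uᵀ *ᵥ z) l) * g l := by
      intro g
      change (U *ᵥ fun l => r l * g l) ⬝ᵥ z = _
      rw [dotProduct_comm, dotProduct_mulVec, ← mulVec_transpose]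
      exact Finset.sum_congr rfl fun l _ => by ring
    simp_rw [h2, h1, eexp_sum]
    rw [hγ, lintegral_pi_prod (fun _ => gaussianReal 0 1)
      (fun l x => eexp (r l * (Uᵀ *ᵥ z) l * x)) fun l => by fun_prop]
    exact Finset.prod_congr rfl fun l _ => (lintegral_eexp_mul_gaussian _).symm
  calc ∫⁻ ω, eexp (c * ((B *ᵥ fun i => Z i ω) ⬝ᵥ (B *ᵥ fun i => Z i ω))) ∂μ
      = ∫⁻ ω, ∫⁻ g, eexp (∑ j, (U *ᵥ fun l => r l * g l) j * Z j ω) ∂γ ∂μ :=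
        lintegral_congr fun ω => hrepr _
    _ = ∫⁻ g, ∫⁻ ω, eexp (∑ j, (U *ᵥ fun l => r l * g l) j * Z j ω) ∂μ ∂γ := by
        refine lintegral_lintegral_swap (Measurable.aemeasurable ?_)
        simp only [Function.uncurry_def, mulVec, dotProduct]
        fun_prop
    -- Integrating out `Z` for fixed `g` returns a quadratic form in the Gaussians, diagonal because
    -- `U` is an isometry.
    _ ≤ ∫⁻ g, ∏ l, eexp ((2 * c * t ^ 2 * e l) * g l ^ 2) ∂γ := by
        refine lintegral_mono fun g => (h.lintegral_eexp_sum_le Finset.univ _).trans_eq ?_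
        rw [← eexp_sum]
        congr 1
        have h1 := hiso fun l => r l * g l
        simp only [dotProduct, ← sq] at h1
        rw [h1, Finset.mul_sum]
        refine Finset.sum_congr rfl fun l _ => ?_
        rw [mul_pow, hr2]; ring
    _ = ∏ l, ∫⁻ x, eexp ((2 * c * t ^ 2 * e l) * x ^ 2) ∂(gaussianReal 0 1) :=
        lintegral_pi_prod (fun _ => gaussianReal 0 1)
          (fun l x => eexp ((2 * c * t ^ 2 * e l) * x ^ 2)) fun l => by fun_prop
    _ ≤ ∏ l, eexp (2 * (2 * c * t ^ 2 * e l)) := by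
        refine Finset.prod_le_prod' fun l _ => lintegral_eexp_mul_sq_gaussian_le ?_ ?_
        · have : 2 * c * t ^ 2 * e l ≤ 2 * c * t ^ 2 * b ^ 2 := by gcongr; exact heb l
          linarith
        · have := he0 l; positivity
    _ = eexp (4 * c * t ^ 2 * frobSq B) := by
        rw [← eexp_sum, ← hesum, Finset.mul_sum]
        congr 1
        exact Finset.sum_congr rfl fun l _ => by ring

end Independent

/-! ### The Hanson–Wright inequality -/

section HansonWright

variable {ι : Type*} [Fintype ι] [DecidableEq ι]

open Matrix

/-- The part of `A` with rows in `I` and columns outside `I`. -/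
def crossBlock (A : Matrix ι ι ℝ) (I : Finset ι) : Matrix ι ι ℝ :=
  Matrix.of fun i j => if i ∈ I ∧ j ∉ I then A i j else 0

theorem crossBlock_mulVec (A : Matrix ι ι ℝ) (I : Finset ι) (z : ι → ℝ) (i : ι) :
    (crossBlock A I *ᵥ z) i = if i ∈ I then ∑ j ∈ Iᶜ, A i j * z j else 0 := by
  simp only [mulVec, dotProduct, crossBlock, of_apply]
  split_ifs with h
  · simp only [h, true_and, ite_mul, zero_mul]
    rw [← Finset.sum_filter]
    refine Finset.sum_congr ?_ fun _ _ => rfl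
    ext; simp
  · simp [h]

theorem frobSq_crossBlock_le (A : Matrix ι ι ℝ) (I : Finset ι) :
    frobSq (crossBlock A I) ≤ frobSq A := by
  refine Finset.sum_le_sum fun i _ => Finset.sum_le_sum fun j _ => ?_
  simp only [crossBlock, of_apply]
  split_ifs
  · exact le_rfl
  · rw [zero_pow two_ne_zero]; positivity

theorem OpBound.crossBlock {A : Matrix ι ι ℝ} {b : ℝ} (hA : OpBound A b) (I : Finset ι) :
    OpBound (crossBlock A I) b := by
  intro x
  set y : ι → ℝ := fun j => if j ∈ I then 0 else x j with hy
  have h1 : ∀ i, (TeraLasso.crossBlock A I *ᵥ x) i * (TeraLasso.crossBlock A I *ᵥ x) i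
      ≤ (A *ᵥ y) i * (A *ᵥ y) i := by
    intro i
    rw [crossBlock_mulVec]
    split_ifs with h
    · apply le_of_eq
      have : (A *ᵥ y) i = ∑ j ∈ Iᶜ, A i j * x j := by
        simp only [mulVec, dotProduct, hy, mul_ite, mul_zero]
        rw [Finset.sum_ite, Finset.sum_const_zero, zero_add]
        refine Finset.sum_congr ?_ fun _ _ => rfl
        ext; simp
      rw [this]
    · rw [mul_zero]; exact mul_self_nonneg _
  have h2 : y ⬝ᵥ y ≤ x ⬝ᵥ x := by
    refine Finset.sum_le_sum fun i _ => ?_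
    simp only [hy]
    split_ifs
    · rw [mul_zero]; exact mul_self_nonneg _
    · exact le_rfl
  calc _ ≤ (A *ᵥ y) ⬝ᵥ (A *ᵥ y) := Finset.sum_le_sum fun i _ => h1 i
    _ ≤ b ^ 2 * (y ⬝ᵥ y) := hA y
    _ ≤ b ^ 2 * (x ⬝ᵥ x) := by gcongr

theorem OpBound.abs_diag_le {A : Matrix ι ι ℝ} {b : ℝ} (hA : OpBound A b) (hb : 0 ≤ b) (i : ι) :
    |A i i| ≤ b := by
  have h := hA (Pi.single i 1)
  have h1 : A i i ^ 2 ≤ b ^ 2 := by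
    have h2 : A i i ^ 2 ≤ (A *ᵥ Pi.single i 1) ⬝ᵥ (A *ᵥ Pi.single i 1) := by
      rw [sq]
      simp only [mulVec_single_one, dotProduct, col_apply]
      exact Finset.single_le_sum (f := fun j => A j i * A j i)
        (fun j _ => mul_self_nonneg _) (Finset.mem_univ i)
    refine h2.trans (h.trans_eq ?_)
    simp
  exact abs_le_of_sq_le_sq h1 hb

/-- The off-diagonal part of a quadratic form is four times the mean of its cross blocks. -/
theorem sum_offDiag_eq_sum_crossBlock (A : Matrix ι ι ℝ) (z : ι → ℝ) :
    (2 : ℝ) ^ Fintype.card ι * (∑ i, ∑ j, if i = j then 0 else A i j * z i * z j)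
      = ∑ I : Finset ι, 4 * (z ⬝ᵥ (crossBlock A I *ᵥ z)) := by
  have h1 : ∀ I : Finset ι, 4 * (z ⬝ᵥ (crossBlock A I *ᵥ z))
      = ∑ i, ∑ j, if i ∈ I ∧ j ∉ I then 4 * (A i j * z i * z j) else 0 := by
    intro I
    simp only [dotProduct, mulVec, Finset.mul_sum, crossBlock, of_apply]
    refine Finset.sum_congr rfl fun i _ => Finset.sum_congr rfl fun j _ => ?_
    split_ifs <;> ring
  simp_rw [h1]
  conv_rhs => rw [Finset.sum_comm]
  rw [Finset.mul_sum]
  refine Finset.sum_congr rfl fun i _ => ?_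
  conv_rhs => rw [Finset.sum_comm]
  rw [Finset.mul_sum]
  refine Finset.sum_congr rfl fun j _ => ?_
  split_ifs with h
  · subst h; simp
  · rw [← Finset.sum_filter, Finset.sum_const]
    -- The sets containing `i` but not `j` form a Boolean interval with `2^(n-2)` elements, hence
    -- the factor `4`.
    have h2 : (Finset.univ.filter fun I : Finset ι => i ∈ I ∧ j ∉ I)
        = Finset.Icc {i} (Finset.univ.erase j) := by
      ext I
      simp only [Finset.mem_filter, Finset.mem_univ, true_and, Finset.mem_Icc,
        Finset.singleton_subset_iff, Finset.subset_erase, Finset.subset_univ]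
    have h3 : ({i} : Finset ι) ⊆ Finset.univ.erase j := by simp [h]
    rw [h2, Finset.card_Icc_finset h3, Finset.card_erase_of_mem (Finset.mem_univ j),
      Finset.card_univ, Finset.card_singleton]
    have h4 : 2 ≤ Fintype.card ι := by
      have := Finset.card_le_univ ({i, j} : Finset ι)
      rwa [Finset.card_pair h] at this
    obtain ⟨n, hn⟩ := Nat.exists_eq_add_of_le h4
    rw [hn, show 2 + n - 1 - 1 = n by omega, pow_add]
    rw [nsmul_eq_mul]
    push_cast
    ring

variable {S : Type*} [MeasurableSpace S] {μ : Measure S} [IsProbabilityMeasure μ] {t : ℝ}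
  {Z : ι → S → ℝ}

/-- With the coordinates outside `I` frozen, the form is linear in the independent coordinates
inside `I`. Integrating these leaves the exponential of `a² t² ‖crossBlock A I Z‖²`, already
controlled. -/
theorem SubgaussianFamily.lintegral_eexp_crossBlock_le (h : SubgaussianFamily μ t Z)
    {A : Matrix ι ι ℝ} {a b : ℝ} (hA : OpBound A b) (hab : 8 * a ^ 2 * t ^ 4 * b ^ 2 ≤ 1)
    (I : Finset ι) :
    ∫⁻ ω, eexp (a * ((fun i => Z i ω) ⬝ᵥ (crossBlock A I *ᵥ fun i => Z i ω))) ∂μ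
      ≤ eexp (4 * a ^ 2 * t ^ 4 * frobSq A) := by
  have hm := h.measurable
  have hind := h.indep.indepFun_finset I Iᶜ disjoint_compl_right hm
  have hform : ∀ z z' : ι → ℝ, ∑ i : I, (∑ j : (Iᶜ : Finset ι), a * A i j * z' j) * z i
      = ∑ i ∈ I, a * (crossBlock A I *ᵥ z') i * z i := by
    intro z z'
    rw [Finset.sum_coe_sort I fun i => (∑ j : (Iᶜ : Finset ι), a * A i j * z' j) * z i]
    refine Finset.sum_congr rfl fun i hi => ?_
    rw [crossBlock_mulVec, if_pos hi, Finset.sum_coe_sort Iᶜ fun j => a * A i j * z' j,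
      Finset.mul_sum]
    congr 1
    exact Finset.sum_congr rfl fun j _ => by ring
  have hform2 : ∀ z z' : ι → ℝ, a * (z ⬝ᵥ (crossBlock A I *ᵥ z'))
      = ∑ i ∈ I, a * (crossBlock A I *ᵥ z') i * z i := by
    intro z z'
    rw [dotProduct, Finset.mul_sum]
    symm
    refine (Finset.sum_subset (Finset.subset_univ I) fun i _ hi => ?_).trans
      (Finset.sum_congr rfl fun i _ => by ring)
    rw [crossBlock_mulVec, if_neg hi]; ring
  have hsplit := lintegral_comp_prod_of_indepFun (μ := μ) (by fun_prop) (by fun_prop) hind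
    (F := fun z => eexp (∑ i : I, (∑ j : (Iᶜ : Finset ι), a * A i j * z.2 j) * z.1 i))
    (by fun_prop)
  calc _ = ∫⁻ ω, eexp (∑ i : I, (∑ j : (Iᶜ : Finset ι), a * A i j * Z j ω) * Z i ω) ∂μ := by
        refine lintegral_congr fun ω => ?_
        rw [hform2, hform (fun i => Z i ω) fun i => Z i ω]
    _ = ∫⁻ ω', ∫⁻ ω, eexp (∑ i : I, (∑ j : (Iᶜ : Finset ι), a * A i j * Z j ω') * Z i ω) ∂μ ∂μ :=
        hsplit
    _ ≤ ∫⁻ ω', eexp ((a ^ 2 * t ^ 2) * ((crossBlock A I *ᵥ fun i => Z i ω') ⬝ᵥ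
          (crossBlock A I *ᵥ fun i => Z i ω'))) ∂μ := by
        refine lintegral_mono fun ω' => ?_
        simp_rw [fun ω => hform (fun i => Z i ω) fun i => Z i ω']
        refine (h.lintegral_eexp_sum_le I _).trans (eexp_mono ?_)
        rw [dotProduct, Finset.mul_sum, Finset.mul_sum]
        refine (Finset.sum_le_sum_of_subset_of_nonneg (Finset.subset_univ I)
          fun i _ _ => by positivity).trans_eq (Finset.sum_congr rfl fun i _ => by ring)
    _ ≤ eexp (4 * (a ^ 2 * t ^ 2) * t ^ 2 * frobSq (crossBlock A I)) :=
        h.lintegral_eexp_norm_sq_le _ (hA.crossBlock I) (by positivity) (by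
          calc _ = 8 * a ^ 2 * t ^ 4 * b ^ 2 := by ring
            _ ≤ 1 := hab)
    _ ≤ _ := by
        refine eexp_mono ?_
        calc _ = 4 * a ^ 2 * t ^ 4 * frobSq (crossBlock A I) := by ring
          _ ≤ _ := by
            gcongr
            exact frobSq_crossBlock_le A I

theorem eexp_sum_le_sum_eexp {κ : Type*} (s : Finset κ) {w : ℝ} (hw : 0 ≤ w)
    (hs : (s.card : ℝ) * w = 1) (f : κ → ℝ) :
    eexp (∑ k ∈ s, w * f k) ≤ ∑ k ∈ s, ENNReal.ofReal w * eexp (f k) := by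
  have h := convexOn_exp.map_sum_le (t := s) (w := fun _ => w) (p := f) (fun _ _ => hw)
    (by simpa using hs) (fun _ _ => Set.mem_univ _)
  simp only [smul_eq_mul] at h
  refine (ENNReal.ofReal_le_ofReal h).trans_eq ?_
  rw [ENNReal.ofReal_sum_of_nonneg fun k _ => by positivity]
  exact Finset.sum_congr rfl fun k _ => ENNReal.ofReal_mul hw

/-- Decoupling: the form is an average of cross blocks multiplied by `4`, so Jensen reduces it to
one cross block with `4 * a` for `a`. This multiplies the constants `8` and `4` of that bound by
`16`. -/
theorem SubgaussianFamily.lintegral_eexp_offDiag_le (h : SubgaussianFamily μ t Z)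
    {A : Matrix ι ι ℝ} {a b : ℝ} (hA : OpBound A b) (hab : 128 * a ^ 2 * t ^ 4 * b ^ 2 ≤ 1) :
    ∫⁻ ω, eexp (a * ∑ i, ∑ j, if i = j then 0 else A i j * Z i ω * Z j ω) ∂μ
      ≤ eexp (64 * a ^ 2 * t ^ 4 * frobSq A) := by
  have hm := h.measurable
  set N : ℝ := 2 ^ Fintype.card ι with hN
  have hN0 : 0 < N := by positivity
  have hcard : ((Finset.univ : Finset (Finset ι)).card : ℝ) * N⁻¹ = 1 := by
    rw [Finset.card_univ, Fintype.card_finset, hN]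
    push_cast
    exact mul_inv_cancel₀ hN0.ne'
  have hle : ∀ ω, eexp (a * ∑ i, ∑ j, if i = j then 0 else A i j * Z i ω * Z j ω)
      ≤ ∑ I : Finset ι, ENNReal.ofReal N⁻¹ *
        eexp (4 * a * ((fun i => Z i ω) ⬝ᵥ (crossBlock A I *ᵥ fun i => Z i ω))) := by
    intro ω
    refine le_trans (eexp_mono (le_of_eq ?_))
      (eexp_sum_le_sum_eexp Finset.univ (inv_nonneg.2 hN0.le) hcard _)
    have h1 := sum_offDiag_eq_sum_crossBlock A fun i => Z i ω
    rw [← Finset.mul_sum]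
    simp_rw [mul_comm 4 a, mul_assoc a 4]
    rw [← Finset.mul_sum, ← h1, ← hN]
    field_simp
  have hmeas : ∀ I : Finset ι, Measurable fun ω =>
      eexp (4 * a * ((fun i => Z i ω) ⬝ᵥ (crossBlock A I *ᵥ fun i => Z i ω))) := by
    intro I
    simp only [mulVec, dotProduct]
    fun_prop
  refine (lintegral_mono hle).trans ?_
  rw [lintegral_finsetSum _ fun I _ => (hmeas I).const_mul _]
  calc _ ≤ ∑ _I : Finset ι, ENNReal.ofReal N⁻¹ * eexp (64 * a ^ 2 * t ^ 4 * frobSq A) := by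
        refine Finset.sum_le_sum fun I _ => ?_
        rw [lintegral_const_mul _ (hmeas I)]
        gcongr
        refine (h.lintegral_eexp_crossBlock_le hA (a := 4 * a) (by nlinarith) I).trans_eq ?_
        congr 1; ring
    _ = eexp (64 * a ^ 2 * t ^ 4 * frobSq A) := by
        rw [← Finset.sum_mul, Finset.sum_const, nsmul_eq_mul,
          ← ENNReal.ofReal_natCast, ← ENNReal.ofReal_mul (by positivity), hcard]
        simp

/-- Moment generating function form of the Hanson–Wright inequality. -/
theorem SubgaussianFamily.lintegral_eexp_quadratic_le (h : SubgaussianFamily μ t Z)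
    {A : Matrix ι ι ℝ} {a b : ℝ} (hA : OpBound A b) (hb : 0 ≤ b) (hab : 32 * |a| * t ^ 2 * b ≤ 1) :
    ∫⁻ ω, eexp (a * ((fun i => Z i ω) ⬝ᵥ (A *ᵥ fun i => Z i ω) - A.trace)) ∂μ
      ≤ eexp (256 * a ^ 2 * t ^ 4 * frobSq A) := by
  have hm := h.measurable
  -- Diagonal and off-diagonal parts are dependent; convexity of the exponential separates them at
  -- the price of doubling `a`. The constants become `4 · 48 ≤ 256` and `4 · 64 = 256`.
  set D : S → ℝ := fun ω => ∑ i, (2 * a * A i i) * (Z i ω ^ 2 - 1) with hD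
  set O : S → ℝ := fun ω => (2 * a) * ∑ i, ∑ j, if i = j then 0 else A i j * Z i ω * Z j ω with hO
  have hsplit : ∀ ω, a * ((fun i => Z i ω) ⬝ᵥ (A *ᵥ fun i => Z i ω) - A.trace)
      = ∑ k : Bool, (1 / 2) * (if k then D ω else O ω) := by
    intro ω
    simp only [Fintype.sum_bool, if_true, hD, hO, Bool.false_eq_true, if_false]
    have h1 : (fun i => Z i ω) ⬝ᵥ (A *ᵥ fun i => Z i ω) =
        ∑ i, A i i * Z i ω ^ 2 + ∑ i, ∑ j, if i = j then 0 else A i j * Z i ω * Z j ω := by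
      simp only [dotProduct, mulVec, Finset.mul_sum]
      rw [← Finset.sum_add_distrib]
      refine Finset.sum_congr rfl fun i _ => ?_
      rw [← Finset.add_sum_erase _ _ (Finset.mem_univ i),
        ← Finset.add_sum_erase _ _ (Finset.mem_univ i), if_pos rfl, zero_add]
      congr 1
      · ring
      · refine Finset.sum_congr rfl fun j hj => ?_
        rw [if_neg (Finset.ne_of_mem_erase hj).symm]; ring
    have h2 : ∑ i, (2 * a * A i i) * (Z i ω ^ 2 - 1)
        = 2 * a * (∑ i, A i i * Z i ω ^ 2 - A.trace) := by
      rw [Matrix.trace, ← Finset.sum_sub_distrib, Finset.mul_sum]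
      exact Finset.sum_congr rfl fun i _ => by simp only [diag_apply]; ring
    rw [h1, h2]; ring
  have hle : ∀ ω, eexp (a * ((fun i => Z i ω) ⬝ᵥ (A *ᵥ fun i => Z i ω) - A.trace))
      ≤ ENNReal.ofReal (1 / 2) * eexp (D ω) + ENNReal.ofReal (1 / 2) * eexp (O ω) := by
    intro ω
    rw [hsplit]
    refine (eexp_sum_le_sum_eexp Finset.univ (by norm_num) (by simp) _).trans_eq ?_
    simp
  have hDm : Measurable fun ω => eexp (D ω) := by fun_prop
  have hab' : |a| * t ^ 2 * b ≤ 1 / 32 := by linarith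
  have hX : 0 ≤ |a| * t ^ 2 * b := by positivity
  have hsq : a ^ 2 * t ^ 4 * b ^ 2 ≤ (1 / 32) ^ 2 := by
    calc a ^ 2 * t ^ 4 * b ^ 2 = (|a| * t ^ 2 * b) ^ 2 := by
          rw [mul_pow, mul_pow, sq_abs]; ring
      _ ≤ _ := by gcongr
  have hDle : ∫⁻ ω, eexp (D ω) ∂μ ≤ eexp (256 * a ^ 2 * t ^ 4 * frobSq A) := by
    refine (h.lintegral_eexp_sum_sq_le Finset.univ _ fun i _ => ?_).trans (eexp_mono ?_)
    · have := hA.abs_diag_le hb i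
      rw [abs_mul, abs_mul, abs_two]
      calc 2 * |a| * |A i i| * t ^ 2 ≤ 2 * |a| * b * t ^ 2 := by gcongr
        _ ≤ 1 / 4 := by linarith
    · have h1 : ∑ i, (2 * a * A i i) ^ 2 ≤ 4 * a ^ 2 * frobSq A := by
        rw [frobSq, Finset.mul_sum]
        refine Finset.sum_le_sum fun i _ => ?_
        have : A i i ^ 2 ≤ ∑ j, A i j ^ 2 :=
          Finset.single_le_sum (f := fun j => A i j ^ 2) (fun j _ => sq_nonneg _)
            (Finset.mem_univ i)
        calc (2 * a * A i i) ^ 2 = 4 * a ^ 2 * A i i ^ 2 := by ring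
          _ ≤ _ := by gcongr
      have h2 : 48 * t ^ 4 * ∑ i, (2 * a * A i i) ^ 2 ≤ 48 * t ^ 4 * (4 * a ^ 2 * frobSq A) := by
        gcongr
      have h3 : 0 ≤ a ^ 2 * t ^ 4 * frobSq A := by
        have := frobSq_nonneg A; positivity
      linarith
  have hOle : ∫⁻ ω, eexp (O ω) ∂μ ≤ eexp (256 * a ^ 2 * t ^ 4 * frobSq A) := by
    refine (h.lintegral_eexp_offDiag_le hA (a := 2 * a) ?_).trans_eq ?_
    · nlinarith
    · congr 1; ring
  refine (lintegral_mono hle).trans ?_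
  rw [lintegral_add_left (hDm.const_mul _), lintegral_const_mul _ hDm,
    lintegral_const_mul' _ _ ENNReal.ofReal_ne_top]
  calc _ ≤ ENNReal.ofReal (1 / 2) * eexp (256 * a ^ 2 * t ^ 4 * frobSq A)
        + ENNReal.ofReal (1 / 2) * eexp (256 * a ^ 2 * t ^ 4 * frobSq A) := by gcongr
    _ = _ := by
      rw [← add_mul, ← ENNReal.ofReal_add (by norm_num) (by norm_num)]
      norm_num

end HansonWright

/-! ### Norms of random vectors from exponential moments of linear functionals -/

section RandomVector

variable {S : Type*} [MeasurableSpace S] {μ : Measure S}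

/-- Chernoff's bound. -/
theorem measure_le_of_lintegral_eexp_le {f : S → ℝ} (hf : Measurable f) {a b : ℝ}
    (h : ∫⁻ ω, eexp (f ω) ∂μ ≤ eexp b) : μ {ω | a ≤ f ω} ≤ eexp (b - a) := by
  have h1 := mul_meas_ge_le_lintegral (μ := μ) (f := fun ω => eexp (f ω)) (by fun_prop) (eexp a)
  have h2 : {ω | a ≤ f ω} ⊆ {ω | eexp a ≤ eexp (f ω)} := fun ω hω => eexp_mono hω
  calc μ {ω | a ≤ f ω} = eexp (-a) * (eexp a * μ {ω | a ≤ f ω}) := by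
        rw [← mul_assoc, mul_comm (eexp (-a)), eexp_mul_eexp_neg, one_mul]
    _ ≤ eexp (-a) * eexp b := by
        gcongr
        exact (mul_le_mul_right (measure_mono h2) _).trans (h1.trans h)
    _ = eexp (b - a) := by rw [← eexp_add]; congr 1; ring

-- A volume argument in place of a net. The ball of radius `R/4` centred at `v₀ = (R/2) N/‖N‖` lies
-- in the ball of radius `R`, fills a fraction `4^{-dim}` of it, and on it `⟨v, N⟩ ≥ (R/4)‖N‖`.
-- Averaging the hypothesis over the large ball gives the claim.
open Metric in
theorem lintegral_eexp_norm_le [SFinite μ] {E : Type*} [NormedAddCommGroup E] [InnerProductSpace ℝ E]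
    [FiniteDimensional ℝ E] [MeasurableSpace E] [BorelSpace E] {N : S → E} (hN : Measurable N)
    {R : ℝ} (hR : 0 < R) {M : ENNReal}
    (h : ∀ v : E, ‖v‖ ≤ R → ∫⁻ ω, eexp (inner ℝ v (N ω)) ∂μ ≤ M) :
    ∫⁻ ω, eexp (R / 4 * ‖N ω‖) ∂μ ≤ 4 ^ Module.finrank ℝ E * M := by
  set D := Module.finrank ℝ E
  set vR : ENNReal := volume (closedBall (0 : E) R) with hvR
  have hvR0 : vR ≠ 0 := (measure_closedBall_pos volume _ hR).ne'
  have hvRt : vR ≠ ⊤ := measure_closedBall_lt_top.ne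
  have hvol : ∀ x : E, volume (closedBall x (R / 4)) * 4 ^ D = vR := by
    intro x
    rw [hvR, Measure.addHaar_closedBall volume x (by positivity),
      Measure.addHaar_closedBall volume 0 hR.le, mul_right_comm]
    congr 1
    have h4 : (4 : ENNReal) ^ D = ENNReal.ofReal (4 ^ D) := by
      rw [ENNReal.ofReal_pow (by norm_num)]; simp
    rw [h4, ← ENNReal.ofReal_mul (by positivity), ← mul_pow]
    congr 2; ring
  have hmeas : Measurable (Function.uncurry fun (ω : S) (v : E) => eexp (inner ℝ v (N ω))) := by
    simp only [Function.uncurry_def]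
    exact measurable_eexp.comp (measurable_snd.inner (hN.comp measurable_fst))
  have hpt : ∀ ω, vR * eexp (R / 4 * ‖N ω‖)
      ≤ 4 ^ D * ∫⁻ v in closedBall (0 : E) R, eexp (inner ℝ v (N ω)) := by
    intro ω
    set v₀ : E := (R / 2 * ‖N ω‖⁻¹) • N ω with hv₀
    have hv₀n : ‖v₀‖ ≤ R / 2 := by
      rw [hv₀, norm_smul, Real.norm_of_nonneg (by positivity), mul_assoc]
      have : ‖N ω‖⁻¹ * ‖N ω‖ ≤ 1 := inv_mul_le_one
      nlinarith
    have hv₀i : inner ℝ v₀ (N ω) = R / 2 * ‖N ω‖ := by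
      rw [hv₀, real_inner_smul_left, real_inner_self_eq_norm_sq]
      rcases eq_or_ne ‖N ω‖ 0 with h0 | h0
      · simp [h0]
      · field_simp
    have hsub : closedBall v₀ (R / 4) ⊆ closedBall (0 : E) R := by
      intro v hv
      rw [mem_closedBall, dist_eq_norm] at hv
      rw [mem_closedBall_zero_iff]
      have := norm_add_le (v - v₀) v₀
      rw [sub_add_cancel] at this
      linarith
    rw [← hvol v₀]
    calc volume (closedBall v₀ (R / 4)) * 4 ^ D * eexp (R / 4 * ‖N ω‖)
        = 4 ^ D * (eexp (R / 4 * ‖N ω‖) * volume (closedBall v₀ (R / 4))) := by ring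
      _ = 4 ^ D * ∫⁻ _v in closedBall v₀ (R / 4), eexp (R / 4 * ‖N ω‖) := by
          rw [setLIntegral_const]
      _ ≤ 4 ^ D * ∫⁻ v in closedBall v₀ (R / 4), eexp (inner ℝ v (N ω)) := by
          gcongr 4 ^ D * ?_
          refine setLIntegral_mono' measurableSet_closedBall fun v hv => eexp_mono ?_
          rw [mem_closedBall, dist_eq_norm] at hv
          have h1 : inner ℝ v (N ω) = inner ℝ v₀ (N ω) + inner ℝ (v - v₀) (N ω) := by
            rw [← inner_add_left, add_sub_cancel]
          have h2 := abs_le.1 (abs_real_inner_le_norm (v - v₀) (N ω))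
          have h3 : ‖v - v₀‖ * ‖N ω‖ ≤ R / 4 * ‖N ω‖ := by gcongr
          rw [h1, hv₀i]
          linarith [h2.1]
      _ ≤ _ := by
          gcongr 4 ^ D * ?_
          exact lintegral_mono_set hsub
  have key : vR * ∫⁻ ω, eexp (R / 4 * ‖N ω‖) ∂μ ≤ vR * (4 ^ D * M) := by
    rw [← lintegral_const_mul' _ _ hvRt]
    calc _ ≤ ∫⁻ ω, 4 ^ D * (∫⁻ v in closedBall (0 : E) R, eexp (inner ℝ v (N ω))) ∂μ :=
          lintegral_mono hpt
      _ = 4 ^ D * ∫⁻ v in closedBall (0 : E) R, ∫⁻ ω, eexp (inner ℝ v (N ω)) ∂μ := by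
          rw [lintegral_const_mul' _ _ (by simp), lintegral_lintegral_swap hmeas.aemeasurable]
      _ ≤ 4 ^ D * ∫⁻ _v in closedBall (0 : E) R, M := by
          gcongr 4 ^ D * ?_
          exact setLIntegral_mono' measurableSet_closedBall fun v hv =>
            h v (mem_closedBall_zero_iff.1 hv)
      _ = vR * (4 ^ D * M) := by rw [setLIntegral_const]; ring
  exact (ENNReal.mul_le_mul_iff_right hvR0 hvRt).1 key

end RandomVector

/-! ### Operator and Frobenius norms -/

section Norms

variable {ι : Type*} [Fintype ι]

open Matrix

theorem dotProduct_self_eq_norm_sq (x : ι → ℝ) : x ⬝ᵥ x = ‖WithLp.toLp 2 x‖ ^ 2 := by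
  rw [EuclideanSpace.real_norm_sq_eq]
  simp [dotProduct, sq]

theorem frobSq_transpose (A : Matrix ι ι ℝ) : frobSq Aᵀ = frobSq A := by
  simp only [frobSq, transpose_apply]
  exact Finset.sum_comm

theorem frobNorm_eq_sqrt (A : Matrix ι ι ℝ) : frobNorm A = √(frobSq A) := rfl

theorem frobNorm_sq (A : Matrix ι ι ℝ) : frobNorm A ^ 2 = frobSq A :=
  Real.sq_sqrt (frobSq_nonneg A)

theorem frobNorm_nonneg (A : Matrix ι ι ℝ) : 0 ≤ frobNorm A := Real.sqrt_nonneg _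

theorem frobSq_smul (c : ℝ) (A : Matrix ι ι ℝ) : frobSq (c • A) = c ^ 2 * frobSq A := by
  simp only [frobSq, Finset.mul_sum, Matrix.smul_apply, smul_eq_mul, mul_pow]

theorem opBound_frobNorm (A : Matrix ι ι ℝ) : OpBound A (frobNorm A) := by
  intro x
  rw [frobNorm_sq, frobSq, Finset.sum_mul]
  refine Finset.sum_le_sum fun i _ => ?_
  have h := Finset.sum_mul_sq_le_sq_mul_sq Finset.univ (fun j => A i j) x
  simp only [mulVec, dotProduct, ← sq]
  exact h

variable [DecidableEq ι]

theorem opNorm_nonneg (A : Matrix ι ι ℝ) : 0 ≤ opNorm A := norm_nonneg _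

theorem opBound_opNorm (A : Matrix ι ι ℝ) : OpBound A (opNorm A) := by
  intro x
  have h := (Matrix.toEuclideanCLM (𝕜 := ℝ) A).le_opNorm (WithLp.toLp 2 x)
  rw [toEuclideanCLM_toLp] at h
  rw [dotProduct_self_eq_norm_sq, dotProduct_self_eq_norm_sq, ← mul_pow]
  gcongr
  exact h

theorem OpBound.opNorm_le {A : Matrix ι ι ℝ} {b : ℝ} (h : OpBound A b) (hb : 0 ≤ b) :
    opNorm A ≤ b := by
  refine ContinuousLinearMap.opNorm_le_bound _ hb fun x => ?_
  have h1 := h x.ofLp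
  rw [dotProduct_self_eq_norm_sq, dotProduct_self_eq_norm_sq, ← mul_pow] at h1
  exact le_of_sq_le_sq h1 (by positivity)

theorem opNorm_add_le (A B : Matrix ι ι ℝ) : opNorm (A + B) ≤ opNorm A + opNorm B := by
  unfold opNorm; rw [map_add]; exact norm_add_le _ _

theorem opNorm_sum_le {κ : Type*} (s : Finset κ) (A : κ → Matrix ι ι ℝ) :
    opNorm (∑ k ∈ s, A k) ≤ ∑ k ∈ s, opNorm (A k) := by
  unfold opNorm; rw [map_sum]; exact norm_sum_le _ _

theorem opNorm_mul_le (A B : Matrix ι ι ℝ) : opNorm (A * B) ≤ opNorm A * opNorm B := by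
  unfold opNorm; rw [map_mul]; exact norm_mul_le _ _

theorem opNorm_smul_one_le (c : ℝ) : opNorm (c • (1 : Matrix ι ι ℝ)) ≤ |c| := by
  refine OpBound.opNorm_le (fun x => ?_) (abs_nonneg c)
  simp only [smul_mulVec, one_mulVec, smul_dotProduct, dotProduct_smul, smul_eq_mul, sq_abs]
  apply le_of_eq; ring

theorem opNorm_mul_self {R : Matrix ι ι ℝ} (hR : Rᵀ = R) : opNorm (R * R) = opNorm R ^ 2 := by
  unfold opNorm
  have h : star (Matrix.toEuclideanCLM (𝕜 := ℝ) R) = Matrix.toEuclideanCLM (𝕜 := ℝ) R := by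
    rw [← map_star, star_eq_conjTranspose, conjTranspose_eq_transpose_of_trivial, hR]
  have h2 := CStarRing.norm_star_mul_self (x := Matrix.toEuclideanCLM (𝕜 := ℝ) R)
  rw [h] at h2
  rw [map_mul, h2, sq]

theorem frobSq_mul_le (A B : Matrix ι ι ℝ) : frobSq (A * B) ≤ opNorm A ^ 2 * frobSq B := by
  have h : ∀ M : Matrix ι ι ℝ, frobSq M = ∑ j, (M.col j) ⬝ᵥ (M.col j) := by
    intro M
    simp only [frobSq, dotProduct, col_apply, ← sq]
    exact Finset.sum_comm
  rw [h, h, Finset.mul_sum]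
  refine Finset.sum_le_sum fun j _ => ?_
  have : (A * B).col j = A *ᵥ B.col j := by
    ext i; simp [mul_apply, mulVec, dotProduct]
  rw [this]
  exact opBound_opNorm A _

theorem frobSq_conj_le {R : Matrix ι ι ℝ} (hR : Rᵀ = R) (A : Matrix ι ι ℝ) :
    frobSq (R * A * R) ≤ opNorm (R * R) ^ 2 * frobSq A := by
  have h1 : frobSq (R * A * R) = frobSq (R * (R * A)ᵀ) := by
    rw [← frobSq_transpose, transpose_mul, hR]
  rw [h1, opNorm_mul_self hR]
  calc _ ≤ opNorm R ^ 2 * frobSq (R * A)ᵀ := frobSq_mul_le _ _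
    _ ≤ opNorm R ^ 2 * (opNorm R ^ 2 * frobSq A) := by
        rw [frobSq_transpose]; gcongr; exact frobSq_mul_le _ _
    _ = _ := by ring

theorem opNorm_conj_le {R : Matrix ι ι ℝ} (hR : Rᵀ = R) (A : Matrix ι ι ℝ) :
    opNorm (R * A * R) ≤ opNorm (R * R) * opNorm A := by
  rw [opNorm_mul_self hR]
  calc _ ≤ opNorm (R * A) * opNorm R := opNorm_mul_le _ _
    _ ≤ opNorm R * opNorm A * opNorm R := by
        gcongr
        · exact opNorm_nonneg _
        · exact opNorm_mul_le _ _
    _ = _ := by ring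

theorem abs_dotProduct_mulVec_le (A : Matrix ι ι ℝ) (x : ι → ℝ) :
    |x ⬝ᵥ (A *ᵥ x)| ≤ opNorm A * (x ⬝ᵥ x) := by
  have h1 : x ⬝ᵥ (A *ᵥ x) = inner ℝ (WithLp.toLp 2 x)
      (Matrix.toEuclideanCLM (𝕜 := ℝ) A (WithLp.toLp 2 x)) := by
    rw [inner_toEuclideanCLM]
  rw [h1, dotProduct_self_eq_norm_sq]
  refine (abs_real_inner_le_norm _ _).trans ?_
  have := (Matrix.toEuclideanCLM (𝕜 := ℝ) A).le_opNorm (WithLp.toLp 2 x)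
  calc _ ≤ ‖WithLp.toLp 2 x‖ * (opNorm A * ‖WithLp.toLp 2 x‖) := by gcongr; exact this
    _ = _ := by ring

end Norms

/-! ### Extreme eigenvalues, condition number and square roots. -/

section Spectrum

variable {ι : Type*} [Fintype ι] [DecidableEq ι]

open Matrix

theorem posDef_of_phiMin_pos {A : Matrix ι ι ℝ} (hA : A.IsHermitian) (h : 0 < phiMin A) :
    A.PosDef := by
  rw [hA.posDef_iff_eigenvalues_pos]
  intro i
  exact h.trans_le (csInf_le (finite_real_spectrum (A := A)).bddBelow
    (hA.eigenvalues_mem_spectrum_real i))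

theorem orthogonal_dotProduct {U : Matrix ι ι ℝ} (hU : Uᵀ * U = 1) (x : ι → ℝ) :
    (U *ᵥ x) ⬝ᵥ (U *ᵥ x) = x ⬝ᵥ x := by
  rw [dotProduct_mulVec, ← mulVec_transpose, mulVec_mulVec, hU, one_mulVec]

theorem dotProduct_mulVec_self_eq_sum {A : Matrix ι ι ℝ} (hA : A.IsHermitian) :
    ∃ U : Matrix ι ι ℝ, (∀ x, (Uᵀ *ᵥ x) ⬝ᵥ (Uᵀ *ᵥ x) = x ⬝ᵥ x) ∧
      ∀ x, (A *ᵥ x) ⬝ᵥ (A *ᵥ x) = ∑ l, hA.eigenvalues l ^ 2 * (Uᵀ *ᵥ x) l ^ 2 := by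
  obtain ⟨U, hU1, hU2, hU3⟩ := exists_orthogonal_diagonalization hA
  refine ⟨U, fun x => orthogonal_dotProduct (by rwa [transpose_transpose]) x, fun x => ?_⟩
  conv_lhs => rw [hU3, ← mulVec_mulVec, ← mulVec_mulVec]
  rw [orthogonal_dotProduct hU1]
  simp only [dotProduct, mulVec_diagonal]
  exact Finset.sum_congr rfl fun l _ => by ring

theorem opNorm_le_phiMax {A : Matrix ι ι ℝ} (hA : A.PosDef) [Nonempty ι] :
    opNorm A ≤ phiMax A := by
  have hle : ∀ l, hA.isHermitian.eigenvalues l ≤ phiMax A := fun l =>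
    le_csSup (finite_real_spectrum (A := A)).bddAbove
      (hA.isHermitian.eigenvalues_mem_spectrum_real l)
  have h0 : 0 ≤ phiMax A := (hA.eigenvalues_pos (Classical.arbitrary ι)).le.trans (hle _)
  obtain ⟨U, hU, hquad⟩ := dotProduct_mulVec_self_eq_sum hA.isHermitian
  refine OpBound.opNorm_le (fun x => ?_) h0
  rw [hquad, ← hU x, dotProduct, Finset.mul_sum]
  refine Finset.sum_le_sum fun l _ => ?_
  rw [← sq]
  have := (hA.eigenvalues_pos l).le
  gcongr
  exact hle l

theorem phiMin_pos {A : Matrix ι ι ℝ} (hA : A.PosDef) [Nonempty ι] : 0 < phiMin A := by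
  have hmem : phiMin A ∈ spectrum ℝ A :=
    Set.Nonempty.csInf_mem ⟨_, hA.isHermitian.eigenvalues_mem_spectrum_real
      (Classical.arbitrary ι)⟩ (finite_real_spectrum (A := A))
  rw [hA.isHermitian.spectrum_real_eq_range_eigenvalues] at hmem
  obtain ⟨i, hi⟩ := hmem
  rw [← hi]
  exact hA.eigenvalues_pos i

theorem opNorm_inv_le {A : Matrix ι ι ℝ} (hA : A.PosDef) [Nonempty ι] :
    opNorm A⁻¹ ≤ (phiMin A)⁻¹ := by
  have h0 := phiMin_pos hA
  have hle : ∀ l, phiMin A ≤ hA.isHermitian.eigenvalues l := fun l =>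
    csInf_le (finite_real_spectrum (A := A)).bddBelow
      (hA.isHermitian.eigenvalues_mem_spectrum_real l)
  obtain ⟨U, hU, hquad⟩ := dotProduct_mulVec_self_eq_sum hA.isHermitian
  have hdet : IsUnit A.det := hA.det_pos.ne'.isUnit
  refine OpBound.opNorm_le (fun x => ?_) (by positivity)
  have h1 : phiMin A ^ 2 * ((A⁻¹ *ᵥ x) ⬝ᵥ (A⁻¹ *ᵥ x)) ≤ x ⬝ᵥ x := by
    have h2 := hquad (A⁻¹ *ᵥ x)
    rw [mulVec_mulVec, mul_nonsing_inv _ hdet, one_mulVec] at h2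
    rw [h2, ← hU (A⁻¹ *ᵥ x), dotProduct, Finset.mul_sum]
    refine Finset.sum_le_sum fun l _ => ?_
    rw [← sq]
    gcongr
    exact hle l
  rw [inv_pow, inv_mul_eq_div, le_div_iff₀ (by positivity)]
  linarith

theorem opNorm_mul_opNorm_inv_le_kappa {A : Matrix ι ι ℝ} (hA : A.PosDef) [Nonempty ι] :
    opNorm A * opNorm A⁻¹ ≤ kappa A := by
  rw [kappa, div_eq_mul_inv]
  exact mul_le_mul (opNorm_le_phiMax hA) (opNorm_inv_le hA) (opNorm_nonneg _)
    ((opNorm_nonneg A).trans (opNorm_le_phiMax hA))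

open scoped MatrixOrder in
theorem sqrt_mul_self_and_symm {A : Matrix ι ι ℝ} (hA : A.PosDef) :
    CFC.sqrt A * CFC.sqrt A = A ∧ (CFC.sqrt A)ᵀ = CFC.sqrt A := by
  have h0 : 0 ≤ A := hA.posSemidef.nonneg
  refine ⟨CFC.sqrt_mul_sqrt_self A h0, ?_⟩
  have h1 : (CFC.sqrt A).PosSemidef := Matrix.nonneg_iff_posSemidef.1 (CFC.sqrt_nonneg A)
  have := h1.isHermitian
  rwa [IsHermitian, conjTranspose_eq_transpose_of_trivial] at this

open scoped MatrixOrder in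
/-- Symmetric square roots of a positive definite matrix and of its inverse. -/
theorem exists_symm_sqrt {A : Matrix ι ι ℝ} (hA : A.PosDef) :
    ∃ R Q : Matrix ι ι ℝ, Rᵀ = R ∧ Qᵀ = Q ∧ R * R = A⁻¹ ∧ Q * Q = A ∧ R * Q = 1 ∧ Q * R = 1 := by
  obtain ⟨h1, h2⟩ := sqrt_mul_self_and_symm hA
  set Q := CFC.sqrt A
  have hdet : IsUnit Q.det := by
    have h3 := hA.det_pos
    rw [← h1, det_mul] at h3
    exact (left_ne_zero_of_mul h3.ne').isUnit
  refine ⟨Q⁻¹, Q, ?_, h2, ?_, h1, nonsing_inv_mul _ hdet, mul_nonsing_inv _ hdet⟩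
  · rw [transpose_nonsing_inv, h2]
  · rw [← Matrix.mul_inv_rev, h1]

end Spectrum

/-! ### A lower bound for the log-determinant -/

section LogDet

variable {ι : Type*} [Fintype ι] [DecidableEq ι]

open Matrix

/-- The left side of the logarithm bound is quadratic up to `e = 1` and only linear beyond. The
factor `θ` compensates: `θ * |e| ≤ 1` turns `θ * e ^ 2` into at most `e` for large `e`. -/
theorem sub_log_one_add_ge {e θ : ℝ} (he : -1 < e) (h1 : θ ≤ 1)
    (hθ : θ * |e| ≤ 1) : θ * e ^ 2 / 4 ≤ e - Real.log (1 + e) := by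
  have hpos : 0 < 1 + e := by linarith
  rcases le_total e 1 with hle | hge
  · have h5 : Real.log (1 + e) ≤ e - e ^ 2 / 4 := by
      rcases le_total 0 e with hn | hn
      · rw [Real.log_le_iff_le_exp hpos]
        have h3 := Real.quadratic_le_exp_of_nonneg (x := e - e ^ 2 / 4) (by nlinarith)
        have h4 : e ^ 2 * (9 / 16) ≤ (e - e ^ 2 / 4) ^ 2 := by
          have : (e - e ^ 2 / 4) ^ 2 = e ^ 2 * (1 - e / 4) ^ 2 := by ring
          rw [this]
          gcongr
          nlinarith
        nlinarith [sq_nonneg e]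
      · have h3 := Real.hasSum_pow_div_log_of_abs_lt_one (x := -e) (by
          rw [abs_neg, abs_of_nonpos hn]; linarith)
        have h4 := sum_le_hasSum (Finset.range 2) (fun n _ => by
          have : 0 ≤ -e := by linarith
          positivity) h3
        simp only [Finset.sum_range_succ, Finset.sum_range_zero] at h4
        norm_num at h4
        nlinarith [sq_nonneg e]
    nlinarith [sq_nonneg e]
  · have h2 : Real.log (1 + e) ≤ e / 2 + 1 / 4 := by
      have h3 : Real.log ((1 + e) / 2) ≤ (1 + e) / 2 - 1 :=
        Real.log_le_sub_one_of_pos (by positivity)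
      rw [Real.log_div hpos.ne' two_ne_zero] at h3
      linarith [Real.log_two_lt_d9]
    rw [abs_of_pos (by linarith)] at hθ
    have : θ * e ^ 2 ≤ e := by nlinarith
    linarith

theorem det_one_add_eq_prod {E : Matrix ι ι ℝ} (hE : E.IsHermitian) :
    (1 + E).det = ∏ l, (1 + hE.eigenvalues l) := by
  obtain ⟨U, hU1, hU2, hU3⟩ := exists_orthogonal_diagonalization hE
  have h : 1 + E = U * diagonal (fun l => 1 + hE.eigenvalues l) * Uᵀ := by
    have h1 : diagonal (fun l => 1 + hE.eigenvalues l) = 1 + diagonal hE.eigenvalues := by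
      rw [← diagonal_one, diagonal_add]
    rw [h1, mul_add, add_mul, mul_one, hU2, ← hU3]
  rw [h, det_mul, det_mul, det_diagonal]
  have h2 : U.det * Uᵀ.det = 1 := by rw [← det_mul, hU2, det_one]
  calc _ = (U.det * Uᵀ.det) * ∏ l, (1 + hE.eigenvalues l) := by ring
    _ = _ := by rw [h2, one_mul]

theorem frobSq_eq_sum_eigenvalues_sq {E : Matrix ι ι ℝ} (hE : E.IsHermitian) :
    frobSq E = ∑ l, hE.eigenvalues l ^ 2 := by
  obtain ⟨U, hU1, hU2, hU3⟩ := exists_orthogonal_diagonalization hE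
  have hsymm : Eᵀ = E := by rwa [IsHermitian, conjTranspose_eq_transpose_of_trivial] at hE
  have h : E * E = U * (diagonal hE.eigenvalues * diagonal hE.eigenvalues) * Uᵀ := by
    conv_lhs => rw [hU3]
    calc _ = U * diagonal hE.eigenvalues * (Uᵀ * U) * diagonal hE.eigenvalues * Uᵀ := by
          simp only [Matrix.mul_assoc]
      _ = _ := by rw [hU1, mul_one]; simp only [Matrix.mul_assoc]
  rw [frobSq_eq_trace, hsymm, h, trace_mul_cycle, hU1, one_mul, diagonal_mul_diagonal,
    trace_diagonal]
  exact Finset.sum_congr rfl fun l _ => (sq _).symm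

/-- Restricted strong convexity of the negative log-determinant. -/
theorem log_det_lower_bound {A D : Matrix ι ι ℝ} (hA : A.PosDef) (hAD : (A + D).PosDef) {θ : ℝ}
    (h0 : 0 ≤ θ) (h1 : θ ≤ 1) (hθ : θ * (opNorm A⁻¹ * opNorm D) ≤ 1) :
    θ * frobSq D ≤ 4 * opNorm A ^ 2 *
      (Real.log A.det - Real.log (A + D).det + (A⁻¹ * D).trace) := by
  obtain ⟨R, Q, hR, hQ, hRR, hQQ, hRQ, hQR⟩ := exists_symm_sqrt hA
  have hD : Dᵀ = D := by
    have h2 := hAD.isHermitian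
    have h3 := hA.isHermitian
    rw [IsHermitian, conjTranspose_eq_transpose_of_trivial] at h2 h3
    rw [transpose_add, h3] at h2
    exact add_left_cancel h2
  -- With `R = A^{-1/2}` one has `1 + E = R(A + D)R`, so the remainder becomes the sum of `e -
  -- log(1+e)` over the eigenvalues of `E`. Positivity of `A + D` gives `e > -1`.
  set E := R * D * R with hEdef
  have hE : E.IsHermitian := by
    rw [IsHermitian, conjTranspose_eq_transpose_of_trivial, hEdef, transpose_mul, transpose_mul,
      hR, hD, Matrix.mul_assoc]
  have hRAR : R * A * R = 1 := by
    rw [← hQQ, ← Matrix.mul_assoc R, hRQ, one_mul, hQR]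
  have hconj : 1 + E = R * (A + D) * R := by
    rw [mul_add, add_mul, hRAR]
  have hev : ∀ l, -1 < hE.eigenvalues l ∧
      |hE.eigenvalues l| ≤ opNorm A⁻¹ * opNorm D := by
    intro l
    set u : ι → ℝ := ⇑(hE.eigenvectorBasis l) with hu
    have huu : u ⬝ᵥ u = 1 := by
      rw [dotProduct_self_eq_norm_sq]
      have : ‖hE.eigenvectorBasis l‖ = 1 := hE.eigenvectorBasis.orthonormal.1 l
      rw [hu]
      simp [this]
    have hEu : u ⬝ᵥ (E *ᵥ u) = hE.eigenvalues l := by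
      rw [hE.mulVec_eigenvectorBasis l, dotProduct_smul, huu, smul_eq_mul, mul_one]
    have hform : ∀ M : Matrix ι ι ℝ, u ⬝ᵥ ((R * M * R) *ᵥ u) = (R *ᵥ u) ⬝ᵥ (M *ᵥ (R *ᵥ u)) := by
      intro M
      rw [← mulVec_mulVec, ← mulVec_mulVec, dotProduct_mulVec u, ← mulVec_transpose, hR]
    constructor
    · have hne : R *ᵥ u ≠ 0 := by
        intro h
        have h2 : Q *ᵥ (R *ᵥ u) = u := by rw [mulVec_mulVec, hQR, one_mulVec]
        rw [h, mulVec_zero] at h2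
        rw [← h2] at huu
        simp at huu
      have h2 := hAD.dotProduct_mulVec_pos hne
      rw [star_trivial, ← hform, ← hconj, add_mulVec, one_mulVec, dotProduct_add, huu, hEu] at h2
      linarith
    · have h2 : |u ⬝ᵥ (E *ᵥ u)| ≤ opNorm E * (u ⬝ᵥ u) := abs_dotProduct_mulVec_le E u
      rw [hEu, huu, mul_one] at h2
      refine h2.trans ?_
      rw [← hRR]
      exact opNorm_conj_le hR D
  have hsum : Real.log A.det - Real.log (A + D).det + (A⁻¹ * D).trace
      = ∑ l, (hE.eigenvalues l - Real.log (1 + hE.eigenvalues l)) := by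
    have htr : (A⁻¹ * D).trace = ∑ l, hE.eigenvalues l := by
      have h2 := hE.trace_eq_sum_eigenvalues
      simp only [RCLike.ofReal_real_eq_id, id] at h2
      rw [← h2, hEdef, trace_mul_cycle, hRR]
    have hdet : A.det * (1 + E).det = (A + D).det := by
      rw [hconj, det_mul, det_mul]
      have h2 : A.det * (R.det * R.det) = 1 := by
        have := congrArg det hRAR
        rw [det_mul, det_mul, det_one] at this
        linarith
      calc _ = (A.det * (R.det * R.det)) * (A + D).det := by ring
        _ = _ := by rw [h2, one_mul]
    have hprod : (1 + E).det ≠ 0 := by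
      intro h
      rw [h, mul_zero] at hdet
      exact hAD.det_pos.ne hdet
    rw [← hdet, Real.log_mul hA.det_pos.ne' hprod, det_one_add_eq_prod hE,
      Real.log_prod fun l _ => by linarith [(hev l).1], Finset.sum_sub_distrib, htr]
    ring
  have hfrob : frobSq D ≤ opNorm A ^ 2 * frobSq E := by
    have h2 : D = Q * E * Q := by
      calc D = (Q * R) * D * (R * Q) := by rw [hQR, hRQ, one_mul, mul_one]
        _ = _ := by rw [hEdef]; simp only [Matrix.mul_assoc]
    rw [h2, ← hQQ, ← h2]
    conv_lhs => rw [h2]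
    exact frobSq_conj_le hQ E
  have hmain : θ * frobSq E / 4 ≤ ∑ l, (hE.eigenvalues l - Real.log (1 + hE.eigenvalues l)) := by
    rw [frobSq_eq_sum_eigenvalues_sq hE, Finset.mul_sum, Finset.sum_div]
    refine Finset.sum_le_sum fun l _ => sub_log_one_add_ge (hev l).1 h1 (le_trans ?_ hθ)
    gcongr
    exact (hev l).2
  rw [hsum]
  calc θ * frobSq D ≤ θ * (opNorm A ^ 2 * frobSq E) := by gcongr
    _ = 4 * opNorm A ^ 2 * (θ * frobSq E / 4) := by ring
    _ ≤ _ := by gcongr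

end LogDet

/-! ### Kronecker sums -/

section Kronecker

variable {L : ℕ} {d : Fin L → ℕ}

open Matrix

/-- `I ⊗ ⋯ ⊗ I ⊗ A ⊗ I ⊗ ⋯ ⊗ I` with `A` in position `k`. -/
def modeEmbed (k : Fin L) (A : Matrix (Fin (d k)) (Fin (d k)) ℝ) : Matrix (Idx d) (Idx d) ℝ :=
  kronProd (Function.update (fun _ => 1) k A)

theorem kronSum_eq_sum (B : (k : Fin L) → Matrix (Fin (d k)) (Fin (d k)) ℝ) :
    kronSum B = ∑ k, modeEmbed k (B k) := rfl

theorem modeEmbed_apply (k : Fin L) (A : Matrix (Fin (d k)) (Fin (d k)) ℝ) (i j : Idx d) :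
    modeEmbed k A i j = if ∀ l, l ≠ k → i l = j l then A (i k) (j k) else 0 := by
  simp only [modeEmbed, kronProd, of_apply]
  rw [← Finset.mul_prod_erase _ _ (Finset.mem_univ k), Function.update_self]
  have h : ∀ l ∈ Finset.univ.erase k,
      Function.update (fun l => (1 : Matrix (Fin (d l)) (Fin (d l)) ℝ)) k A l (i l) (j l)
        = if i l = j l then 1 else 0 := by
    intro l hl
    rw [Function.update_of_ne (Finset.ne_of_mem_erase hl), one_apply]
  rw [Finset.prod_congr rfl h, Finset.prod_ite_zero]
  simp

/-- Joining the coordinate in position `k` with the other coordinates. -/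
def joinAt (k : Fin L) (a : Fin (d k)) (c : (l : {l : Fin L // l ≠ k}) → Fin (d l)) : Idx d :=
  (Equiv.piSplitAt k fun l => Fin (d l)).symm (a, c)

theorem joinAt_self (k : Fin L) (a : Fin (d k)) (c : (l : {l : Fin L // l ≠ k}) → Fin (d l)) :
    joinAt k a c k = a := by
  simp [joinAt, Equiv.piSplitAt]

theorem joinAt_of_ne {k l : Fin L} (h : l ≠ k) (a : Fin (d k))
    (c : (l : {l : Fin L // l ≠ k}) → Fin (d l)) : joinAt k a c l = c ⟨l, h⟩ := by
  simp [joinAt, Equiv.piSplitAt, h]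

theorem sum_idx_eq (k : Fin L) (f : Idx d → ℝ) : ∑ i, f i = ∑ c, ∑ a, f (joinAt k a c) := by
  rw [← (Equiv.piSplitAt k fun l => Fin (d l)).symm.sum_comp, Fintype.sum_prod_type,
    Finset.sum_comm]
  rfl

theorem exists_eq_joinAt (k : Fin L) (i : Idx d) : ∃ a c, i = joinAt k a c :=
  ⟨_, _, ((Equiv.piSplitAt k fun l => Fin (d l)).symm_apply_apply i).symm⟩

/-- Separating the coordinate `k` from the others makes the embedding block diagonal, with one copy
of `A` for each of the `m_k` values of the remaining coordinates. The algebraic and norm identities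
for embeddings come from this. -/
theorem modeEmbed_joinAt (k : Fin L) (A : Matrix (Fin (d k)) (Fin (d k)) ℝ) (a b : Fin (d k))
    (c c' : (l : {l : Fin L // l ≠ k}) → Fin (d l)) :
    modeEmbed k A (joinAt k a c) (joinAt k b c') = if c = c' then A a b else 0 := by
  rw [modeEmbed_apply, joinAt_self, joinAt_self]
  refine if_congr ⟨fun h => ?_, fun h l hl => ?_⟩ rfl rfl
  · ext ⟨l, hl⟩
    have := h l hl
    rw [joinAt_of_ne hl, joinAt_of_ne hl] at this
    rw [this]
  · rw [joinAt_of_ne hl, joinAt_of_ne hl, h]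

theorem modeEmbed_add (k : Fin L) (A B : Matrix (Fin (d k)) (Fin (d k)) ℝ) :
    modeEmbed k (A + B) = modeEmbed k A + modeEmbed k B := by
  ext i j
  simp only [modeEmbed_apply, Matrix.add_apply]
  split_ifs <;> simp

theorem modeEmbed_smul (k : Fin L) (r : ℝ) (A : Matrix (Fin (d k)) (Fin (d k)) ℝ) :
    modeEmbed k (r • A) = r • modeEmbed k A := by
  ext i j
  simp only [modeEmbed_apply, Matrix.smul_apply]
  split_ifs <;> simp

theorem modeEmbed_one (k : Fin L) :
    modeEmbed k (1 : Matrix (Fin (d k)) (Fin (d k)) ℝ) = 1 := by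
  ext i j
  obtain ⟨a, c, rfl⟩ := exists_eq_joinAt k i
  obtain ⟨b, c', rfl⟩ := exists_eq_joinAt k j
  rw [modeEmbed_joinAt, one_apply, one_apply]
  have : joinAt k a c = joinAt k b c' ↔ a = b ∧ c = c' := by
    unfold joinAt
    rw [(Equiv.piSplitAt k fun l => Fin (d l)).symm.injective.eq_iff, Prod.mk.injEq]
  simp only [this]
  split_ifs <;> simp_all

theorem modeEmbed_transpose (k : Fin L) (A : Matrix (Fin (d k)) (Fin (d k)) ℝ) :
    (modeEmbed k A)ᵀ = modeEmbed k Aᵀ := by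
  ext i j
  simp only [transpose_apply, modeEmbed_apply]
  exact if_congr ⟨fun h l hl => (h l hl).symm, fun h l hl => (h l hl).symm⟩ rfl rfl

theorem modeEmbed_mul (k : Fin L) (A B : Matrix (Fin (d k)) (Fin (d k)) ℝ) :
    modeEmbed k A * modeEmbed k B = modeEmbed k (A * B) := by
  ext i j
  obtain ⟨a, c, rfl⟩ := exists_eq_joinAt k i
  obtain ⟨b, c', rfl⟩ := exists_eq_joinAt k j
  rw [mul_apply, sum_idx_eq k]
  simp only [modeEmbed_joinAt, mul_apply, ite_mul, zero_mul, mul_ite, mul_zero]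
  split_ifs with h
  · subst h
    rw [Finset.sum_eq_single c (fun c₂ _ h => by simp [h]) (by simp)]
    simp
  · refine Finset.sum_eq_zero fun c₂ _ => Finset.sum_eq_zero fun a' _ => ?_
    split_ifs with h1 h2
    · exact absurd (h2.trans h1) h
    · rfl
    · rfl

theorem card_rest (k : Fin L) :
    Fintype.card ((l : {l : Fin L // l ≠ k}) → Fin (d l)) = mdim d k := by
  rw [Fintype.card_pi, mdim]
  simp only [Fintype.card_fin]
  exact (Finset.prod_subtype _ (by simp) d).symm

theorem card_idx : Fintype.card (Idx d) = pdim d := by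
  rw [Fintype.card_pi, pdim]; simp

theorem trace_modeEmbed (k : Fin L) (A : Matrix (Fin (d k)) (Fin (d k)) ℝ) :
    (modeEmbed k A).trace = mdim d k * A.trace := by
  rw [Matrix.trace, sum_idx_eq k]
  simp only [diag_apply, modeEmbed_joinAt, if_true]
  rw [Finset.sum_const, Finset.card_univ, card_rest, nsmul_eq_mul]
  rfl

theorem trace_modeEmbed_mul (k : Fin L) (A B : Matrix (Fin (d k)) (Fin (d k)) ℝ) :
    ((modeEmbed k A)ᵀ * modeEmbed k B).trace = mdim d k * (Aᵀ * B).trace := by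
  rw [modeEmbed_transpose, modeEmbed_mul, trace_modeEmbed]

/-- An entry nonzero in both factors has indices that differ at most in position `k` and at most in
position `l`, so it is diagonal. Summing over the coordinate `k` then produces the factor `tr A`. -/
theorem trace_modeEmbed_mul_of_ne {k l : Fin L} (h : k ≠ l)
    {A : Matrix (Fin (d k)) (Fin (d k)) ℝ} (B : Matrix (Fin (d l)) (Fin (d l)) ℝ)
    (hA : A.trace = 0) : ((modeEmbed k A)ᵀ * modeEmbed l B).trace = 0 := by
  have h1 : ∀ i j : Idx d, modeEmbed k A j i * modeEmbed l B j i
      = if i = j then A (i k) (i k) * B (i l) (i l) else 0 := by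
    intro i j
    split_ifs with hij
    · subst hij; simp [modeEmbed_apply]
    · rw [modeEmbed_apply, modeEmbed_apply]
      split_ifs with h1 h2
      · refine absurd (funext fun m => ?_) hij
        by_cases hm : m = k
        · exact (h2 m (hm ▸ h)).symm
        · exact (h1 m hm).symm
      all_goals simp
  simp only [Matrix.trace, diag_apply, mul_apply, transpose_apply, h1, Finset.sum_ite_eq,
    Finset.mem_univ, if_true]
  rw [sum_idx_eq k]
  refine Finset.sum_eq_zero fun c _ => ?_
  simp only [joinAt_self, joinAt_of_ne h.symm]
  rw [← Finset.sum_mul]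
  have : ∑ a, A a a = 0 := hA
  rw [this, zero_mul]

theorem frobSq_modeEmbed (k : Fin L) (A : Matrix (Fin (d k)) (Fin (d k)) ℝ) :
    frobSq (modeEmbed k A) = mdim d k * frobSq A := by
  rw [frobSq_eq_trace, frobSq_eq_trace, trace_modeEmbed_mul]

theorem OpBound.modeEmbed {k : Fin L} {A : Matrix (Fin (d k)) (Fin (d k)) ℝ} {b : ℝ}
    (h : OpBound A b) : OpBound (modeEmbed k A) b := by
  intro x
  have h1 : ∀ a c, (TeraLasso.modeEmbed k A *ᵥ x) (joinAt k a c)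
      = (A *ᵥ fun a' => x (joinAt k a' c)) a := by
    intro a c
    simp only [mulVec, dotProduct]
    rw [sum_idx_eq k, Finset.sum_eq_single c]
    · simp [modeEmbed_joinAt]
    · intro c' _ hc
      simp [modeEmbed_joinAt, hc.symm]
    · simp
  rw [dotProduct, dotProduct, sum_idx_eq k, sum_idx_eq k, Finset.mul_sum]
  refine Finset.sum_le_sum fun c _ => ?_
  simp only [h1]
  exact h _

theorem opNorm_modeEmbed_le (k : Fin L) (A : Matrix (Fin (d k)) (Fin (d k)) ℝ) :
    opNorm (modeEmbed k A) ≤ frobNorm A :=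
  (opBound_frobNorm A).modeEmbed.opNorm_le (frobNorm_nonneg A)

theorem mdim_pos (hd : ∀ k, 1 ≤ d k) (k : Fin L) : 0 < mdim d k :=
  Finset.prod_pos fun l _ => hd l

theorem pdim_pos (hd : ∀ k, 1 ≤ d k) : 0 < pdim d := Finset.prod_pos fun l _ => hd l

theorem mul_mdim (k : Fin L) : d k * mdim d k = pdim d :=
  Finset.mul_prod_erase _ _ (Finset.mem_univ k)

theorem mul_trace_gram (hd : ∀ k, 1 ≤ d k) (x : Idx d → ℝ) (k : Fin L)
    (B : Matrix (Fin (d k)) (Fin (d k)) ℝ) :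
    (mdim d k : ℝ) * ((gram x k)ᵀ * B).trace = x ⬝ᵥ (modeEmbed k B *ᵥ x) := by
  have hm : (mdim d k : ℝ) ≠ 0 := by exact_mod_cast (mdim_pos hd k).ne'
  have hu : ∀ a c, unfolding x k a c = x (joinAt k a c) := fun _ _ => rfl
  rw [gram, transpose_smul, smul_mul, trace_smul, smul_eq_mul, mul_inv_cancel_left₀ hm]
  simp only [transpose_mul, transpose_transpose, Matrix.trace, diag_apply, mul_apply,
    transpose_apply, hu, dotProduct, mulVec]
  rw [sum_idx_eq k]
  have h2 : ∀ c a, ∑ j, modeEmbed k B (joinAt k a c) j * x j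
      = ∑ b, B a b * x (joinAt k b c) := by
    intro c a
    rw [sum_idx_eq k, Finset.sum_eq_single c]
    · simp [modeEmbed_joinAt]
    · intro c' _ hc
      simp [modeEmbed_joinAt, hc.symm]
    · simp
  simp_rw [h2, Finset.sum_mul, Finset.mul_sum]
  rw [Finset.sum_comm' (t' := Finset.univ) (s' := fun _ => Finset.univ) (by simp)]
  calc _ = ∑ a, ∑ c, ∑ b, x (joinAt k a c) * (B a b * x (joinAt k b c)) := by
        refine Finset.sum_congr rfl fun a _ => ?_
        rw [Finset.sum_comm]
        refine Finset.sum_congr rfl fun c _ => Finset.sum_congr rfl fun b _ => by ring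
    _ = _ := Finset.sum_comm

/-- The smooth part depends only on the Kronecker sum, and the penalty only on off-diagonal entries.
Thus trading multiples of the identity between components leaves the objective unchanged. -/
theorem objective_eq (hd : ∀ k, 1 ≤ d k) (x : Idx d → ℝ) (ρ : Fin L → ℝ)
    (B : (k : Fin L) → Matrix (Fin (d k)) (Fin (d k)) ℝ) :
    objective x ρ B = -Real.log (kronSum B).det + x ⬝ᵥ (kronSum B *ᵥ x)
      + ∑ k, (mdim d k : ℝ) * (ρ k * offOne (B k)) := by
  rw [objective, add_assoc]
  congr 1
  simp only [mul_add]
  rw [Finset.sum_add_distrib]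
  congr 1
  rw [kronSum_eq_sum, sum_mulVec, dotProduct_sum]
  exact Finset.sum_congr rfl fun k _ => mul_trace_gram hd x k (B k)

/-! ### Orthogonal decompositions of Kronecker sums -/

theorem kronSum_add (A B : (k : Fin L) → Matrix (Fin (d k)) (Fin (d k)) ℝ) :
    kronSum (fun k => A k + B k) = kronSum A + kronSum B := by
  simp only [kronSum_eq_sum, modeEmbed_add, Finset.sum_add_distrib]

theorem kronSum_sub (A B : (k : Fin L) → Matrix (Fin (d k)) (Fin (d k)) ℝ) :
    kronSum (fun k => A k - B k) = kronSum A - kronSum B := by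
  rw [eq_sub_iff_add_eq, ← kronSum_add]
  simp

theorem kronSum_smul_one (c : Fin L → ℝ) :
    kronSum (d := d) (fun k => c k • 1) = (∑ k, c k) • 1 := by
  simp only [kronSum_eq_sum, modeEmbed_smul, modeEmbed_one, Finset.sum_smul]

theorem trace_kronSum_mul {A : (k : Fin L) → Matrix (Fin (d k)) (Fin (d k)) ℝ}
    (B : (k : Fin L) → Matrix (Fin (d k)) (Fin (d k)) ℝ) (hA : ∀ k, (A k).trace = 0) :
    ((kronSum A)ᵀ * kronSum B).trace = ∑ k, mdim d k * ((A k)ᵀ * B k).trace := by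
  rw [kronSum_eq_sum, kronSum_eq_sum, transpose_sum, Finset.sum_mul, trace_sum]
  refine Finset.sum_congr rfl fun k _ => ?_
  rw [Finset.mul_sum, trace_sum, Finset.sum_eq_single k, trace_modeEmbed_mul]
  · intro l _ hl
    exact trace_modeEmbed_mul_of_ne hl.symm _ (hA k)
  · simp

theorem frobSq_kronSum_of_trace_eq_zero {A : (k : Fin L) → Matrix (Fin (d k)) (Fin (d k)) ℝ}
    (hA : ∀ k, (A k).trace = 0) : frobSq (kronSum A) = ∑ k, mdim d k * frobSq (A k) := by
  simp only [frobSq_eq_trace]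
  exact trace_kronSum_mul A hA

theorem frobSq_add {ι : Type*} [Fintype ι] {A B : Matrix ι ι ℝ} (h : (Aᵀ * B).trace = 0) :
    frobSq (A + B) = frobSq A + frobSq B := by
  have h2 : (Bᵀ * A).trace = 0 := by
    rw [← h, ← trace_transpose, transpose_mul, transpose_transpose]
  simp only [frobSq_eq_trace, transpose_add, mul_add, add_mul, trace_add, h, h2]
  ring

/-- Off-diagonal part of a matrix. -/
def offPart {n : ℕ} (A : Matrix (Fin n) (Fin n) ℝ) : Matrix (Fin n) (Fin n) ℝ :=
  Matrix.of fun i j => if i = j then 0 else A i j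

/-- Diagonal part of a matrix. -/
def diagPart {n : ℕ} (A : Matrix (Fin n) (Fin n) ℝ) : Matrix (Fin n) (Fin n) ℝ :=
  diagonal A.diag

/-- Traceless part of a matrix. -/
def traceless {n : ℕ} (A : Matrix (Fin n) (Fin n) ℝ) : Matrix (Fin n) (Fin n) ℝ :=
  A - (A.trace / n) • 1

theorem offPart_add_diagPart {n : ℕ} (A : Matrix (Fin n) (Fin n) ℝ) :
    offPart A + diagPart A = A := by
  ext i j
  by_cases h : i = j
  · subst h; simp [offPart, diagPart]
  · simp [offPart, diagPart, h]

theorem trace_offPart {n : ℕ} (A : Matrix (Fin n) (Fin n) ℝ) : (offPart A).trace = 0 := by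
  simp [offPart, Matrix.trace]

theorem trace_traceless {n : ℕ} (hn : 1 ≤ n) (A : Matrix (Fin n) (Fin n) ℝ) :
    (traceless A).trace = 0 := by
  have : (n : ℝ) ≠ 0 := by positivity
  rw [traceless, trace_sub, trace_smul, trace_one, Fintype.card_fin, smul_eq_mul]
  field_simp
  ring

/-- Off-diagonal parts are traceless, hence orthogonal across modes, and they are orthogonal to the
diagonal parts. The diagonals are left together because they share the identity direction. -/
theorem frobSq_kronSum_eq_off_add_diag (D : (k : Fin L) → Matrix (Fin (d k)) (Fin (d k)) ℝ) :
    frobSq (kronSum D) = ∑ k, mdim d k * frobSq (offPart (D k))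
      + frobSq (kronSum fun k => diagPart (D k)) := by
  have h : kronSum D = kronSum (fun k => offPart (D k)) + kronSum fun k => diagPart (D k) := by
    rw [← kronSum_add]; simp only [offPart_add_diagPart]
  rw [h, frobSq_add, frobSq_kronSum_of_trace_eq_zero fun k => trace_offPart (D k)]
  rw [trace_kronSum_mul _ fun k => trace_offPart (D k)]
  refine Finset.sum_eq_zero fun k _ => ?_
  have : ((offPart (D k))ᵀ * diagPart (D k)).trace = 0 := by
    simp [Matrix.trace, diagPart, offPart]
  rw [this, mul_zero]

/-- Mean of the diagonal of a Kronecker sum. -/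
def diagMean (D : (k : Fin L) → Matrix (Fin (d k)) (Fin (d k)) ℝ) : ℝ :=
  ∑ k, (D k).trace / d k

theorem kronSum_eq_traceless_add (D : (k : Fin L) → Matrix (Fin (d k)) (Fin (d k)) ℝ) :
    kronSum D = kronSum (fun k => traceless (D k)) + diagMean D • 1 := by
  rw [diagMean, ← kronSum_smul_one, ← kronSum_add]
  simp [traceless]

/-- Moving all multiples of the identity into one term removes the ambiguity of the components and
makes all remaining terms orthogonal. -/
theorem frobSq_kronSum_eq_traceless_add (hd : ∀ k, 1 ≤ d k)
    (D : (k : Fin L) → Matrix (Fin (d k)) (Fin (d k)) ℝ) :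
    frobSq (kronSum D) = ∑ k, mdim d k * frobSq (traceless (D k)) + pdim d * diagMean D ^ 2 := by
  have h0 : ∀ k, (traceless (D k)).trace = 0 := fun k => trace_traceless (hd k) (D k)
  rw [kronSum_eq_traceless_add, frobSq_add, frobSq_kronSum_of_trace_eq_zero h0, frobSq_smul]
  · have : frobSq (1 : Matrix (Idx d) (Idx d) ℝ) = pdim d := by
      rw [frobSq_eq_trace, transpose_one, one_mul, trace_one, card_idx]
    rw [this]; ring
  · rw [Matrix.mul_smul, mul_one, trace_smul, trace_transpose, kronSum_eq_sum, trace_sum]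
    simp only [trace_modeEmbed, h0]
    simp

theorem mmin_le (k : Fin L) : mmin d ≤ mdim d k := ciInf_le (OrderBot.bddBelow _) k

theorem le_dmax (k : Fin L) : d k ≤ dmax d := le_ciSup (Set.finite_range d).bddAbove k

theorem mdim_le_pdim (hd : ∀ k, 1 ≤ d k) (k : Fin L) : mdim d k ≤ pdim d := by
  rw [← mul_mdim k]
  exact Nat.le_mul_of_pos_left _ (hd k)

theorem exists_mmin_eq (hL : 1 ≤ L) : ∃ k, mdim d k = mmin d := by
  have : Nonempty (Fin L) := ⟨⟨0, hL⟩⟩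
  exact exists_eq_ciInf_of_finite

theorem mmin_pos (hL : 1 ≤ L) (hd : ∀ k, 1 ≤ d k) : 0 < mmin d := by
  obtain ⟨k, hk⟩ := exists_mmin_eq (d := d) hL
  rw [← hk]; exact mdim_pos hd k

/-- There are `L` traceless pieces and one multiple of the identity. A piece has operator norm at
most the Frobenius norm of its small factor, while its embedding repeats that factor `m_k ≥ m_min`
times; the identity has weight `p ≥ m_min`. Cauchy–Schwarz over the pieces gives `L + 1`. -/
theorem mmin_mul_opNorm_sq_le (hL : 1 ≤ L) (hd : ∀ k, 1 ≤ d k)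
    (D : (k : Fin L) → Matrix (Fin (d k)) (Fin (d k)) ℝ) :
    mmin d * opNorm (kronSum D) ^ 2 ≤ (L + 1) * frobSq (kronSum D) := by
  set f : Option (Fin L) → ℝ :=
    fun o => o.elim |diagMean D| fun k => frobNorm (traceless (D k)) with hf
  have hsum : opNorm (kronSum D) ≤ ∑ o, f o := by
    rw [kronSum_eq_traceless_add, Fintype.sum_option, add_comm]
    refine (opNorm_add_le _ _).trans (add_le_add (opNorm_smul_one_le _) ?_)
    rw [kronSum_eq_sum]
    refine (opNorm_sum_le _ _).trans (Finset.sum_le_sum fun k _ => opNorm_modeEmbed_le k _)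
  have hcs : (∑ o, f o) ^ 2 ≤ (L + 1) * ∑ o, f o ^ 2 := by
    have := sq_sum_le_card_mul_sum_sq (s := (Finset.univ : Finset (Option (Fin L)))) (f := f)
    simpa using this
  have hle : mmin d * ∑ o, f o ^ 2 ≤ frobSq (kronSum D) := by
    rw [frobSq_kronSum_eq_traceless_add hd, Fintype.sum_option, mul_add, add_comm, Finset.mul_sum]
    simp only [hf, Option.elim, sq_abs, frobNorm_sq]
    refine add_le_add (Finset.sum_le_sum fun k _ => ?_) ?_
    · have : (mmin d : ℝ) ≤ mdim d k := by exact_mod_cast mmin_le k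
      exact mul_le_mul_of_nonneg_right this (frobSq_nonneg _)
    · have : (mmin d : ℝ) ≤ pdim d := by
        exact_mod_cast (mmin_le ⟨0, hL⟩).trans (mdim_le_pdim hd _)
      gcongr
  calc mmin d * opNorm (kronSum D) ^ 2 ≤ mmin d * ((L + 1) * ∑ o, f o ^ 2) := by
        gcongr
        exact (pow_le_pow_left₀ (opNorm_nonneg _) hsum 2).trans hcs
    _ = (L + 1) * (mmin d * ∑ o, f o ^ 2) := by ring
    _ ≤ _ := by gcongr

end Kronecker

/-! ### Deterministic analysis of the estimator -/

section Deterministic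

variable {L : ℕ} {d : Fin L → ℕ}

open Matrix

/-- Deviation of the quadratic form `x ⬝ M x` from its mean `tr (Σ₀ M)`. -/
def deviation {ι : Type*} [Fintype ι] (x : ι → ℝ) (Sig0 M : Matrix ι ι ℝ) : ℝ :=
  x ⬝ᵥ (M *ᵥ x) - (Sig0 * M).trace

theorem deviation_add {ι : Type*} [Fintype ι] (x : ι → ℝ) (Sig0 M N : Matrix ι ι ℝ) :
    deviation x Sig0 (M + N) = deviation x Sig0 M + deviation x Sig0 N := by
  simp only [deviation, add_mulVec, dotProduct_add, mul_add, trace_add]; ring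

theorem deviation_smul {ι : Type*} [Fintype ι] (x : ι → ℝ) (Sig0 : Matrix ι ι ℝ) (c : ℝ)
    (M : Matrix ι ι ℝ) : deviation x Sig0 (c • M) = c * deviation x Sig0 M := by
  simp only [deviation, smul_mulVec, dotProduct_smul, Matrix.mul_smul, trace_smul, smul_eq_mul]
  ring

theorem deviation_sum {ι κ : Type*} [Fintype ι] (x : ι → ℝ) (Sig0 : Matrix ι ι ℝ) (s : Finset κ)
    (M : κ → Matrix ι ι ℝ) :
    deviation x Sig0 (∑ k ∈ s, M k) = ∑ k ∈ s, deviation x Sig0 (M k) := by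
  simp only [deviation, sum_mulVec, dotProduct_sum, Finset.mul_sum, trace_sum,
    Finset.sum_sub_distrib]

theorem offOne_eq_sum_offPart {n : ℕ} (A : Matrix (Fin n) (Fin n) ℝ) :
    offOne A = ∑ a, ∑ b, |offPart A a b| := by
  simp only [offOne, offPart, of_apply]
  refine Finset.sum_congr rfl fun a _ => Finset.sum_congr rfl fun b _ => ?_
  split_ifs <;> simp

theorem modeEmbed_sum {κ : Type*} (k : Fin L) (s : Finset κ)
    (A : κ → Matrix (Fin (d k)) (Fin (d k)) ℝ) :
    modeEmbed k (∑ i ∈ s, A i) = ∑ i ∈ s, modeEmbed k (A i) := by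
  classical
  induction s using Finset.induction_on with
  | empty =>
    simp only [Finset.sum_empty]
    ext i j; simp [modeEmbed_apply]
  | insert a s ha ih => rw [Finset.sum_insert ha, Finset.sum_insert ha, modeEmbed_add, ih]

/-- Duality of the entrywise maximum and the `ℓ₁` norm, expanded in matrix units. -/
theorem abs_deviation_offPart_le {x : Idx d → ℝ} {Sig0 : Matrix (Idx d) (Idx d) ℝ} {k : Fin L}
    {c : ℝ} (h : ∀ a b : Fin (d k), a ≠ b →
      |deviation x Sig0 (modeEmbed k (Matrix.single a b 1))| ≤ c)
    (A : Matrix (Fin (d k)) (Fin (d k)) ℝ) :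
    |deviation x Sig0 (modeEmbed k (offPart A))| ≤ c * offOne A := by
  have h1 : offPart A = ∑ a, ∑ b, offPart A a b • Matrix.single a b (1 : ℝ) := by
    conv_lhs => rw [matrix_eq_sum_single (offPart A)]
    simp
  conv_lhs => rw [h1]
  rw [offOne_eq_sum_offPart, modeEmbed_sum, deviation_sum, Finset.mul_sum]
  refine (Finset.abs_sum_le_sum_abs _ _).trans (Finset.sum_le_sum fun a _ => ?_)
  rw [modeEmbed_sum, deviation_sum, Finset.mul_sum]
  refine (Finset.abs_sum_le_sum_abs _ _).trans (Finset.sum_le_sum fun b _ => ?_)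
  rw [modeEmbed_smul, deviation_smul, abs_mul]
  by_cases hab : a = b
  · subst hab; simp [offPart]
  · rw [mul_comm]
    gcongr
    exact h a b hab

/-- The off-diagonal `ℓ₁` norm decreases only along the support. -/
theorem offOne_add_ge {n : ℕ} (P D : Matrix (Fin n) (Fin n) ℝ) :
    offOne P + offOne D - 2 * (√(offSupp P) * frobNorm (offPart D)) ≤ offOne (P + D) := by
  classical
  set T : Finset (Fin n × Fin n) :=
    Finset.univ.filter fun ij => ij.1 ≠ ij.2 ∧ P ij.1 ij.2 ≠ 0 with hT
  have hcard : offSupp P = T.card := by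
    rw [offSupp, ← Set.ncard_coe_finset]
    congr 1
    ext; simp [hT]
  have hcs : ∑ ij ∈ T, |offPart D ij.1 ij.2| ≤ √(offSupp P) * frobNorm (offPart D) := by
    rw [hcard, frobNorm_eq_sqrt, ← Real.sqrt_mul (by positivity)]
    refine Real.le_sqrt_of_sq_le ?_
    refine (sq_sum_le_card_mul_sum_sq (s := T)).trans ?_
    gcongr
    simp only [sq_abs, frobSq]
    rw [← Fintype.sum_prod_type' (f := fun i j => offPart D i j ^ 2)]
    exact Finset.sum_le_sum_of_subset_of_nonneg (Finset.subset_univ _) fun _ _ _ => sq_nonneg _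
  have hsum : offOne P + offOne D - 2 * ∑ ij ∈ T, |offPart D ij.1 ij.2| ≤ offOne (P + D) := by
    simp only [offOne]
    rw [hT, Finset.sum_filter, Fintype.sum_prod_type]
    simp only [Finset.mul_sum, ← Finset.sum_add_distrib, ← Finset.sum_sub_distrib]
    refine Finset.sum_le_sum fun i _ => Finset.sum_le_sum fun j _ => ?_
    by_cases hij : i = j
    · simp [hij]
    · by_cases hP : P i j = 0
      · simp [hij, hP]
      · simp only [hij, hP, if_false, ne_eq, not_false_eq_true, and_self, if_true, offPart,
          of_apply, Matrix.add_apply]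
        have := abs_sub_abs_le_abs_sub (P i j) (-(D i j))
        rw [abs_neg, sub_neg_eq_add] at this
        linarith
  linarith

/-- The linear part of the objective is dominated by the Frobenius norm. -/
theorem linear_part_ge {x : Idx d → ℝ} {Sig0 : Matrix (Idx d) (Idx d) ℝ} {ρ : Fin L → ℝ}
    {W T : ℝ} (hρ : ∀ k, 0 ≤ ρ k) (hW : 0 ≤ W) (hρW : ∀ k, mdim d k * ρ k ^ 2 ≤ W ^ 2)
    (hoff : ∀ k, ∀ a b : Fin (d k), a ≠ b →
      |deviation x Sig0 (modeEmbed k (Matrix.single a b 1))| ≤ mdim d k * ρ k)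
    (hdiag : ∀ D : (k : Fin L) → Matrix (Fin (d k)) (Fin (d k)) ℝ,
      |deviation x Sig0 (kronSum fun k => diagPart (D k))|
        ≤ T * frobNorm (kronSum fun k => diagPart (D k))) (hT : 0 ≤ T)
    (Psi D : (k : Fin L) → Matrix (Fin (d k)) (Fin (d k)) ℝ) :
    -((2 * W * √(∑ k, (offSupp (Psi k) : ℝ)) + T) * frobNorm (kronSum D))
      ≤ deviation x Sig0 (kronSum D)
        + ∑ k, (mdim d k : ℝ) * (ρ k * (offOne (Psi k + D k) - offOne (Psi k))) := by
  have hfrob := frobSq_kronSum_eq_off_add_diag D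
  have hoffsq : ∑ k, (mdim d k : ℝ) * frobSq (offPart (D k)) ≤ frobSq (kronSum D) := by
    rw [hfrob]; linarith [frobSq_nonneg (kronSum fun k => diagPart (D k))]
  have hdiagle : frobNorm (kronSum fun k => diagPart (D k)) ≤ frobNorm (kronSum D) := by
    refine Real.sqrt_le_sqrt ?_
    change frobSq _ ≤ frobSq _
    rw [hfrob]
    have : 0 ≤ ∑ k, (mdim d k : ℝ) * frobSq (offPart (D k)) :=
      Finset.sum_nonneg fun k _ => mul_nonneg (by positivity) (frobSq_nonneg _)
    linarith
  have hsplit : deviation x Sig0 (kronSum D)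
      = ∑ k, deviation x Sig0 (modeEmbed k (offPart (D k)))
        + deviation x Sig0 (kronSum fun k => diagPart (D k)) := by
    rw [← deviation_sum, ← kronSum_eq_sum, ← deviation_add, ← kronSum_add]
    simp only [offPart_add_diagPart]
  have hd1 : -(T * frobNorm (kronSum D)) ≤ deviation x Sig0 (kronSum fun k => diagPart (D k)) := by
    have h1 := (abs_le.1 (hdiag D)).1
    have h2 : T * frobNorm (kronSum fun k => diagPart (D k)) ≤ T * frobNorm (kronSum D) := by
      gcongr
    linarith
  -- The deviation costs at most `m_k ρ_k` times the off-diagonal `ℓ₁` norm of `D k`, exactly what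
  -- the penalty gains. Only twice the contribution of the support of `Psi k` remains.
  have hk : ∀ k, -(2 * ((√(mdim d k) * ρ k * √(offSupp (Psi k))) *
        (√(mdim d k) * frobNorm (offPart (D k)))))
      ≤ deviation x Sig0 (modeEmbed k (offPart (D k)))
        + (mdim d k : ℝ) * (ρ k * (offOne (Psi k + D k) - offOne (Psi k))) := by
    intro k
    have h1 := (abs_le.1 (abs_deviation_offPart_le (hoff k) (D k))).1
    have h2 := offOne_add_ge (Psi k) (D k)
    have h3 : 0 ≤ (mdim d k : ℝ) * ρ k := mul_nonneg (by positivity) (hρ k)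
    have h4 := mul_le_mul_of_nonneg_left h2 h3
    have h5 : √(mdim d k : ℝ) * √(mdim d k : ℝ) = mdim d k := Real.mul_self_sqrt (by positivity)
    calc _ = -(2 * ((√(mdim d k) * √(mdim d k)) * ρ k *
          (√(offSupp (Psi k)) * frobNorm (offPart (D k))))) := by ring
      _ ≤ _ := by rw [h5]; linarith
  -- Splitting `m_k` as `√m_k · √m_k` gives one root to `ρ k`, where `W` bounds the product
  -- uniformly, and one to the Frobenius norm in the Kronecker sum.
  have hcs : ∑ k, (√(mdim d k) * ρ k * √(offSupp (Psi k))) *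
        (√(mdim d k) * frobNorm (offPart (D k)))
      ≤ W * √(∑ k, (offSupp (Psi k) : ℝ)) * frobNorm (kronSum D) := by
    refine (Real.sum_mul_le_sqrt_mul_sqrt _ _ _).trans ?_
    refine mul_le_mul ?_ ?_ (Real.sqrt_nonneg _) (by positivity)
    · rw [← Real.sqrt_sq hW, ← Real.sqrt_mul (by positivity), Finset.mul_sum]
      refine Real.sqrt_le_sqrt (Finset.sum_le_sum fun k _ => ?_)
      rw [mul_pow, mul_pow, Real.sq_sqrt (by positivity), Real.sq_sqrt (by positivity)]
      gcongr
      exact hρW k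
    · refine Real.sqrt_le_sqrt (le_trans (le_of_eq ?_) hoffsq)
      refine Finset.sum_congr rfl fun k _ => ?_
      rw [mul_pow, Real.sq_sqrt (by positivity), frobNorm_sq]
  have hsum := Finset.sum_le_sum fun k (_ : k ∈ Finset.univ) => hk k
  rw [Finset.sum_neg_distrib, ← Finset.mul_sum, Finset.sum_add_distrib] at hsum
  rw [hsplit]
  linarith

/-- Outside a Frobenius ball the objective exceeds its value at the truth. -/
theorem objective_lt_of_frobNorm_gt (hL : 1 ≤ L) (hd : ∀ k, 1 ≤ d k) {x : Idx d → ℝ}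
    {ρ : Fin L → ℝ} {Psi : (k : Fin L) → Matrix (Fin (d k)) (Fin (d k)) ℝ}
    (hPsi : (kronSum Psi).PosDef) {Λ r : ℝ} (hr : 0 < r)
    (hlin : ∀ D : (k : Fin L) → Matrix (Fin (d k)) (Fin (d k)) ℝ,
      -(Λ * frobNorm (kronSum D)) ≤ deviation x (kronSum Psi)⁻¹ (kronSum D)
        + ∑ k, (mdim d k : ℝ) * (ρ k * (offOne (Psi k + D k) - offOne (Psi k))))
    (hΛ : 4 * opNorm (kronSum Psi) ^ 2 * Λ < r)
    (hsmall : opNorm (kronSum Psi)⁻¹ * (√((L + 1) / mmin d) * r) ≤ 1 / 2)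
    {B : (k : Fin L) → Matrix (Fin (d k)) (Fin (d k)) ℝ} (hB : (kronSum B).PosDef)
    (hgt : r < frobNorm (kronSum B - kronSum Psi)) : objective x ρ Psi < objective x ρ B := by
  set D : (k : Fin L) → Matrix (Fin (d k)) (Fin (d k)) ℝ := fun k => B k - Psi k with hD
  have hDB : kronSum B = kronSum Psi + kronSum D := by rw [hD, kronSum_sub]; abel
  have hDk : ∀ k, B k = Psi k + D k := fun k => by simp [hD]
  rw [← kronSum_sub] at hgt
  have hop : opNorm (kronSum D) ≤ √((L + 1) / mmin d) * frobNorm (kronSum D) := by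
    have hm : (0 : ℝ) < mmin d := by exact_mod_cast mmin_pos hL hd
    rw [frobNorm_eq_sqrt, ← Real.sqrt_mul (by positivity)]
    refine Real.le_sqrt_of_sq_le ?_
    rw [div_mul_eq_mul_div, le_div_iff₀ hm, mul_comm]
    exact mmin_mul_opNorm_sq_le hL hd D
  set f := frobNorm (kronSum D) with hf
  have hf0 : 0 < f := hr.trans hgt
  -- The choice `θ = r / f` yields the lower bound `r f`, linear in the distance `f`, at every point
  -- outside the ball. This replaces the usual convexity argument along the segment to the sphere;
  -- the factor `f` cancels in `θ` times the operator norm bound.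
  have hlog := log_det_lower_bound hPsi (D := kronSum D) (by rwa [← hDB]) (θ := r / f)
    (by positivity) (by rw [div_le_one hf0]; exact hgt.le) (by
      calc r / f * (opNorm (kronSum Psi)⁻¹ * opNorm (kronSum D))
          ≤ r / f * (opNorm (kronSum Psi)⁻¹ * (√((L + 1) / mmin d) * f)) := by
            have := opNorm_nonneg (kronSum Psi)⁻¹
            gcongr
        _ = opNorm (kronSum Psi)⁻¹ * (√((L + 1) / mmin d) * r) := by field_simp
        _ ≤ 1 := by linarith)
  have hθ : r / f * frobSq (kronSum D) = r * f := by
    rw [← frobNorm_sq, ← hf]; field_simp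
  rw [hθ] at hlog
  have hl := hlin D
  rw [← hf] at hl
  have hdiff : objective x ρ B - objective x ρ Psi =
      (Real.log (kronSum Psi).det - Real.log (kronSum Psi + kronSum D).det
        + ((kronSum Psi)⁻¹ * kronSum D).trace)
      + (deviation x (kronSum Psi)⁻¹ (kronSum D)
        + ∑ k, (mdim d k : ℝ) * (ρ k * (offOne (Psi k + D k) - offOne (Psi k)))) := by
    rw [objective_eq hd, objective_eq hd, hDB, add_mulVec, dotProduct_add, deviation]
    simp only [← hDk, mul_sub, Finset.sum_sub_distrib]
    ring
  have hpos : 0 < 4 * opNorm (kronSum Psi) ^ 2 * (objective x ρ B - objective x ρ Psi) := by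
    rw [hdiff, mul_add]
    have h1 := mul_le_mul_of_nonneg_left hl
      (by positivity : 0 ≤ 4 * opNorm (kronSum Psi) ^ 2)
    nlinarith
  have := pos_of_mul_pos_right hpos (by positivity)
  linarith

/-- The form of `A` is at least `(x·x) / ‖A⁻¹‖`, and the perturbation changes it by less. -/
theorem posDef_of_opNorm_sub_lt {ι : Type*} [Fintype ι] [DecidableEq ι] {A M : Matrix ι ι ℝ}
    (hA : A.PosDef) (hM : M.IsHermitian) (h : opNorm A⁻¹ * opNorm (M - A) < 1) : M.PosDef := by
  obtain ⟨R, Q, hR, hQ, hRR, hQQ, hRQ, hQR⟩ := exists_symm_sqrt hA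
  refine PosDef.of_dotProduct_mulVec_pos hM fun {x} hx => ?_
  rw [star_trivial]
  have hxx : 0 < x ⬝ᵥ x := by
    have := dotProduct_self_eq_zero.not.2 hx
    exact lt_of_le_of_ne (Finset.sum_nonneg fun i _ => mul_self_nonneg _) (Ne.symm this)
  have h1 : x ⬝ᵥ x ≤ opNorm A⁻¹ * (x ⬝ᵥ (A *ᵥ x)) := by
    have h2 : R *ᵥ (Q *ᵥ x) = x := by rw [mulVec_mulVec, hRQ, one_mulVec]
    have h3 := opBound_opNorm R (Q *ᵥ x)
    rw [h2, ← opNorm_mul_self hR, hRR, dotProduct_mulVec, ← mulVec_transpose, hQ, mulVec_mulVec,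
      hQQ, dotProduct_comm (A *ᵥ x)] at h3
    exact h3
  have h4 := (abs_le.1 (abs_dotProduct_mulVec_le (M - A) x)).1
  rw [sub_mulVec, dotProduct_sub] at h4
  have h5 : opNorm A⁻¹ * opNorm (M - A) * (x ⬝ᵥ x) < 1 * (x ⬝ᵥ x) := by gcongr
  have h6 := mul_le_mul_of_nonneg_left h4 (opNorm_nonneg A⁻¹)
  have h7 : 0 < opNorm A⁻¹ * (x ⬝ᵥ (M *ᵥ x)) := by nlinarith
  exact pos_of_mul_pos_right h7 (opNorm_nonneg _)

end Deterministic

/-! ### Existence and localization of minimizers -/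

section Existence

variable {L : ℕ} {d : Fin L → ℕ}

open Matrix

theorem abs_apply_le_frobNorm {ι : Type*} [Fintype ι] (A : Matrix ι ι ℝ) (i j : ι) :
    |A i j| ≤ frobNorm A := by
  refine Real.abs_le_sqrt ?_
  refine le_trans ?_ (Finset.single_le_sum (f := fun i => ∑ j, A i j ^ 2)
    (fun i _ => by positivity) (Finset.mem_univ i))
  exact Finset.single_le_sum (f := fun j => A i j ^ 2) (fun j _ => sq_nonneg _) (Finset.mem_univ j)

/-- The components of a Kronecker sum can be chosen to depend boundedly on the sum. -/
theorem exists_normalized (hL : 1 ≤ L) (hd : ∀ k, 1 ≤ d k)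
    (Psi B : (k : Fin L) → Matrix (Fin (d k)) (Fin (d k)) ℝ) :
    ∃ B' : (k : Fin L) → Matrix (Fin (d k)) (Fin (d k)) ℝ, kronSum B' = kronSum B ∧
      (∀ k, offOne (B' k) = offOne (B k)) ∧
      ∀ k a b, |B' k a b - Psi k a b| ≤ 2 * frobNorm (kronSum B - kronSum Psi) := by
  set D : (k : Fin L) → Matrix (Fin (d k)) (Fin (d k)) ℝ := fun k => B k - Psi k with hD
  have hLr : (1 : ℝ) ≤ L := by exact_mod_cast hL
  set τ := diagMean D with hτ
  have hfrob := frobSq_kronSum_eq_traceless_add hd D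
  have hnn : ∀ k, 0 ≤ (mdim d k : ℝ) * frobSq (traceless (D k)) := fun k =>
    mul_nonneg (by positivity) (frobSq_nonneg _)
  -- The traceless parts are determined by the sum; the total multiple `τ` of the identity is shared
  -- equally. Off-diagonal entries, hence the penalty, do not change.
  refine ⟨fun k => Psi k + (traceless (D k) + (τ / L) • 1), ?_, fun k => ?_, fun k a b => ?_⟩
  · rw [kronSum_add, kronSum_add, kronSum_smul_one]
    have h1 : ∑ _k : Fin L, τ / L = τ := by
      rw [Finset.sum_const, Finset.card_univ, Fintype.card_fin, nsmul_eq_mul]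
      field_simp
    rw [h1, hτ, ← kronSum_eq_traceless_add, hD, kronSum_sub]
    abel
  · simp only [offOne]
    refine Finset.sum_congr rfl fun a _ => Finset.sum_congr rfl fun b _ => ?_
    split_ifs with h
    · rfl
    · simp [traceless, hD, h]
  · rw [← kronSum_sub]
    have h1 : |traceless (D k) a b| ≤ frobNorm (kronSum D) := by
      refine (abs_apply_le_frobNorm _ a b).trans (Real.sqrt_le_sqrt ?_)
      change frobSq _ ≤ frobSq _
      have h2 : (1 : ℝ) ≤ mdim d k := by exact_mod_cast mdim_pos hd k
      have h3 := Finset.single_le_sum (fun k _ => hnn k) (Finset.mem_univ k)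
      have h4 : 0 ≤ (pdim d : ℝ) * diagMean D ^ 2 := by positivity
      have h5 := frobSq_nonneg (traceless (D k))
      nlinarith
    have h2 : |(τ / L) * (1 : Matrix (Fin (d k)) (Fin (d k)) ℝ) a b| ≤ frobNorm (kronSum D) := by
      have h3 : |τ| ≤ frobNorm (kronSum D) := by
        refine Real.abs_le_sqrt ?_
        change _ ≤ frobSq _
        have h2 : (1 : ℝ) ≤ pdim d := by exact_mod_cast pdim_pos hd
        have h4 : 0 ≤ ∑ k, (mdim d k : ℝ) * frobSq (traceless (D k)) :=
          Finset.sum_nonneg fun k _ => hnn k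
        nlinarith [sq_nonneg τ]
      refine le_trans ?_ h3
      rw [abs_mul, abs_div, abs_of_pos (by linarith : (0 : ℝ) < L)]
      have h5 : |(1 : Matrix (Fin (d k)) (Fin (d k)) ℝ) a b| ≤ 1 := by
        rw [one_apply]; split_ifs <;> simp
      have h6 : |τ| / L ≤ |τ| := div_le_self (abs_nonneg _) hLr
      calc |τ| / L * |(1 : Matrix (Fin (d k)) (Fin (d k)) ℝ) a b| ≤ |τ| * 1 := by gcongr
        _ = |τ| := mul_one _
    have h3 : (Psi k + (traceless (D k) + (τ / L) • 1)) a b - Psi k a b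
        = traceless (D k) a b + (τ / L) * (1 : Matrix (Fin (d k)) (Fin (d k)) ℝ) a b := by
      simp only [Matrix.add_apply, Matrix.smul_apply, smul_eq_mul]; ring
    rw [h3]
    refine (abs_add_le _ _).trans ?_
    linarith

theorem continuous_kronSum :
    Continuous (kronSum : ((k : Fin L) → Matrix (Fin (d k)) (Fin (d k)) ℝ) → _) := by
  refine continuous_matrix fun i j => ?_
  simp only [kronSum_eq_sum, Matrix.sum_apply, modeEmbed_apply]
  refine continuous_finsetSum _ fun k _ => ?_
  split_ifs
  · exact (continuous_apply k).matrix_elem _ _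
  · exact continuous_const

theorem continuous_frobNorm {ι : Type*} [Fintype ι] :
    Continuous (frobNorm : Matrix ι ι ℝ → ℝ) := by
  unfold frobNorm
  refine Real.continuous_sqrt.comp (continuous_finsetSum _ fun i _ =>
    continuous_finsetSum _ fun j _ => ?_)
  exact (continuous_id.matrix_elem i j).pow 2

theorem continuous_offOne {n : ℕ} : Continuous (offOne : Matrix (Fin n) (Fin n) ℝ → ℝ) := by
  unfold offOne
  refine continuous_finsetSum _ fun i _ => continuous_finsetSum _ fun j _ => ?_
  split_ifs
  · exact continuous_const
  · exact (continuous_id.matrix_elem i j).abs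

theorem continuousOn_objective (hd : ∀ k, 1 ≤ d k) (x : Idx d → ℝ) (ρ : Fin L → ℝ) :
    ContinuousOn (objective x ρ) {B | (kronSum B).PosDef} := by
  have h1 : ContinuousOn (fun B : (k : Fin L) → Matrix (Fin (d k)) (Fin (d k)) ℝ =>
      Real.log (kronSum B).det) {B | (kronSum B).PosDef} :=
    ContinuousOn.log (continuous_kronSum.matrix_det).continuousOn fun B hB => hB.det_pos.ne'
  have h2 : Continuous (fun B : (k : Fin L) → Matrix (Fin (d k)) (Fin (d k)) ℝ =>
      x ⬝ᵥ (kronSum B *ᵥ x)) :=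
    continuous_const.dotProduct (continuous_kronSum.matrix_mulVec continuous_const)
  have h3 : Continuous (fun B : (k : Fin L) → Matrix (Fin (d k)) (Fin (d k)) ℝ =>
      ∑ k, (mdim d k : ℝ) * (ρ k * offOne (B k))) :=
    continuous_finsetSum _ fun k _ => continuous_const.mul
      (continuous_const.mul (continuous_offOne.comp (continuous_apply k)))
  refine ((h1.neg.add h2.continuousOn).add h3.continuousOn).congr fun B _ => ?_
  exact objective_eq hd x ρ B

/-- If the objective exceeds its value at the truth outside a small Frobenius ball, then minimizers
exist and lie in the ball. -/
theorem exists_isTeraLasso_and_frobNorm_le (hL : 1 ≤ L) (hd : ∀ k, 1 ≤ d k) {x : Idx d → ℝ}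
    {ρ : Fin L → ℝ} {Psi : (k : Fin L) → Matrix (Fin (d k)) (Fin (d k)) ℝ}
    (hPsi : (kronSum Psi).PosDef) {r : ℝ} (hr : 0 < r)
    (hsmall : opNorm (kronSum Psi)⁻¹ * (√((L + 1) / mmin d) * r) ≤ 1 / 2)
    (hball : ∀ B : (k : Fin L) → Matrix (Fin (d k)) (Fin (d k)) ℝ, (kronSum B).PosDef →
      r < frobNorm (kronSum B - kronSum Psi) → objective x ρ Psi < objective x ρ B) :
    (∃ Ωhat, IsTeraLasso x ρ Ωhat) ∧
      ∀ Ωhat, IsTeraLasso x ρ Ωhat → ∃ D : (k : Fin L) → Matrix (Fin (d k)) (Fin (d k)) ℝ,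
        Ωhat - kronSum Psi = kronSum D ∧ frobNorm (kronSum D) ≤ r := by
  refine ⟨?_, ?_⟩
  · set C : Set ((k : Fin L) → Matrix (Fin (d k)) (Fin (d k)) ℝ) :=
      {B | (∀ k a b, B k a b ∈ Set.Icc (Psi k a b - 2 * r) (Psi k a b + 2 * r)) ∧
        frobNorm (kronSum B - kronSum Psi) ≤ r ∧ (kronSum B)ᵀ = kronSum B} with hC
    have hbox : IsCompact {B : (k : Fin L) → Matrix (Fin (d k)) (Fin (d k)) ℝ |
        ∀ k a b, B k a b ∈ Set.Icc (Psi k a b - 2 * r) (Psi k a b + 2 * r)} := by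
      have h1 : IsCompact (Set.pi Set.univ fun k : Fin L =>
          Set.pi Set.univ fun a : Fin (d k) => Set.pi Set.univ fun b : Fin (d k) =>
            Set.Icc (Psi k a b - 2 * r) (Psi k a b + 2 * r)) :=
        isCompact_univ_pi fun k => isCompact_univ_pi fun a => isCompact_univ_pi fun b =>
          isCompact_Icc
      convert! h1 using 1
      ext B
      exact ⟨fun h k _ a _ b _ => h k a b,
        fun h k a b => h k trivial a trivial b trivial⟩
    have hclosed : IsClosed {B : (k : Fin L) → Matrix (Fin (d k)) (Fin (d k)) ℝ |
        frobNorm (kronSum B - kronSum Psi) ≤ r ∧ (kronSum B)ᵀ = kronSum B} :=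
      (isClosed_le (continuous_frobNorm.comp (continuous_kronSum.sub continuous_const))
        continuous_const).inter
      (isClosed_eq continuous_kronSum.matrix_transpose continuous_kronSum)
    have hcomp : IsCompact C := hbox.inter_right hclosed
    have hsymm : (kronSum Psi)ᵀ = kronSum Psi := by
      have := hPsi.isHermitian
      rwa [IsHermitian, conjTranspose_eq_transpose_of_trivial] at this
    have hPsiC : Psi ∈ C := by
      refine ⟨fun k a b => ⟨by linarith, by linarith⟩, ?_, hsymm⟩
      rw [sub_self]
      simpa [frobNorm] using hr.le
    have hpd : ∀ B ∈ C, (kronSum B).PosDef := by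
      intro B hB
      refine posDef_of_opNorm_sub_lt hPsi ?_ ?_
      · rw [IsHermitian, conjTranspose_eq_transpose_of_trivial]; exact hB.2.2
      · have hm : (0 : ℝ) < mmin d := by exact_mod_cast mmin_pos hL hd
        have hop : opNorm (kronSum B - kronSum Psi) ≤ √((L + 1) / mmin d) * r := by
          refine le_trans ?_ (mul_le_mul_of_nonneg_left hB.2.1 (Real.sqrt_nonneg _))
          rw [← kronSum_sub, frobNorm_eq_sqrt, ← Real.sqrt_mul (by positivity)]
          refine Real.le_sqrt_of_sq_le ?_
          rw [div_mul_eq_mul_div, le_div_iff₀ hm, mul_comm]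
          exact mmin_mul_opNorm_sq_le hL hd _
        have := mul_le_mul_of_nonneg_left hop (opNorm_nonneg (kronSum Psi)⁻¹)
        linarith
    obtain ⟨B, hBC, hmin⟩ := hcomp.exists_isMinOn ⟨Psi, hPsiC⟩
      ((continuousOn_objective hd x ρ).mono hpd)
    refine ⟨kronSum B, B, rfl, hpd B hBC, fun B' hB' => ?_⟩
    rcases lt_or_ge r (frobNorm (kronSum B' - kronSum Psi)) with hlt | hle
    · exact (hmin hPsiC).trans (hball B' hB' hlt).le
    -- A competitor inside the ball may have components outside the box; its normalized version lies
    -- in `C` and has the same objective.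
    · obtain ⟨B₁, h1, h2, h3⟩ := exists_normalized hL hd Psi B'
      have hmem : B₁ ∈ C := by
        refine ⟨fun k a b => ?_, by rwa [h1], ?_⟩
        · have := abs_le.1 (h3 k a b)
          constructor <;> linarith [this.1, this.2]
        · rw [h1]
          have := hB'.isHermitian
          rwa [IsHermitian, conjTranspose_eq_transpose_of_trivial] at this
      have heq : objective x ρ B₁ = objective x ρ B' := by
        rw [objective_eq hd, objective_eq hd, h1]
        simp only [h2]
      rw [← heq]
      exact hmin hmem
  · rintro Ωhat ⟨B, rfl, hB, hmin⟩
    refine ⟨fun k => B k - Psi k, (kronSum_sub B Psi).symm, ?_⟩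
    rw [kronSum_sub]
    by_contra! h
    exact absurd (hmin Psi hPsi) (not_le.2 (hball B hB h))

end Existence

/-! ### Concentration of the Gram matrices -/

section Concentration

open Matrix

variable {S : Type*} [MeasurableSpace S] {μ : Measure S} [IsProbabilityMeasure μ] {t : ℝ}

/-- With `x = RZ` the deviation is the centred quadratic form of `R M R` in `Z`; conjugation by `R`
costs one factor `‖Σ₀‖₂` in either norm. -/
theorem SubgaussianFamily.lintegral_eexp_deviation_le {ι : Type*} [Fintype ι] [DecidableEq ι]
    {Z : ι → S → ℝ} (h : SubgaussianFamily μ t Z) {R Sig0 : Matrix ι ι ℝ} (hR : Rᵀ = R)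
    (hRR : R * R = Sig0) (M : Matrix ι ι ℝ) {a : ℝ}
    (ha : 32 * |a| * t ^ 2 * (opNorm Sig0 * opNorm M) ≤ 1) :
    ∫⁻ ω, eexp (a * deviation (R *ᵥ fun i => Z i ω) Sig0 M) ∂μ
      ≤ eexp (256 * a ^ 2 * t ^ 4 * (opNorm Sig0 ^ 2 * frobSq M)) := by
  have hdev : ∀ z : ι → ℝ, deviation (R *ᵥ z) Sig0 M
      = z ⬝ᵥ ((R * M * R) *ᵥ z) - (R * M * R).trace := by
    intro z
    rw [deviation, trace_mul_cycle R M R, hRR, ← mulVec_mulVec, ← mulVec_mulVec,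
      dotProduct_mulVec z, ← mulVec_transpose, hR]
  simp_rw [hdev]
  have hop : opNorm (R * M * R) ≤ opNorm Sig0 * opNorm M := by
    rw [← hRR]; exact opNorm_conj_le hR M
  refine (h.lintegral_eexp_quadratic_le (opBound_opNorm _) (opNorm_nonneg _) ?_).trans
    (eexp_mono ?_)
  · refine le_trans ?_ ha
    gcongr
  · gcongr
    rw [← hRR]
    exact frobSq_conj_le hR M

variable {L : ℕ} {d : Fin L → ℕ}

theorem frobSq_single {n : ℕ} (a b : Fin n) :
    frobSq (Matrix.single a b (1 : ℝ)) = 1 := by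
  rw [frobSq, Finset.sum_eq_single a, Finset.sum_eq_single b]
  · simp
  · intro j _ hj; simp [hj.symm]
  · simp
  · intro i _ hi; exact Finset.sum_eq_zero fun j _ => by simp [hi.symm]
  · simp

theorem measurable_deviation {ι : Type*} [Fintype ι] {Y : S → ι → ℝ} (hY : Measurable Y)
    (Sig0 M : Matrix ι ι ℝ) : Measurable fun ω => deviation (Y ω) Sig0 M := by
  simp only [deviation, dotProduct, mulVec]
  fun_prop

theorem measurable_mulVec {ι : Type*} [Fintype ι] {Z : ι → S → ℝ} (hZ : ∀ i, Measurable (Z i))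
    (R : Matrix ι ι ℝ) : Measurable fun ω => R *ᵥ fun i => Z i ω := by
  refine measurable_pi_lambda _ fun i => ?_
  simp only [mulVec, dotProduct]
  fun_prop

/-- An embedded matrix unit has operator norm at most `1` and squared Frobenius norm `m_k`. As `q ≤
m_k`, the threshold stays in the sub-gaussian range of Hanson–Wright. -/
theorem SubgaussianFamily.measure_deviation_single_ge_le (hd : ∀ k, 1 ≤ d k)
    {Z : Idx d → S → ℝ} (h : SubgaussianFamily μ t Z) {R Sig0 : Matrix (Idx d) (Idx d) ℝ}
    (hR : Rᵀ = R) (hRR : R * R = Sig0) (hσ : 0 < opNorm Sig0) (k : Fin L) {q : ℝ} (hq : 0 ≤ q)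
    (hqm : q ≤ mdim d k) (a b : Fin (d k)) :
    μ {ω | mdim d k * (192 * t ^ 2 * (opNorm Sig0 * √(q / mdim d k)))
        ≤ |deviation (R *ᵥ fun i => Z i ω) Sig0 (modeEmbed k (Matrix.single a b 1))|}
      ≤ 2 * eexp (-5 * q) := by
  have ht := h.pos
  have hm : (0 : ℝ) < mdim d k := by exact_mod_cast mdim_pos hd k
  set σ := opNorm Sig0
  set M : Matrix (Idx d) (Idx d) ℝ := modeEmbed k (Matrix.single a b 1) with hM
  set w := √(q / mdim d k) with hw
  have hw0 : 0 ≤ w := Real.sqrt_nonneg _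
  have hw1 : w ≤ 1 := by
    rw [hw, Real.sqrt_le_one, div_le_one hm]; exact hqm
  have hw2 : mdim d k * w ^ 2 = q := by
    rw [hw, Real.sq_sqrt (by positivity)]; field_simp
  have hMop : opNorm M ≤ 1 := by
    refine (opNorm_modeEmbed_le k _).trans ?_
    rw [frobNorm_eq_sqrt, frobSq_single, Real.sqrt_one]
  have hMf : frobSq M = mdim d k := by rw [hM, frobSq_modeEmbed, frobSq_single, mul_one]
  have hmeas := measurable_deviation (measurable_mulVec h.measurable R) Sig0 M
  -- This is admissible since `w ≤ 1`. The exponent is then `256/32² · q = q/4`, and the threshold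
  -- becomes `192/32 · q = 6q`, which leaves a tail below `exp(-5q)`.
  set η := w / (32 * t ^ 2 * σ) with hη
  have hη0 : 0 ≤ η := by positivity
  have hside : ∀ s : ℝ, |s| = 1 →
      μ {ω | 6 * q ≤ (s * η) * deviation (R *ᵥ fun i => Z i ω) Sig0 M} ≤ eexp (-5 * q) := by
    intro s hs
    have hmgf := h.lintegral_eexp_deviation_le hR hRR M (a := s * η) (by
      rw [abs_mul, hs, one_mul, abs_of_nonneg hη0]
      calc 32 * η * t ^ 2 * (σ * opNorm M) ≤ 32 * η * t ^ 2 * (σ * 1) := by gcongr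
        _ = w := by rw [hη]; field_simp
        _ ≤ 1 := hw1)
    refine (measure_le_of_lintegral_eexp_le (hmeas.const_mul _) hmgf).trans (eexp_mono ?_)
    have hs2 : s ^ 2 = 1 := by rw [← sq_abs, hs, one_pow]
    have h2 : 256 * (s * η) ^ 2 * t ^ 4 * (σ ^ 2 * frobSq M) = q / 4 := by
      rw [hMf, mul_pow, hs2, hη, ← hw2]
      field_simp
      ring
    rw [h2]; linarith
  have hsub : {ω | mdim d k * (192 * t ^ 2 * (σ * w))
        ≤ |deviation (R *ᵥ fun i => Z i ω) Sig0 M|}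
      ⊆ {ω | 6 * q ≤ ((1 : ℝ) * η) * deviation (R *ᵥ fun i => Z i ω) Sig0 M} ∪
        {ω | 6 * q ≤ ((-1 : ℝ) * η) * deviation (R *ᵥ fun i => Z i ω) Sig0 M} := by
    intro ω hω
    have h1 : mdim d k * (192 * t ^ 2 * (σ * w))
        ≤ |deviation (R *ᵥ fun i => Z i ω) Sig0 M| := hω
    have h2 := mul_le_mul_of_nonneg_left h1 hη0
    have h3 : η * (mdim d k * (192 * t ^ 2 * (σ * w))) = 6 * q := by
      rw [hη, ← hw2]; field_simp; ring
    rw [h3] at h2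
    rcases abs_cases (deviation (R *ᵥ fun i => Z i ω) Sig0 M) with ⟨he, _⟩ | ⟨he, _⟩
    · left
      change 6 * q ≤ _
      rw [he] at h2; linarith
    · right
      change 6 * q ≤ _
      rw [he] at h2; linarith
  refine (measure_mono hsub).trans ((measure_union_le _ _).trans ?_)
  rw [two_mul]
  exact add_le_add (hside 1 (by simp)) (hside (-1) (by simp))

/-- Diagonals of the Kronecker sums of diagonal matrices. -/
def diagSum (d : Fin L → ℕ) : ((k : Fin L) → Fin (d k) → ℝ) →ₗ[ℝ] EuclideanSpace ℝ (Idx d) where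
  toFun u := WithLp.toLp 2 fun i => ∑ k, u k (i k)
  map_add' u v := by ext i; simp [Finset.sum_add_distrib]
  map_smul' c u := by ext i; simp [Finset.mul_sum]

theorem kronSum_diagonal (u : (k : Fin L) → Fin (d k) → ℝ) :
    kronSum (fun k => diagonal (u k)) = diagonal (diagSum d u).ofLp := by
  ext i j
  rw [kronSum_eq_sum, Matrix.sum_apply, diagonal_apply]
  split_ifs with h
  · subst h
    simp [modeEmbed_apply, diagSum]
  · refine Finset.sum_eq_zero fun k _ => ?_
    rw [modeEmbed_apply]
    split_ifs with h1
    · rw [diagonal_apply_ne]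
      intro hk
      refine h (funext fun l => ?_)
      by_cases hl : l = k
      · subst hl; exact hk
      · exact h1 l hl
    · rfl

theorem frobSq_diagonal {ι : Type*} [Fintype ι] [DecidableEq ι] (v : EuclideanSpace ℝ ι) :
    frobSq (diagonal v.ofLp) = ‖v‖ ^ 2 := by
  rw [EuclideanSpace.real_norm_sq_eq, frobSq]
  refine Finset.sum_congr rfl fun i _ => ?_
  rw [Finset.sum_eq_single i]
  · simp
  · intro j _ hj; simp [diagonal_apply_ne _ hj.symm]
  · simp

/-- On diagonal matrices the deviation is the inner product with one random vector, so its supremum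
over a subspace is governed by the norm of the projection. -/
theorem deviation_diagonal {ι : Type*} [Fintype ι] [DecidableEq ι] (x : ι → ℝ)
    (Sig0 : Matrix ι ι ℝ) (v : EuclideanSpace ℝ ι) :
    deviation x Sig0 (diagonal v.ofLp)
      = inner ℝ v (WithLp.toLp 2 fun i => x i ^ 2 - Sig0 i i) := by
  rw [PiLp.inner_apply]
  simp only [deviation, dotProduct, mulVec_diagonal, Matrix.trace, diag_apply, mul_diagonal,
    ← Finset.sum_sub_distrib]
  refine Finset.sum_congr rfl fun i _ => ?_
  simp
  ring

/-- The bound on the deviations of the diagonal entries, uniformly over Kronecker sums. -/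
theorem SubgaussianFamily.measure_deviation_diagonal_gt_le (hL : 1 ≤ L) (hd : ∀ k, 1 ≤ d k)
    {Z : Idx d → S → ℝ} (h : SubgaussianFamily μ t Z) {R Sig0 : Matrix (Idx d) (Idx d) ℝ}
    (hR : Rᵀ = R) (hRR : R * R = Sig0) (hσ : 0 < opNorm Sig0)
    (hm : (32 * t ^ 2) ^ 2 * ((L + 1) * (L * dmax d)) ≤ mmin d) :
    μ {ω | ¬ ∀ D : (k : Fin L) → Matrix (Fin (d k)) (Fin (d k)) ℝ,
        |deviation (R *ᵥ fun i => Z i ω) Sig0 (kronSum fun k => diagPart (D k))|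
          ≤ 4 * (5 + 256 * t ^ 4) * opNorm Sig0 * √(L * dmax d) *
            frobNorm (kronSum fun k => diagPart (D k))}
      ≤ eexp (-3 * (L * dmax d)) := by
  have ht := h.pos
  have hm0 : (0 : ℝ) < mmin d := by exact_mod_cast mmin_pos hL hd
  have hq0 : (0 : ℝ) < L * dmax d := by
    have h1 : 0 < dmax d := (hd ⟨0, hL⟩).trans (le_dmax _)
    have h2 : 0 < L := hL
    exact_mod_cast Nat.mul_pos h2 h1
  set q : ℝ := L * dmax d with hq
  set σ := opNorm Sig0
  set V : Submodule ℝ (EuclideanSpace ℝ (Idx d)) := LinearMap.range (diagSum d) with hV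
  have hfin : Module.finrank ℝ V ≤ L * dmax d := by
    refine (LinearMap.finrank_range_le (diagSum d)).trans ?_
    rw [Module.finrank_pi_fintype]
    simp only [Module.finrank_fintype_fun_eq_card, Fintype.card_fin]
    refine (Finset.sum_le_sum fun k _ => le_dmax k).trans_eq ?_
    simp
  set n : S → EuclideanSpace ℝ (Idx d) := fun ω =>
    WithLp.toLp 2 fun i => (R *ᵥ fun i => Z i ω) i ^ 2 - Sig0 i i with hn
  have hnm : Measurable n := by
    refine (WithLp.measurable_toLp 2 _).comp (measurable_pi_lambda _ fun i => ?_)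
    exact (((measurable_pi_apply i).comp (measurable_mulVec h.measurable R)).pow_const 2).sub_const _
  set N : S → V := fun ω => V.orthogonalProjectionOnto (n ω) with hN
  have hNm : Measurable N := V.orthogonalProjectionOnto.continuous.measurable.comp hnm
  have hinner : ∀ (v : V) ω, inner ℝ v (N ω)
      = deviation (R *ᵥ fun i => Z i ω) Sig0 (diagonal (v : EuclideanSpace ℝ (Idx d)).ofLp) := by
    intro v ω
    rw [deviation_diagonal, hN]
    simp [hn]
  have hop : ∀ v : V, opNorm (diagonal (v : EuclideanSpace ℝ (Idx d)).ofLp)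
      ≤ √((L + 1) / mmin d) * ‖v‖ := by
    rintro ⟨v, u, rfl⟩
    rw [← Real.sqrt_sq (norm_nonneg _), ← Real.sqrt_mul (by positivity)]
    refine Real.le_sqrt_of_sq_le ?_
    rw [div_mul_eq_mul_div, le_div_iff₀ hm0, mul_comm]
    have h1 := mmin_mul_opNorm_sq_le hL hd fun k => diagonal (u k)
    rw [kronSum_diagonal, frobSq_diagonal] at h1
    exact h1
  -- The radius at which the moment exponent `256 t⁴ σ² r²` is proportional to `q`, which bounds the
  -- dimension; `hm` ensures that Hanson–Wright applies up to this radius.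
  set r : ℝ := √q / σ with hr
  have hr0 : 0 < r := by positivity
  have hr2 : σ ^ 2 * r ^ 2 = q := by
    rw [hr, div_pow, Real.sq_sqrt hq0.le]; field_simp
  have hsmall : 32 * t ^ 2 * (√((L + 1) / mmin d) * √q) ≤ 1 := by
    rw [← Real.sqrt_mul (by positivity), ← Real.sqrt_sq (by positivity : 0 ≤ 32 * t ^ 2),
      ← Real.sqrt_mul (by positivity), Real.sqrt_le_one, div_mul_eq_mul_div, mul_div_assoc',
      div_le_one hm0]
    exact hm
  have hmgf : ∀ v : V, ‖v‖ ≤ r →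
      ∫⁻ ω, eexp (inner ℝ v (N ω)) ∂μ ≤ eexp (256 * t ^ 4 * q) := by
    intro v hv
    have h1 := h.lintegral_eexp_deviation_le hR hRR
      (diagonal (v : EuclideanSpace ℝ (Idx d)).ofLp) (a := 1) (by
        rw [abs_one, mul_one]
        calc 32 * t ^ 2 * (σ * opNorm (diagonal (v : EuclideanSpace ℝ (Idx d)).ofLp))
            ≤ 32 * t ^ 2 * (σ * (√((L + 1) / mmin d) * r)) := by
              gcongr
              exact (hop v).trans (by gcongr)
          _ = 32 * t ^ 2 * (√((L + 1) / mmin d) * √q) := by rw [hr]; field_simp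
          _ ≤ 1 := hsmall)
    simp only [one_mul] at h1
    simp_rw [hinner]
    refine h1.trans (eexp_mono ?_)
    rw [frobSq_diagonal, one_pow, mul_one]
    have h2 : ‖(v : EuclideanSpace ℝ (Idx d))‖ ^ 2 ≤ r ^ 2 := by
      gcongr; exact hv
    calc _ ≤ 256 * t ^ 4 * (σ ^ 2 * r ^ 2) := by gcongr
      _ = _ := by rw [hr2]
  have hball := lintegral_eexp_norm_le hNm hr0 hmgf
  have hexp : (4 : ENNReal) ^ Module.finrank ℝ V * eexp (256 * t ^ 4 * q)
      ≤ eexp (2 * q + 256 * t ^ 4 * q) := by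
    rw [eexp_add]
    gcongr
    have h4 : (4 : ENNReal) ≤ eexp 2 := by
      rw [eexp, show (4 : ENNReal) = ENNReal.ofReal 4 by simp]
      refine ENNReal.ofReal_le_ofReal ?_
      have := Real.quadratic_le_exp_of_nonneg (x := 2) (by norm_num)
      linarith
    calc (4 : ENNReal) ^ Module.finrank ℝ V ≤ eexp 2 ^ Module.finrank ℝ V := by gcongr
      _ = eexp (2 * Module.finrank ℝ V) := by
          rw [eexp, eexp, ← ENNReal.ofReal_pow (Real.exp_pos _).le, ← Real.exp_nat_mul, mul_comm]
      _ ≤ eexp (2 * q) := by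
          refine eexp_mono ?_
          have : (Module.finrank ℝ V : ℝ) ≤ q := by rw [hq]; exact_mod_cast hfin
          linarith
  -- The volume factor `4^dim` contributes at most `2q` and the moment `256 t⁴ q`, so this threshold
  -- leaves `exp(-3q)`.
  have htail := measure_le_of_lintegral_eexp_le (a := (5 + 256 * t ^ 4) * q)
    (hNm.norm.const_mul (r / 4)) (hball.trans hexp)
  refine (measure_mono fun ω hω => ?_).trans (htail.trans (eexp_mono (by linarith)))
  by_contra hlt
  have hlt' : r / 4 * ‖N ω‖ < (5 + 256 * t ^ 4) * q := not_le.1 hlt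
  refine hω fun D => ?_
  have hNle : ‖N ω‖ ≤ 4 * (5 + 256 * t ^ 4) * σ * √q := by
    have h1 : r / 4 * (4 * (5 + 256 * t ^ 4) * σ * √q) = (5 + 256 * t ^ 4) * q := by
      rw [hr]
      field_simp
      rw [Real.sq_sqrt hq0.le]
    rw [← h1] at hlt'
    exact (lt_of_mul_lt_mul_left hlt' (by positivity)).le
  simp only [diagPart]
  rw [kronSum_diagonal fun k => (D k).diag]
  set v : V := ⟨diagSum d fun k => (D k).diag, ⟨_, rfl⟩⟩ with hv
  have h2 := hinner v ω
  simp only [hv] at h2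
  rw [← h2, frobNorm_eq_sqrt, frobSq_diagonal, Real.sqrt_sq (norm_nonneg _)]
  refine (abs_real_inner_le_norm _ _).trans ?_
  rw [mul_comm]
  exact mul_le_mul_of_nonneg_right hNle (norm_nonneg _)

end Concentration

/-! ### The rate of convergence -/

section Rate

open Matrix

variable {L : ℕ} {d : Fin L → ℕ}

theorem exists_dmax_eq (hL : 1 ≤ L) : ∃ k, d k = dmax d := by
  have : Nonempty (Fin L) := ⟨⟨0, hL⟩⟩
  exact exists_eq_ciSup_of_finite

theorem dmax_pos (hL : 1 ≤ L) (hd : ∀ k, 1 ≤ d k) : 0 < dmax d :=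
  (hd ⟨0, hL⟩).trans (le_dmax _)

theorem log_pdim_nonneg : 0 ≤ Real.log (pdim d) := Real.log_natCast_nonneg _

theorem log_pdim_le (hd : ∀ k, 1 ≤ d k) : Real.log (pdim d) ≤ L * dmax d := by
  rw [pdim]
  push_cast
  rw [Real.log_prod fun k _ => by have := hd k; positivity]
  refine (Finset.sum_le_card_nsmul Finset.univ _ (dmax d : ℝ) fun k _ => ?_).trans_eq (by simp)
  refine (Real.log_le_self (by positivity)).trans ?_
  exact_mod_cast le_dmax k

/-- The effective dimension of the problem. -/
def effDim (Psi : (k : Fin L) → Matrix (Fin (d k)) (Fin (d k)) ℝ) : ℝ :=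
  (∑ k, (offSupp (Psi k) : ℝ)) * Real.log (pdim d) + L * dmax d

theorem effDim_pos (hL : 1 ≤ L) (hd : ∀ k, 1 ≤ d k)
    (Psi : (k : Fin L) → Matrix (Fin (d k)) (Fin (d k)) ℝ) : 0 < effDim Psi := by
  have h1 := dmax_pos hL hd
  have h2 : 0 < L := hL
  have h3 : (0 : ℝ) < L * dmax d := by positivity
  have h4 : 0 ≤ (∑ k, (offSupp (Psi k) : ℝ)) * Real.log (pdim d) :=
    mul_nonneg (by positivity) log_pdim_nonneg
  rw [effDim]; linarith

/-- The bracket in (A3) is at least `m_min` times the effective dimension, by `m_k ≥ m_min` and `p ≥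
m_min d_max`; one factor `m_min` cancels. -/
theorem mmin_ge_of_A3 (hL : 1 ≤ L) (hd : ∀ k, 1 ≤ d k) {C : ℝ}
    {Psi : (k : Fin L) → Matrix (Fin (d k)) (Fin (d k)) ℝ} {Sig0 : Matrix (Idx d) (Idx d) ℝ}
    (h : A3 C Psi Sig0) : C ^ 2 * (L + 1) * kappa Sig0 ^ 4 * effDim Psi ≤ mmin d := by
  have hm : (0 : ℝ) < mmin d := by exact_mod_cast mmin_pos hL hd
  have h1 : mmin d * effDim Psi
      ≤ (∑ k, (mdim d k : ℝ) * offSupp (Psi k)) * Real.log (pdim d) + L * pdim d := by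
    rw [effDim, mul_add, ← mul_assoc]
    refine add_le_add (mul_le_mul_of_nonneg_right ?_ log_pdim_nonneg) ?_
    · rw [Finset.mul_sum]
      refine Finset.sum_le_sum fun k _ => ?_
      gcongr
      exact mmin_le k
    · obtain ⟨k, hk⟩ := exists_dmax_eq (d := d) hL
      have h2 : mmin d * dmax d ≤ pdim d := by
        rw [← mul_mdim k, ← hk, mul_comm]
        exact Nat.mul_le_mul_left _ (mmin_le k)
      have h3 : (mmin d : ℝ) * dmax d ≤ pdim d := by exact_mod_cast h2
      calc (mmin d : ℝ) * (L * dmax d) = L * (mmin d * dmax d) := by ring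
        _ ≤ _ := by gcongr
  have h2 : C ^ 2 * (L + 1) * kappa Sig0 ^ 4 * (mmin d * effDim Psi) ≤ (mmin d : ℝ) ^ 2 :=
    le_trans (by gcongr) h
  have h3 : mmin d * (C ^ 2 * (L + 1) * kappa Sig0 ^ 4 * effDim Psi) ≤ mmin d * (mmin d : ℝ) := by
    linarith
  exact le_of_mul_le_mul_left h3 hm

/-- Uses `d_max / d_k ≥ 1` in each mode to reach the form in which the rate is stated. -/
theorem effDim_le (hd : ∀ k, 1 ≤ d k)
    (Psi : (k : Fin L) → Matrix (Fin (d k)) (Fin (d k)) ℝ) :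
    effDim Psi ≤ dmax d * ((∑ k, (offSupp (Psi k) : ℝ) * Real.log (pdim d) / d k) + L) := by
  rw [effDim, mul_add, mul_comm (dmax d : ℝ) (L : ℝ), Finset.sum_mul, Finset.mul_sum]
  refine add_le_add (Finset.sum_le_sum fun k _ => ?_) le_rfl
  have h1 : (0 : ℝ) < d k := by exact_mod_cast hd k
  have h2 : (d k : ℝ) ≤ dmax d := by exact_mod_cast le_dmax k
  have h3 : 0 ≤ (offSupp (Psi k) : ℝ) * Real.log (pdim d) :=
    mul_nonneg (by positivity) log_pdim_nonneg
  rw [mul_div_assoc', le_div_iff₀ h1, mul_comm]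
  exact mul_le_mul_of_nonneg_right h2 h3

/-- Existence of minimizers and their rate, on the event that the Gram matrices concentrate. -/
theorem rate_of_deviation_bounds (hL : 1 ≤ L) (hd : ∀ k, 1 ≤ d k) {x : Idx d → ℝ}
    {ρ : Fin L → ℝ} {Psi : (k : Fin L) → Matrix (Fin (d k)) (Fin (d k)) ℝ}
    {Sig0 : Matrix (Idx d) (Idx d) ℝ} (hPsi : (kronSum Psi).PosDef)
    (hSig : Sig0 = (kronSum Psi)⁻¹) {b T : ℝ} (hb : 0 ≤ b) (hT : 0 < T) (hρ0 : ∀ k, 0 ≤ ρ k)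
    (hρ : ∀ k, ρ k ≤ b * (opNorm Sig0 * √(Real.log (pdim d) / mdim d k)))
    (hA3 : (10 * (2 * b + T)) ^ 2 * (L + 1) * kappa Sig0 ^ 4 * effDim Psi ≤ mmin d)
    (hoff : ∀ k, ∀ a b : Fin (d k), a ≠ b →
      |deviation x Sig0 (modeEmbed k (Matrix.single a b 1))| ≤ mdim d k * ρ k)
    (hdiag : ∀ D : (k : Fin L) → Matrix (Fin (d k)) (Fin (d k)) ℝ,
      |deviation x Sig0 (kronSum fun k => diagPart (D k))|
        ≤ T * opNorm Sig0 * √(L * dmax d) * frobNorm (kronSum fun k => diagPart (D k))) :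
    (∃ Ωhat, IsTeraLasso x ρ Ωhat) ∧
      ∀ Ωhat, IsTeraLasso x ρ Ωhat →
        max (opNorm (Ωhat - kronSum Psi) / opNorm (kronSum Psi))
            (frobNorm (Ωhat - kronSum Psi) / frobNorm (kronSum Psi)) ≤
          10 * (2 * b + T) * kappa Sig0 * √(L * dmax d / mmin d) *
            √((∑ k, (offSupp (Psi k) : ℝ) * Real.log (pdim d) / d k) + L) := by
  have hne : Nonempty (Idx d) := ⟨fun k => ⟨0, hd k⟩⟩
  have hm : (0 : ℝ) < mmin d := by exact_mod_cast mmin_pos hL hd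
  have hLr : (1 : ℝ) ≤ L := by exact_mod_cast hL
  have hQ := effDim_pos hL hd Psi
  have hlp : 0 ≤ Real.log (pdim d) := log_pdim_nonneg
  have hQ' := effDim_le hd Psi
  set σ := opNorm Sig0 with hσ
  set w := opNorm (kronSum Psi) with hw
  set Q := effDim Psi with hQdef
  set Λ₀ := 2 * b + T with hΛ₀
  clear_value σ w Q Λ₀
  have hΛ₀pos : 0 < Λ₀ := by rw [hΛ₀]; positivity
  have hSigPD : Sig0.PosDef := by rw [hSig]; exact hPsi.inv
  have hinv : Sig0⁻¹ = kronSum Psi := by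
    rw [hSig, nonsing_inv_nonsing_inv _ hPsi.det_pos.ne'.isUnit]
  have hκ : σ * w ≤ kappa Sig0 := by
    have := opNorm_mul_opNorm_inv_le_kappa hSigPD
    rwa [hinv, ← hσ, ← hw] at this
  have hprod : 1 ≤ σ * w := by
    have h1 : Sig0 * kronSum Psi = 1 := by
      rw [hSig]; exact nonsing_inv_mul _ hPsi.det_pos.ne'.isUnit
    have h2 := opNorm_mul_le Sig0 (kronSum Psi)
    rw [h1, ← hσ, ← hw] at h2
    have h3 : opNorm (1 : Matrix (Idx d) (Idx d) ℝ) = 1 := by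
      rw [opNorm, map_one, norm_one]
    rwa [h3] at h2
  have hσ0 : 0 < σ := by
    rcases (hσ ▸ opNorm_nonneg Sig0 : 0 ≤ σ).eq_or_lt with h | h
    · rw [← h] at hprod; linarith
    · exact h
  have hw0 : 0 < w := by
    by_contra h
    nlinarith [not_lt.1 h]
  obtain ⟨W, hW⟩ : ∃ W, W = b * σ * √(Real.log (pdim d)) := ⟨_, rfl⟩
  have hW0 : 0 ≤ W := by rw [hW]; positivity
  have hρW : ∀ k, mdim d k * ρ k ^ 2 ≤ W ^ 2 := by
    intro k
    have hmk : (0 : ℝ) < mdim d k := by exact_mod_cast mdim_pos hd k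
    have h1 : ρ k ^ 2 ≤ (b * (σ * √(Real.log (pdim d) / mdim d k))) ^ 2 :=
      pow_le_pow_left₀ (hρ0 k) (hρ k) 2
    calc mdim d k * ρ k ^ 2 ≤ mdim d k * (b * (σ * √(Real.log (pdim d) / mdim d k))) ^ 2 := by
          gcongr
      _ = W ^ 2 := by
          rw [hW, mul_pow, mul_pow, mul_pow, mul_pow, Real.sq_sqrt (by positivity),
            Real.sq_sqrt hlp]
          field_simp
  have hlin := linear_part_ge hρ0 hW0 hρW hoff hdiag (by positivity) Psi
  obtain ⟨Λ, hΛ⟩ : ∃ Λ, Λ = 2 * W * √(∑ k, (offSupp (Psi k) : ℝ)) + T * σ * √(L * dmax d) :=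
    ⟨_, rfl⟩
  rw [← hΛ] at hlin
  have hΛle : Λ ≤ Λ₀ * σ * √Q := by
    have h1 : √(Real.log (pdim d)) * √(∑ k, (offSupp (Psi k) : ℝ)) ≤ √Q := by
      rw [← Real.sqrt_mul hlp]
      refine Real.sqrt_le_sqrt ?_
      rw [hQdef, effDim, mul_comm]
      have : (0 : ℝ) ≤ L * dmax d := by positivity
      linarith
    have h2 : √(L * dmax d) ≤ √Q := by
      refine Real.sqrt_le_sqrt ?_
      rw [hQdef, effDim]
      have : 0 ≤ (∑ k, (offSupp (Psi k) : ℝ)) * Real.log (pdim d) :=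
        mul_nonneg (by positivity) hlp
      linarith
    calc Λ = 2 * b * σ * (√(Real.log (pdim d)) * √(∑ k, (offSupp (Psi k) : ℝ)))
          + T * σ * √(L * dmax d) := by rw [hΛ, hW]; ring
      _ ≤ 2 * b * σ * √Q + T * σ * √Q := by gcongr
      _ = _ := by rw [hΛ₀]; ring
  -- The constant `5` beats the `4` of the log-determinant bound strictly.
  obtain ⟨r, hr⟩ : ∃ r, r = 5 * Λ₀ * w ^ 2 * σ * √Q := ⟨_, rfl⟩
  have hsQ : 0 < √Q := Real.sqrt_pos.2 hQ
  have hr0 : 0 < r := by rw [hr]; positivity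
  obtain ⟨g, hg⟩ : ∃ g, g = √((L + 1) / mmin d) := ⟨_, rfl⟩
  have hg0 : 0 ≤ g := by rw [hg]; positivity
  have hrΛ : 4 * w ^ 2 * Λ < r := by
    calc 4 * w ^ 2 * Λ ≤ 4 * w ^ 2 * (Λ₀ * σ * √Q) := by gcongr
      _ < 5 * (w ^ 2 * (Λ₀ * σ * √Q)) := by
          have : 0 < w ^ 2 * (Λ₀ * σ * √Q) := by positivity
          linarith
      _ = r := by rw [hr]; ring
  have hκ1 : 1 ≤ kappa Sig0 := hprod.trans hκ
  -- Here (A3) is used: `σ g r = 5 Λ₀ (σw)² g √Q`, and `(σw)² ≤ κ²` accounts for the fourth power of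
  -- `κ` after squaring.
  have hsmall : σ * (g * r) ≤ 1 / 2 := by
    have h1 : 10 * Λ₀ * kappa Sig0 ^ 2 * (g * √Q) ≤ 1 := by
      rw [hg, ← Real.sqrt_mul (by positivity),
        ← Real.sqrt_sq (by positivity : 0 ≤ 10 * Λ₀ * kappa Sig0 ^ 2),
        ← Real.sqrt_mul (by positivity), Real.sqrt_le_one, div_mul_eq_mul_div, mul_div_assoc',
        div_le_one hm]
      refine le_trans (le_of_eq ?_) hA3
      ring
    have h2 : (σ * w) ^ 2 ≤ kappa Sig0 ^ 2 := by gcongr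
    calc σ * (g * r) = 5 * Λ₀ * (σ * w) ^ 2 * (g * √Q) := by rw [hr]; ring
      _ ≤ 5 * Λ₀ * kappa Sig0 ^ 2 * (g * √Q) := by gcongr
      _ ≤ 1 / 2 := by linarith
  have hopfrob : ∀ D : (k : Fin L) → Matrix (Fin (d k)) (Fin (d k)) ℝ,
      opNorm (kronSum D) ≤ g * frobNorm (kronSum D) := by
    intro D
    rw [hg, frobNorm_eq_sqrt, ← Real.sqrt_mul (by positivity)]
    refine Real.le_sqrt_of_sq_le ?_
    rw [div_mul_eq_mul_div, le_div_iff₀ hm, mul_comm]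
    exact mmin_mul_opNorm_sq_le hL hd D
  obtain ⟨hex, hall⟩ := exists_isTeraLasso_and_frobNorm_le hL hd (x := x) (ρ := ρ) hPsi hr0
    (by rw [← hSig, ← hσ, ← hg]; exact hsmall)
    (fun B hB hgt => objective_lt_of_frobNorm_gt hL hd hPsi hr0 (by rw [← hSig]; exact hlin)
      (by rw [← hw]; exact hrΛ) (by rw [← hSig, ← hσ, ← hg]; exact hsmall) hB hgt)
  refine ⟨hex, fun Ωhat hΩ => ?_⟩
  obtain ⟨D, hD, hDr⟩ := hall Ωhat hΩ
  rw [hD]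
  -- Both relative errors are at most `g r / w`: the operator error because `‖Δ‖₂ ≤ g ‖Δ‖_F`, the
  -- Frobenius error because the same comparison for `Ω₀` gives `w ≤ g ‖Ω₀‖_F`.
  have hgr : g * r / w ≤ 10 * Λ₀ * kappa Sig0 * √(L * dmax d / mmin d) *
      √((∑ k, (offSupp (Psi k) : ℝ) * Real.log (pdim d) / d k) + L) := by
    set Q' := (∑ k, (offSupp (Psi k) : ℝ) * Real.log (pdim d) / d k) + (L : ℝ) with hQ'def
    have h1 : g * √Q ≤ 2 * (√(L * dmax d / mmin d) * √Q') := by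
      rw [hg, ← Real.sqrt_mul (by positivity), ← Real.sqrt_mul (by positivity),
        show (2 : ℝ) = √4 by rw [show (4 : ℝ) = 2 ^ 2 by norm_num]; simp,
        ← Real.sqrt_mul (by norm_num)]
      refine Real.sqrt_le_sqrt ?_
      rw [div_mul_eq_mul_div, div_mul_eq_mul_div, mul_div_assoc']
      refine div_le_div_of_nonneg_right ?_ hm.le
      calc ((L : ℝ) + 1) * Q ≤ (4 * L) * (dmax d * Q') := by
            gcongr
            linarith
        _ = _ := by ring
    calc g * r / w = 5 * Λ₀ * (σ * w) * (g * √Q) := by rw [hr]; field_simp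
      _ ≤ 5 * Λ₀ * kappa Sig0 * (2 * (√(L * dmax d / mmin d) * √Q')) := by gcongr
      _ = _ := by ring
  refine le_trans (max_le ?_ ?_) hgr
  · gcongr
    exact (hopfrob D).trans (by gcongr)
  · have h1 := hopfrob Psi
    rw [← hw] at h1
    have h2 : 0 < frobNorm (kronSum Psi) := by
      by_contra hcon
      have : frobNorm (kronSum Psi) = 0 := le_antisymm (not_lt.1 hcon) (frobNorm_nonneg _)
      rw [this, mul_zero] at h1
      linarith
    rw [div_le_div_iff₀ h2 hw0]
    calc frobNorm (kronSum D) * w ≤ r * (g * frobNorm (kronSum Psi)) := by gcongr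
      _ = _ := by ring

end Rate

/-! ### The probability of the good event -/

section Probability

open Matrix

variable {L : ℕ} {d : Fin L → ℕ} {S : Type*} [MeasurableSpace S] {μ : Measure S}
  [IsProbabilityMeasure μ] {t : ℝ}

theorem eexp_log_natCast {n : ℕ} (hn : 0 < n) : eexp (Real.log n) = n := by
  rw [eexp, Real.exp_log (by exact_mod_cast hn), ENNReal.ofReal_natCast]

/-- The union over at most `p²` entries per mode costs `exp(2 log p)` of the available `exp(-5 log
p)`. -/
theorem SubgaussianFamily.measure_exists_deviation_ge_le (hd : ∀ k, 1 ≤ d k)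
    {Z : Idx d → S → ℝ} (h : SubgaussianFamily μ t Z) {R Sig0 : Matrix (Idx d) (Idx d) ℝ}
    (hR : Rᵀ = R) (hRR : R * R = Sig0) (hσ : 0 < opNorm Sig0)
    (hlog : Real.log (pdim d) ≤ mmin d) :
    μ (⋃ k, ⋃ a : Fin (d k), ⋃ b : Fin (d k),
      {ω | mdim d k * (192 * t ^ 2 * (opNorm Sig0 * √(Real.log (pdim d) / mdim d k)))
        ≤ |deviation (R *ᵥ fun i => Z i ω) Sig0 (modeEmbed k (Matrix.single a b 1))|})
      ≤ L * (2 * eexp (-3 * Real.log (pdim d))) := by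
  have hp := pdim_pos hd
  set q := Real.log (pdim d) with hq
  have hk : ∀ k : Fin L, μ (⋃ a : Fin (d k), ⋃ b : Fin (d k),
      {ω | mdim d k * (192 * t ^ 2 * (opNorm Sig0 * √(q / mdim d k)))
        ≤ |deviation (R *ᵥ fun i => Z i ω) Sig0 (modeEmbed k (Matrix.single a b 1))|})
      ≤ 2 * eexp (-3 * q) := by
    intro k
    have hdk : (d k : ENNReal) ≤ eexp q := by
      rw [hq, eexp_log_natCast hp]
      have : d k ≤ pdim d := by
        rw [← mul_mdim k]; exact Nat.le_mul_of_pos_right _ (mdim_pos hd k)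
      exact_mod_cast this
    have hqm : q ≤ mdim d k := hlog.trans (by exact_mod_cast mmin_le k)
    refine (measure_iUnion_fintype_le _ _).trans ?_
    refine (Finset.sum_le_sum fun a _ => (measure_iUnion_fintype_le _ _).trans
      (Finset.sum_le_sum fun b _ => h.measure_deviation_single_ge_le hd hR hRR hσ k
        log_pdim_nonneg hqm a b)).trans ?_
    simp only [Finset.sum_const, Finset.card_univ, Fintype.card_fin, nsmul_eq_mul]
    calc (d k : ENNReal) * (d k * (2 * eexp (-5 * q)))
        ≤ eexp q * (eexp q * (2 * eexp (-5 * q))) := by gcongr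
      _ = 2 * (eexp q * eexp q * eexp (-5 * q)) := by ring
      _ = 2 * eexp (-3 * q) := by
          rw [← eexp_add, ← eexp_add]; congr 2; ring
  refine (measure_iUnion_fintype_le _ _).trans ((Finset.sum_le_sum fun k _ => hk k).trans_eq ?_)
  simp

/-- With `y = 1/p ≤ 1/2`, `(2L + 1)y³ ≤ 3L y³ ≤ (3/4) L y`. -/
theorem three_mul_eexp_le (hL : 1 ≤ L) {p : ℕ} (hp : 2 ≤ p) :
    L * (2 * eexp (-3 * Real.log p)) + eexp (-3 * Real.log p)
      ≤ ENNReal.ofReal (L * Real.exp (-1 * Real.log p)) := by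
  have hp0 : (0 : ℝ) < p := by positivity
  have hLr : (1 : ℝ) ≤ L := by exact_mod_cast hL
  set y := Real.exp (-1 * Real.log p) with hy
  have hy0 : 0 < y := Real.exp_pos _
  have hy1 : y ≤ 1 / 2 := by
    rw [hy, neg_one_mul, Real.exp_neg, Real.exp_log hp0, inv_eq_one_div]
    gcongr
    exact_mod_cast hp
  have h3 : Real.exp (-3 * Real.log p) = y ^ 3 := by
    rw [hy, ← Real.exp_nat_mul]; push_cast; ring_nf
  rw [eexp, h3, ← ENNReal.ofReal_natCast L, show (2 : ENNReal) = ENNReal.ofReal 2 by simp,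
    ← ENNReal.ofReal_mul (by norm_num), ← ENNReal.ofReal_mul (by positivity),
    ← ENNReal.ofReal_add (by positivity) (by positivity)]
  refine ENNReal.ofReal_le_ofReal ?_
  have h4 : y ^ 2 ≤ 1 / 4 := by nlinarith
  have h5 : y ^ 3 ≤ L * y ^ 3 := le_mul_of_one_le_left (by positivity) hLr
  have h6 : L * y ^ 3 ≤ L * (y * (1 / 4)) := by
    have : y ^ 3 = y * y ^ 2 := by ring
    rw [this]; gcongr
  have h7 : 0 < L * y := by positivity
  linarith

end Probability

end TeraLasso

end

/-! ### Choice of constants and assembly. -/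

open TeraLasso in
/-- `a₁`, `c` depend only on the bound `K` on the `ψ₂` norms; `C₃`, `C` depend only on `K`, on the
upper constant `a₂` in the choice of the penalties and on the lower bound `ε₀` of the `ε k`.
The exceptional set need not be measurable: `μ` of it is the outer measure. -/
theorem mainTheorem3 (K : ℝ) (hK : 0 < K) :
    ∃ a₁ c : ℝ, 0 < a₁ ∧ 0 < c ∧
      ∀ a₂ ε₀ : ℝ, a₁ ≤ a₂ → 0 < ε₀ → ε₀ < 1 →
        ∃ C₃ C : ℝ, 0 < C₃ ∧ 0 < C ∧
          ∀ (L : ℕ) (d : Fin L → ℕ) (Psi : (k : Fin L) → Matrix (Fin (d k)) (Fin (d k)) ℝ)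
            (Omega0 Sig0 : Matrix (Idx d) (Idx d) ℝ) (ρ : Fin L → ℝ) (kLow kUp : ℝ)
            (S : Type*) [MeasurableSpace S] (μ : Measure S) [IsProbabilityMeasure μ]
            (X : S → Idx d → ℝ),
            1 ≤ L → (∀ k, 1 ≤ d k) →
            (∀ k, (Psi k).IsSymm) → Omega0 = kronSum Psi → Sig0 = Omega0⁻¹ →
            IsSubgaussianTensor μ K Sig0 X →
            A1 a₁ a₂ ε₀ Sig0 ρ → A2 kLow kUp Omega0 → A3 C₃ Psi Sig0 →
            μ {ω | ¬ ((∃ Ωhat, IsTeraLasso (X ω) ρ Ωhat) ∧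
                ∀ Ωhat, IsTeraLasso (X ω) ρ Ωhat →
                  max (opNorm (Ωhat - Omega0) / opNorm Omega0)
                      (frobNorm (Ωhat - Omega0) / frobNorm Omega0) ≤
                    C * kappa Sig0 * √(L * dmax d / mmin d) *
                      √((∑ k, (offSupp (Psi k) : ℝ) * Real.log (pdim d) / d k) + L))}
              ≤ ENNReal.ofReal (L * Real.exp (-c * Real.log (pdim d))) := by
  set t : ℝ := 2 * K with ht
  have ht0 : 0 < t := by positivity
  refine ⟨192 * t ^ 2, 1, by positivity, one_pos, fun a₂ ε₀ ha₂ hε₀ _ => ?_⟩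
  have ha₂0 : 0 < a₂ := lt_of_lt_of_le (by positivity) ha₂
  set b := a₂ / ε₀ with hb
  set T := 4 * (5 + 256 * t ^ 4) with hT
  have hb0 : 0 < b := by positivity
  have hT0 : 0 < T := by positivity
  -- The first summand of `C₃` makes the radius small in the deterministic step; the second keeps
  -- the diagonal bound in the range of Hanson–Wright.
  refine ⟨10 * (2 * b + T) + 32 * t ^ 2, 10 * (2 * b + T), by positivity, by positivity, ?_⟩
  intro L d Psi Omega0 Sig0 ρ kLow kUp S _ μ _ X hL hd hPsi hOm hSig hX hA1 hA2 hA3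
  subst hOm
  have hne : Nonempty (Idx d) := ⟨fun k => ⟨0, hd k⟩⟩
  have hm : (0 : ℝ) < mmin d := by exact_mod_cast mmin_pos hL hd
  -- For `p = 1` the claimed bound is `L ≥ 1`, and nothing is to be proved; `p ≥ 2` is needed to
  -- absorb the factor `3`.
  rcases Nat.lt_or_ge (pdim d) 2 with hp | hp
  · have hp1 : pdim d = 1 := by have := pdim_pos hd; omega
    refine prob_le_one.trans ?_
    rw [hp1, Nat.cast_one, Real.log_one, mul_zero, Real.exp_zero, mul_one, ← ENNReal.ofReal_one]
    exact ENNReal.ofReal_le_ofReal (by exact_mod_cast hL)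
  have hherm : (kronSum Psi).IsHermitian := by
    rw [Matrix.IsHermitian, Matrix.conjTranspose_eq_transpose_of_trivial, kronSum_eq_sum,
      Matrix.transpose_sum]
    refine Finset.sum_congr rfl fun k _ => ?_
    rw [modeEmbed_transpose, (hPsi k).eq]
  have hPD : (kronSum Psi).PosDef := posDef_of_phiMin_pos hherm (hA2.1.trans_le hA2.2.1)
  have hSigPD : Sig0.PosDef := by rw [hSig]; exact hPD.inv
  have hprod : 1 ≤ opNorm Sig0 * opNorm Sig0⁻¹ := by
    have h1 : Sig0 * Sig0⁻¹ = 1 := Matrix.mul_nonsing_inv _ hSigPD.det_pos.ne'.isUnit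
    have h2 := opNorm_mul_le Sig0 Sig0⁻¹
    rw [h1, opNorm, map_one, norm_one] at h2
    exact h2
  have hκ1 : 1 ≤ kappa Sig0 := hprod.trans (opNorm_mul_opNorm_inv_le_kappa hSigPD)
  have hσ0 : 0 < opNorm Sig0 :=
    lt_of_le_of_ne (opNorm_nonneg _) fun h => by rw [← h] at hprod; linarith
  obtain ⟨Z, hZm, hZi, hZ0, hZ1, hZψ, hXZ⟩ := hX
  have hfam : SubgaussianFamily μ t Z :=
    ⟨hZm, hZi, hZ0, hZ1, fun i => lintegral_eexp_le_of_psi2Norm_le hK (hZψ i), ht0⟩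
  obtain ⟨R, hR, hRR, hXR⟩ : ∃ R : Matrix (Idx d) (Idx d) ℝ, R.transpose = R ∧ R * R = Sig0 ∧
      ∀ᵐ ω ∂μ, X ω = R.mulVec fun i => Z i ω :=
    ⟨_, (sqrt_mul_self_and_symm hSigPD).2, (sqrt_mul_self_and_symm hSigPD).1, hXZ⟩
  obtain ⟨hlog, δ, ε, hδ⟩ := hA1
  have hA3' := mmin_ge_of_A3 hL hd hA3
  have hQ := effDim_pos hL hd Psi
  have hA3r : (10 * (2 * b + T)) ^ 2 * (L + 1) * kappa Sig0 ^ 4 * effDim Psi ≤ mmin d := by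
    refine le_trans ?_ hA3'
    gcongr
    linarith [sq_nonneg t]
  have hA3d : (32 * t ^ 2) ^ 2 * ((L + 1) * (L * dmax d)) ≤ mmin d := by
    refine le_trans ?_ hA3'
    have h1 : L * dmax d ≤ effDim Psi := by
      have : 0 ≤ (∑ k, (offSupp (Psi k) : ℝ)) * Real.log (pdim d) :=
        mul_nonneg (by positivity) log_pdim_nonneg
      rw [effDim]; linarith
    have h2 : 1 ≤ kappa Sig0 ^ 4 := one_le_pow₀ hκ1
    calc (32 * t ^ 2) ^ 2 * ((L + 1) * (L * dmax d))
        = (32 * t ^ 2) ^ 2 * (L + 1) * 1 * (L * dmax d) := by ring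
      _ ≤ _ := by
          gcongr
          have : 0 < 10 * (2 * b + T) := by positivity
          linarith
  have hρ : ∀ k, 192 * t ^ 2 * (opNorm Sig0 * √(Real.log (pdim d) / mdim d k)) ≤ ρ k ∧
      ρ k ≤ b * (opNorm Sig0 * √(Real.log (pdim d) / mdim d k)) := by
    intro k
    obtain ⟨h1, h2, h3, h4, h5, h6⟩ := hδ k
    have h7 : 0 ≤ 192 * t ^ 2 * (opNorm Sig0 * √(Real.log (pdim d) / mdim d k)) := by positivity
    have h8 : 0 ≤ δ k := h7.trans h1
    rw [h6]
    refine ⟨h1.trans (le_div_self h8 h3 h4.le), ?_⟩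
    rw [hb, div_mul_eq_mul_div]
    exact div_le_div₀ (h8.trans h2) h2 hε₀ h5
  -- The bad set is covered by a null set, where `X = RZ` fails, and the two deviation events.
  -- Monotonicity and subadditivity hold for outer measure, so measurability is not needed.
  refine (measure_mono (t := {ω | ¬ X ω = R.mulVec fun i => Z i ω} ∪
    ((⋃ k, ⋃ a : Fin (d k), ⋃ b : Fin (d k),
      {ω | mdim d k * (192 * t ^ 2 * (opNorm Sig0 * √(Real.log (pdim d) / mdim d k)))
        ≤ |deviation (R.mulVec fun i => Z i ω) Sig0
          (modeEmbed k (Matrix.single a b 1))|}) ∪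
    {ω | ¬ ∀ D : (k : Fin L) → Matrix (Fin (d k)) (Fin (d k)) ℝ,
        |deviation (R.mulVec fun i => Z i ω) Sig0 (kronSum fun k => diagPart (D k))|
          ≤ T * opNorm Sig0 * √(L * dmax d) *
            frobNorm (kronSum fun k => diagPart (D k))})) fun ω hω => ?_).trans ?_
  · by_contra hgood
    rw [Set.mem_union, Set.mem_union, not_or, not_or] at hgood
    obtain ⟨hg1, hg2, hg3⟩ := hgood
    have hg1' : X ω = R.mulVec fun i => Z i ω := not_not.1 hg1
    have hg3' := not_not.1 hg3
    simp only [Set.mem_iUnion, not_exists] at hg2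
    refine hω ?_
    rw [hg1']
    refine rate_of_deviation_bounds hL hd hPD hSig hb0.le hT0
      (fun k => le_trans (by positivity) (hρ k).1) (fun k => (hρ k).2) hA3r
      (fun k a b _ => ?_) hg3'
    refine (not_le.1 (hg2 k a b)).le.trans ?_
    exact mul_le_mul_of_nonneg_left (hρ k).1 (by positivity)
  · refine (measure_union_le _ _).trans ?_
    have h0 : μ {ω | ¬ X ω = R.mulVec fun i => Z i ω} = 0 := ae_iff.1 hXR
    rw [h0, zero_add]
    refine (measure_union_le _ _).trans (le_trans (add_le_add
      (hfam.measure_exists_deviation_ge_le hd hR hRR hσ0 hlog)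
      (hfam.measure_deviation_diagonal_gt_le hL hd hR hRR hσ0 hA3d)) ?_)
    -- As `log p ≤ L d_max`, the diagonal event is also as rare as `exp(-3 log p)`.
    refine le_trans (add_le_add le_rfl (eexp_mono ?_)) (three_mul_eexp_le hL hp)
    have := log_pdim_le hd
    linarith
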